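/- Let $f$ be a real, zero-mean, statistically homogeneous random field on $\mathbb{R}^d$, periodic with respect to a box of side lengths $L_1,\dots,L_d>0$ and volume $V=L_1\cdots L_d$, with finite moments of all orders. Let $k\neq0$ be a wavevector of the box (components $2\pi m_i/L_i$, $m_i\in\mathbb{Z}$), $f_k=V^{-1/2}\int_{\rm box}f(x)e^{-ik\cdot x}\,dx$, $P(k)=\langle|f_k|^2\rangle$, and assume $P(k)>0$. Put $\alpha_{\pm k}=f_{\pm k}/\sqrt{P(k)}$, $\alpha_k=A e^{i\theta}$ with $A\ge0$, $0\le\theta<2\pi$, and let $q^{(2n)}(k)$ be the collapsed normalized polyspectrum, $q^{(2n)}(k)=V^{n-1}\langle(\alpha_k)^n(\alpha_{-k})^n\rangle_{\rm c}$, with $\langle\cdot\rangle_{\rm c}$ the joint cumulant. Then every $q^{(2n)}(k)$ is real, and the joint distribution of $(A,\theta)$ is given to all orders by $$P_1(A,\theta)=\frac{A}{\pi}\exp\Bigl[\sum_{n\ge2}\frac{q^{(2n)}(k)}{4^n(n!)^2V^{n-1}}\,B^n\Bigr]e^{-A^2},\qquad B=\partial_A^2+A^{-1}\partial_A ,\tag{$*$}$$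 in the following two senses. (1) Expand $(*)$ as a formal power series in $V^{-1}$ with the $q^{(2n)}$ fixed, and let $P_1^{<J}(A,\theta)$ be the sum of its terms of order $V^{0},\dots,V^{-(J-1)}$. For every polynomial $\varphi$ in $\alpha_k,\alpha_{-k}$ and every $J>\deg\varphi$, $\langle\varphi(\alpha_k,\alpha_{-k})\rangle=\int_0^\infty\!\int_0^{2\pi}\varphi(Ae^{i\theta},Ae^{-i\theta})\,P_1^{<J}(A,\theta)\,d\theta\,dA$, all integrals being absolutely convergent. Moreover, for every $J$, every polynomial $\varphi$, every $V_0>0$ and every sequence of bounds $(Q_n)_{n\ge2}$ there is a constant $C$ such that for all such fields and modes with $V\ge V_0$ and $|q^{(2n)}(k)|\le Q_n$ for $n\ge2$, the two sides differ by at most $CV^{-J}$. (2) Suppose that $F(x)=\sum_{n\ge2}\frac{q^{(2n)}(k)}{4^n(n!)^2V^{n-1}}x^n$ converges for every real $x$ and that $\kappa\mapsto e^{F(-\kappa^2)}e^{-\kappa^2/4}\kappa$ is integrable on $(0,\infty)$. Then $(A,\theta)$ has the joint density $(*)$ on $A>0$, $0\le\theta<2\pi$, where $G(B)$ is defined by the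 Hankel transform, $G(B)g(A)=\int_0^\infty G(-\kappa^2)\,\hat g(\kappa)J_0(\kappa A)\kappa\,d\kappa$ with $\hat g(\kappa)=\int_0^\infty g(A)J_0(\kappa A)A\,dA$. For $G(x)=x^n$ and $g=e^{-A^2}$ this is the $n$-fold application of the differential operator $B$ on $A>0$. The second-order expansion obtained from $(*)$ is, with $P_{\rm G}(A,\theta)=2Ae^{-A^2}/(2\pi)$ and $A>0$, $$\frac{P_1^{<3}}{P_{\rm G}}=1+\frac1V\Bigl(\tfrac14A^4-A^2+\tfrac12\Bigr)q^{(4)}+\frac1{V^2}\Bigl\{\Bigl(\tfrac1{36}A^6-\tfrac14A^4+\tfrac12A^2-\tfrac16\Bigr)q^{(6)}+\Bigl(\tfrac1{32}A^8-\tfrac12A^6+\tfrac94A^4-3A^2+\tfrac34\Bigr)[q^{(4)}]^2\Bigr\},$$ and by (1) the error of this expansion is $O(V^{-3})$ against polynomials. -/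

import Mathlib

open MeasureTheory

universe u

namespace FourierModes

/-! ### Cumulants -/

/-- The joint cumulant `⟨∏ᵢ Xᵢ⟩_c` of a finite family of complex random variables:
`∑_π (-1)^(|π|-1) (|π|-1)! ∏_{B ∈ π} 𝔼[∏_{i ∈ B} Xᵢ]`, the sum being over all set partitions `π` of
the index set into non-empty blocks. -/
noncomputable def jointCumulant {Ω : Type*} [MeasurableSpace Ω] (μ : Measure Ω)
    {ι : Type*} [Fintype ι] [DecidableEq ι] (X : ι → Ω → ℂ) : ℂ :=
  ∑ π : Finpartition (Finset.univ : Finset ι),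
    (-1 : ℂ) ^ (π.parts.card - 1) * ((π.parts.card - 1).factorial : ℂ) *
      ∏ B ∈ π.parts, ∫ ω, ∏ i ∈ B, X i ω ∂μ

/-! ### Homogeneous random fields in a periodic box -/

/-- A real, zero-mean, statistically homogeneous random field on `ℝ^d` with periodic boundary
conditions with respect to the box `∏ᵢ [0, Lᵢ]`, all of whose moments are finite. -/
structure PeriodicField (d : ℕ) where
  /-- the sample space -/
  Ω : Type u
  [mΩ : MeasurableSpace Ω]
  /-- the ensemble -/
  μ : Measure Ω
  [prob : IsProbabilityMeasure μ]
  /-- the side lengths of the box -/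
  L : Fin d → ℝ
  L_pos : ∀ i, 0 < L i
  /-- the field -/
  f : (Fin d → ℝ) → Ω → ℝ
  measurable_f : Measurable fun p : (Fin d → ℝ) × Ω => f p.1 p.2
  periodic : ∀ i x, ∀ᵐ ω ∂μ, f (x + Pi.single i (L i)) ω = f x ω
  homogeneous : ∀ (n : ℕ) (x : Fin n → Fin d → ℝ) (y : Fin d → ℝ),
    μ.map (fun ω (i : Fin n) => f (x i + y) ω) = μ.map (fun ω (i : Fin n) => f (x i) ω)
  moments : ∀ (x : Fin d → ℝ) (p : ℕ), Integrable (fun ω => |f x ω| ^ p) μ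
  mean_zero : ∀ x, ∫ ω, f x ω ∂μ = 0

attribute [instance] PeriodicField.mΩ PeriodicField.prob

namespace PeriodicField

variable {d : ℕ} (F : PeriodicField.{u} d)

/-- The volume of the box. -/
noncomputable def V : ℝ := ∏ i, F.L i

/-- The phase `k · x`, where the integer vector `k` stands for the wavevector with components
`2π kᵢ / Lᵢ`. -/
noncomputable def wavePhase (k : Fin d → ℤ) (x : Fin d → ℝ) : ℝ :=
  ∑ i, 2 * Real.pi * (k i : ℝ) / F.L i * x i

/-- The volume-normalized Fourier coefficient `f_k = V^{-1/2} ∫_box f(x) e^{-i k·x} dx`. -/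
noncomputable def fourierCoeff (k : Fin d → ℤ) (ω : F.Ω) : ℂ :=
  ((√F.V : ℝ) : ℂ)⁻¹ *
    ∫ x in Set.Icc (0 : Fin d → ℝ) F.L,
      (F.f x ω : ℂ) * Complex.exp (-Complex.I * (F.wavePhase k x : ℂ))

/-- The power spectrum `P(k) = ⟨|f_k|²⟩`. -/
noncomputable def powerSpectrum (k : Fin d → ℤ) : ℝ :=
  ∫ ω, ‖F.fourierCoeff k ω‖ ^ 2 ∂F.μ

/-- The polyspectrum of order `N = |ι|`, defined on families of wavevectors with sum zero by
`⟨f_{k₁} ⋯ f_{k_N}⟩_c = V^{1 - N/2} P^{(N)}`. -/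
noncomputable def polyspectrum {ι : Type*} [Fintype ι] [DecidableEq ι]
    (k : ι → Fin d → ℤ) : ℂ :=
  ((F.V ^ ((Fintype.card ι : ℝ) / 2 - 1) : ℝ) : ℂ) *
    jointCumulant F.μ (fun i => F.fourierCoeff (k i))

open Classical in
/-- The normalized polyspectrum `p^{(N)}(k₁, …, k_N)`. -/
noncomputable def normalizedPolyspectrum {ι : Type*} [Fintype ι] [DecidableEq ι]
    (k : ι → Fin d → ℤ) : ℂ :=
  if ∑ i, k i = 0 then F.polyspectrum k / ((√(∏ i, F.powerSpectrum (k i)) : ℝ) : ℂ) else 0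

/-- The normalized polyspectrum at `n` copies of `k` and `n` copies of `-k`. -/
noncomputable def collapsed (k : Fin d → ℤ) (n : ℕ) : ℂ :=
  F.normalizedPolyspectrum (Sum.elim (fun _ : Fin n => k) (fun _ : Fin n => -k))

/-- The collapsed polyspectrum `n ↦ q^{(2n)}(k)` as a real number (it is part of the theorem that
`collapsed` is real). -/
noncomputable def q (k : Fin d → ℤ) (n : ℕ) : ℝ := (F.collapsed k n).re

/-- The normalized mode `α_k = f_k / √P(k)`. -/
noncomputable def α (k : Fin d → ℤ) (ω : F.Ω) : ℂ :=
  F.fourierCoeff k ω / ((√(F.powerSpectrum k) : ℝ) : ℂ)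

end PeriodicField

/-- Polar coordinates `(A, θ)` of `z = A e^{iθ}` with `A ≥ 0` and `0 ≤ θ < 2π`. -/
noncomputable def polar (z : ℂ) : ℝ × ℝ :=
  (‖z‖, if z.arg < 0 then z.arg + 2 * Real.pi else z.arg)

/-- The range `A > 0`, `0 ≤ θ < 2π` of the polar coordinates of a non-zero number. -/
def polarDomain : Set (ℝ × ℝ) := Set.Ioi 0 ×ˢ Set.Ico 0 (2 * Real.pi)

/-- The value of a polynomial in `α_k` and `α_{-k}` at `α_k = A e^{iθ}`, `α_{-k} = A e^{-iθ}`. -/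
noncomputable def testValue (φ : MvPolynomial (Fin 2) ℂ) (p : ℝ × ℝ) : ℂ :=
  MvPolynomial.eval ![(p.1 : ℂ) * Complex.exp (Complex.I * p.2),
    (p.1 : ℂ) * Complex.exp (-Complex.I * p.2)] φ

/-! ### The operator `∂²_A + A⁻¹ ∂_A` and the exponential of a series in it -/

/-- The radial operator `∂²_A + A⁻¹ ∂_A`. -/
noncomputable def radialOp (g : ℝ → ℝ) (A : ℝ) : ℝ := deriv (deriv g) A + A⁻¹ * deriv g A

/-- The function `exp(-A²)`. -/
noncomputable def gauss (A : ℝ) : ℝ := Real.exp (-A ^ 2)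

/-- The coefficient `q^{(2n)} / (4^n (n!)²)`. -/
noncomputable def cumulantCoeff (q : ℕ → ℝ) (n : ℕ) : ℝ :=
  q n / (4 ^ n * (n.factorial : ℝ) ^ 2)

/-- The exponent `∑_{n ≥ 2} (q^{(2n)} / (4^n (n!)²)) ε^{n-1} X^n`, as a formal power series in
`ε = V⁻¹` with coefficients in the polynomials in the operator `X`. -/
noncomputable def exponent (q : ℕ → ℝ) : PowerSeries (Polynomial ℝ) :=
  PowerSeries.mk fun j =>
    if j = 0 then 0 else Polynomial.monomial (j + 1) (cumulantCoeff q (j + 1))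

/-- The exponential `∑_m S^m / m!` of a formal power series `S` without constant term (the
coefficient of `ε^j` receives contributions from `m ≤ j` only). -/
noncomputable def formalExp (S : PowerSeries (Polynomial ℝ)) : PowerSeries (Polynomial ℝ) :=
  PowerSeries.mk fun j =>
    ∑ m ∈ Finset.range (j + 1), ((m.factorial : ℝ)⁻¹) • PowerSeries.coeff j (S ^ m)

/-- A polynomial in the radial operator, applied to a function. -/
noncomputable def applyRadial (P : Polynomial ℝ) (g : ℝ → ℝ) (A : ℝ) : ℝ :=
  P.sum fun m c => c * (radialOp^[m] g) A

/-- The part of order below `V^{-J}` of the formal one-point density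
`(A/π) exp[∑_{n ≥ 2} q^{(2n)} / (4^n (n!)² V^{n-1}) (∂²_A + A⁻¹ ∂_A)^n] exp(-A²)`. -/
noncomputable def truncDensity (V : ℝ) (q : ℕ → ℝ) (J : ℕ) (p : ℝ × ℝ) : ℝ :=
  p.1 / Real.pi * ∑ j ∈ Finset.range J,
    (V⁻¹) ^ j * applyRadial (PowerSeries.coeff j (formalExp (exponent q))) gauss p.1

/-- The one-point density of a Gaussian field, `2 A exp(-A²) / (2π)`. -/
noncomputable def gaussDensity (p : ℝ × ℝ) : ℝ :=
  2 * p.1 * Real.exp (-p.1 ^ 2) / (2 * Real.pi)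

/-- The Bessel function `J₀`. -/
noncomputable def besselJ0 (z : ℝ) : ℝ :=
  (2 * Real.pi)⁻¹ * ∫ ψ in (0 : ℝ)..(2 * Real.pi), Real.cos (z * Real.cos ψ)

/-- The Hankel transform of order zero. -/
noncomputable def hankel (g : ℝ → ℝ) (κ : ℝ) : ℝ :=
  ∫ A in Set.Ioi (0 : ℝ), g A * besselJ0 (κ * A) * A

/-- The function `G(∂²_A + A⁻¹ ∂_A)` of the radial operator, applied to `g`. The operator is
diagonalized by the Hankel transform, `A ↦ J₀(κ A)` having the eigenvalue `-κ²`. -/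
noncomputable def radialCalculus (G : ℝ → ℝ) (g : ℝ → ℝ) (A : ℝ) : ℝ :=
  ∫ κ in Set.Ioi (0 : ℝ), G (-κ ^ 2) * hankel g κ * besselJ0 (κ * A) * κ

/-- The `n`-th term (`n ≥ 2` being written as `m + 2`) of the exponent at a real argument:
`q^{(2n)} / (4^n (n!)² V^{n-1}) x^n`. -/
noncomputable def symbolTerm (V : ℝ) (q : ℕ → ℝ) (x : ℝ) (m : ℕ) : ℝ :=
  cumulantCoeff q (m + 2) / V ^ (m + 1) * x ^ (m + 2)

/-- `x ↦ exp(∑_{n ≥ 2} q^{(2n)} / (4^n (n!)² V^{n-1}) x^n)`. -/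
noncomputable def expSymbol (V : ℝ) (q : ℕ → ℝ) (x : ℝ) : ℝ :=
  Real.exp (∑' m, symbolTerm V q x m)

/-- `(A/π) exp[∑_{n ≥ 2} q^{(2n)} / (4^n (n!)² V^{n-1}) (∂²_A + A⁻¹ ∂_A)^n] exp(-A²)`, the
exponential being a function of the radial operator. -/
noncomputable def closedDensity (V : ℝ) (q : ℕ → ℝ) (p : ℝ × ℝ) : ℝ :=
  p.1 / Real.pi * radialCalculus (expSymbol V q) gauss p.1

end FourierModes

namespace FourierModes

/-! ### Sums over set partitions -/

/-! Both sides are reduced to one identity of power series. Homogeneity makes `⟨f_k^a f_{-k}^b⟩`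
invariant under translations of the field, while periodicity lets a translation by `y` act on it as
the factor `e^{i(a-b)k·y}`. Hence the moment vanishes unless `a = b`
(`integral_shiftedMode_eq_zero`), and only `m_n = ⟨|f_k|^{2n}⟩` remain. For such diagonal moments a
sum over set partitions sees only how many copies of `k` and `-k` lie in each block, and
`sum_finpartition_diag` evaluates it: for `n ≥ 1` the cumulant of `n` copies of each mode is `(n!)²`
times the coefficient of `x^n` in `log(∑ m_n x^n / (n!)²)`. It is therefore real, and with `w_n =
⟨|α_k|^{2n}⟩ / (n!)²` and `F` the exponent of the closed form, `W(x) = ∑ w_n x^n = e^x e^{F(4x)}`.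
This is used in the coefficient form of `W' = K' W`, `K = log W` (`normMoment_recursion`).

On the side of the density let `B` be the radial operator. Since `B A^{2a} = 4a² A^{2a-2}`,
integration by parts shows that the moment of order `2a` of `(A/π) P(B) e^{-A²}`, angle included, is
`(a!)²` times the coefficient of `x^a` in `e^x P(4x)` (`factorialForm_sum_radialPoly`). The formal
exponential thus obeys the recursion of the moments (`sum_expCoeff_eq`). Each factor `V⁻¹` comes
with at least one `B`, so orders above `a` do not touch this moment. The truncation is exact for `J
> a`; otherwise the error is a finite block of terms of order at least `J`, bounded by putting the
bounds `Q` in place of `q`.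

For the closed density, convergence of `F` makes `W` entire (`hasSum_exp_of_recursion`), which gives
exponential moments of `|α_k|`. The characteristic function can then be expanded and equals
`W(-|t|²/4) = e^{-|t|²/4} e^{F(-|t|²)}` (`charFun_α`). It is radial and integrable, so Fourier
inversion (`eq_withDensity_fourier_charFun`) gives a density, which in polar coordinates is a Hankel
integral (`map_polar_of_charFun`). The factor `e^{-κ²/4}/2` is the Hankel transform of `e^{-A²}`,
which identifies this integral with the operator expression. -/

/-- Sums over set partitions, organized by the block of a given point. -/
theorem sum_finpartition_split {ι R : Type*} [DecidableEq ι] [CommSemiring R] (S : Finset ι) {s : ι}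
    (hs : s ∈ S) (g : ℕ → R) (M : Finset ι → R) :
    ∑ π : Finpartition S, g π.parts.card * ∏ B ∈ π.parts, M B =
      ∑ B ∈ S.powerset with s ∈ B, M B *
        ∑ π : Finpartition (S \ B), g (π.parts.card + 1) * ∏ C ∈ π.parts, M C := by
  classical
  rw [← Finset.sum_fiberwise_of_maps_to (s := Finset.univ) (t := S.powerset.filter (s ∈ ·))
    (g := fun π : Finpartition S => π.part s)]
  · refine Finset.sum_congr rfl fun B hB => ?_
    obtain ⟨hBS, hsB⟩ := Finset.mem_filter.1 hB
    rw [Finset.mem_powerset] at hBS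
    have hne : B ≠ ⊥ := Finset.ne_empty_of_mem hsB
    have hdis : Disjoint (S \ B) B := Finset.sdiff_disjoint
    have hsup : (S \ B) ⊔ B = S := Finset.sdiff_union_of_subset hBS
    -- `avoid B` subtracts `B` from every part and drops empty results; the other parts are disjoint
    -- from `B`, so only `B` itself disappears.
    have havoid : ∀ π : Finpartition S, B ∈ π.parts → (π.avoid B).parts = π.parts.erase B := by
      intro π hπ
      ext C
      rw [Finpartition.mem_avoid, Finset.mem_erase]
      constructor
      · rintro ⟨D, hD, hDB, rfl⟩
        have hne' : D ≠ B := fun h => hDB h.le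
        have : D \ B = D := Finset.sdiff_eq_self_of_disjoint (π.disjoint hD hπ hne')
        rw [this]
        exact ⟨hne', hD⟩
      · rintro ⟨hCB, hC⟩
        have hd := π.disjoint hC hπ hCB
        refine ⟨C, hC, fun h => ?_, Finset.sdiff_eq_self_of_disjoint hd⟩
        exact π.ne_bot hC (hd.eq_bot_of_le h)
    rw [Finset.mul_sum]
    -- Deleting the block `B` and adjoining it again are mutually inverse.
    refine Finset.sum_bij' (fun π _ => π.avoid B) (fun π' _ => π'.extend hne hdis hsup)
      (fun _ _ => Finset.mem_univ _) ?_ ?_ ?_ ?_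
    · intro π' _
      refine Finset.mem_filter.2 ⟨Finset.mem_univ _, ?_⟩
      exact Finpartition.part_eq_of_mem _ (by simp) hsB
    · intro π hπ
      have hpart : π.part s = B := (Finset.mem_filter.1 hπ).2
      have hB' : B ∈ π.parts := hpart ▸ (π.part_mem.2 hs)
      apply Finpartition.ext
      rw [Finpartition.extend_parts, havoid π hB', Finset.insert_erase hB']
    · intro π' _
      apply Finpartition.ext
      rw [havoid _ (by simp), Finpartition.extend_parts, Finset.erase_insert]
      intro h
      exact hne (hdis.symm.eq_bot_of_le (π'.le h))
    · intro π hπ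
      have hpart : π.part s = B := (Finset.mem_filter.1 hπ).2
      have hB' : B ∈ π.parts := hpart ▸ (π.part_mem.2 hs)
      rw [havoid π hB', Finset.card_erase_add_one hB', ← Finset.mul_prod_erase _ _ hB']
      ring
  · intro π _
    simp [Finpartition.part_subset, hs]

/-- A sum over the subsets of `S` containing `inl s` of a function of the numbers of elements of
the two kinds. -/
theorem sum_powerset_sum_apply_card {α β R : Type*} [DecidableEq α] [DecidableEq β]
    [CommSemiring R] (S : Finset (α ⊕ β)) {s : α} {a : ℕ} (hs : Sum.inl s ∈ S)
    (ha : S.toLeft.card = a + 1) (h : ℕ → ℕ → R) :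
    ∑ B ∈ S.powerset with Sum.inl s ∈ B, h B.toLeft.card B.toRight.card =
      ∑ i ∈ Finset.range (a + 1), ∑ j ∈ Finset.range (S.toRight.card + 1),
        (a.choose i : R) * (S.toRight.card.choose j : R) * h (i + 1) j := by
  have hcard : (S.toLeft.erase s).card = a := by
    rw [Finset.card_erase_of_mem (by simpa using hs), ha]; rfl
  have key : ∑ B ∈ S.powerset with Sum.inl s ∈ B, h B.toLeft.card B.toRight.card =
      ∑ T ∈ (S.toLeft.erase s).powerset, ∑ U ∈ S.toRight.powerset, h (T.card + 1) U.card := by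
    rw [Finset.sum_sigma']
    -- Such a subset is given freely by its left elements other than `s` and its right elements.
    refine Finset.sum_bij' (fun B _ => ⟨B.toLeft.erase s, B.toRight⟩)
      (fun p _ => (insert s p.1).disjSum p.2) ?_ ?_ ?_ ?_ ?_
    · intro B hB
      obtain ⟨hB, hsB⟩ := Finset.mem_filter.1 hB
      rw [Finset.mem_powerset] at hB
      simp only [Finset.mem_sigma, Finset.mem_powerset]
      exact ⟨Finset.erase_subset_erase _ (Finset.toLeft_subset_toLeft hB),
        Finset.toRight_subset_toRight hB⟩
    · rintro ⟨T, U⟩ h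
      simp only [Finset.mem_sigma, Finset.mem_powerset] at h
      refine Finset.mem_filter.2 ⟨?_, by simp⟩
      rw [Finset.mem_powerset, Finset.disjSum_subset]
      exact ⟨Finset.insert_subset (by simpa using hs) (h.1.trans (Finset.erase_subset _ _)), h.2⟩
    · intro B hB
      obtain ⟨hB, hsB⟩ := Finset.mem_filter.1 hB
      simp [Finset.insert_erase (Finset.mem_toLeft.2 hsB), Finset.toLeft_disjSum_toRight]
    · rintro ⟨T, U⟩ h
      simp only [Finset.mem_sigma, Finset.mem_powerset] at h
      have : s ∉ T := fun hT => by simpa using h.1 hT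
      simp [Finset.erase_insert this]
    · intro B hB
      obtain ⟨hB, hsB⟩ := Finset.mem_filter.1 hB
      simp only
      rw [Finset.card_erase_add_one (Finset.mem_toLeft.2 hsB)]
  rw [key, Finset.sum_powerset_apply_card (fun i => ∑ U ∈ S.toRight.powerset, h (i + 1) U.card),
    hcard]
  refine Finset.sum_congr rfl fun i _ => ?_
  rw [Finset.sum_powerset_apply_card (fun j => h (i + 1) j), nsmul_eq_mul, Finset.mul_sum]
  refine Finset.sum_congr rfl fun j _ => ?_
  rw [nsmul_eq_mul]; ring

/-! ### Generating functions of diagonal moments and cumulants -/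

/-- The generating function `∑_{n ≥ 1} m_n x^n / (n!)²`. -/
noncomputable def diagSeries (m : ℕ → ℝ) : PowerSeries ℝ :=
  PowerSeries.mk fun n => if n = 0 then 0 else m n / (n.factorial : ℝ) ^ 2

theorem coeff_diagSeries_succ (m : ℕ → ℝ) (n : ℕ) :
    PowerSeries.coeff (n + 1) (diagSeries m) = m (n + 1) / ((n + 1).factorial : ℝ) ^ 2 := by
  simp [diagSeries]

theorem constantCoeff_diagSeries (m : ℕ → ℝ) : PowerSeries.constantCoeff (diagSeries m) = 0 := by
  rw [← PowerSeries.coeff_zero_eq_constantCoeff_apply]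
  simp [diagSeries]

theorem coeff_pow_eq_zero {R : Type*} [CommRing R] {f : PowerSeries R}
    (hf : PowerSeries.constantCoeff f = 0) {n r : ℕ} (h : n < r) :
    PowerSeries.coeff n (f ^ r) = 0 := by
  have : PowerSeries.X ^ r ∣ f ^ r := pow_dvd_pow_of_dvd (PowerSeries.X_dvd_iff.2 hf) r
  exact PowerSeries.X_pow_dvd_iff.1 this n h

/-- The coefficient form of `(f^{r+1})' = (r+1) f' f^r`. -/
theorem succ_mul_coeff_pow_succ (f : PowerSeries ℝ) (a r : ℕ) :
    ((a : ℝ) + 1) * PowerSeries.coeff (a + 1) (f ^ (r + 1)) =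
      (r + 1) * ∑ i ∈ Finset.range (a + 1),
        ((i : ℝ) + 1) * PowerSeries.coeff (i + 1) f * PowerSeries.coeff (a - i) (f ^ r) := by
  have h1 : PowerSeries.derivative ℝ (f ^ (r + 1)) =
      ((r + 1 : ℕ) : PowerSeries ℝ) * (PowerSeries.derivative ℝ f * f ^ r) := by
    rw [Derivation.leibniz_pow]
    simp only [add_tsub_cancel_right, smul_eq_mul, nsmul_eq_mul]
    ring
  have h2 := congrArg (PowerSeries.coeff a) h1
  rw [PowerSeries.coeff_derivative, ← map_natCast (PowerSeries.C (R := ℝ)), PowerSeries.coeff_C_mul,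
    PowerSeries.coeff_mul, Finset.Nat.sum_antidiagonal_eq_sum_range_succ_mk] at h2
  rw [mul_comm, h2]
  push_cast
  congr 1
  refine Finset.sum_congr rfl fun i _ => ?_
  rw [PowerSeries.coeff_derivative]
  ring

/-- Sums over the set partitions of a set with elements of two kinds, when the weight of a block
vanishes unless it contains equally many elements of both kinds. -/
theorem sum_finpartition_diag {α β : Type*} [DecidableEq α] [DecidableEq β] (m : ℕ → ℝ)
    (M : Finset (α ⊕ β) → ℝ)
    (hM : ∀ B, M B = if B.toLeft.card = B.toRight.card then m B.toLeft.card else 0)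
    (a : ℕ) : ∀ (S : Finset (α ⊕ β)), S.toLeft.card = a → ∀ g : ℕ → ℝ,
    ∑ π : Finpartition S, g π.parts.card * ∏ B ∈ π.parts, M B =
      if a = S.toRight.card then (a.factorial : ℝ) ^ 2 * ∑ r ∈ Finset.range (a + 1),
        g r / r.factorial * PowerSeries.coeff a (diagSeries m ^ r) else 0 := by
  -- `g` is quantified inside the induction, because splitting off a block replaces `g r` by `g (r +
  -- 1)`.
  induction a using Nat.strong_induction_on with
  | _ a ih =>
    intro S hS g
    rcases a with _ | a
    · by_cases hb : S.toRight.card = 0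
      · have hS0 : S = ∅ := by
          rw [← Finset.card_eq_zero, ← Finset.card_toLeft_add_card_toRight, hS, hb]
        subst hS0
        have huniq : ∀ π : Finpartition (∅ : Finset (α ⊕ β)), π.parts = ∅ := fun π =>
          Finpartition.parts_eq_empty_iff.2 rfl
        have : (Finset.univ : Finset (Finpartition (∅ : Finset (α ⊕ β)))) =
            {Finpartition.empty _} :=
          Finset.eq_singleton_iff_unique_mem.2 ⟨Finset.mem_univ _, fun π _ =>
            Finpartition.ext ((huniq π).trans (huniq _).symm)⟩
        rw [this, Finset.sum_singleton, if_pos hb.symm]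
        simp
      -- Without left elements every block consists of right elements only, so its weight vanishes.
      · rw [if_neg (Ne.symm hb)]
        refine Finset.sum_eq_zero fun π _ => ?_
        have hne : S ≠ ⊥ := by
          rintro rfl
          exact hb rfl
        obtain ⟨B, hB⟩ := π.parts_nonempty hne
        have hBl : B.toLeft.card = 0 := by
          have := Finset.card_le_card (Finset.toLeft_subset_toLeft (π.subset hB))
          omega
        have hBr : B.toRight.card ≠ 0 := by
          intro h0
          have : B.card = 0 := by rw [← Finset.card_toLeft_add_card_toRight, hBl, h0]
          exact π.ne_empty hB (Finset.card_eq_zero.1 this)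
        rw [Finset.prod_eq_zero hB, mul_zero]
        rw [hM, if_neg]
        omega
    · obtain ⟨s, hs⟩ : S.toLeft.Nonempty := Finset.card_pos.1 (by omega)
      have hs' : Sum.inl s ∈ S := Finset.mem_toLeft.1 hs
      rw [sum_finpartition_split S hs']
      set b := S.toRight.card with hb
      obtain ⟨h, hh⟩ : ∃ h : ℕ → ℕ → ℝ, h = fun i j : ℕ => if i = j then
          (if a + 1 = b then m i * (((a + 1 - i).factorial : ℝ) ^ 2 *
            ∑ r ∈ Finset.range (a + 1 - i + 1), g (r + 1) / r.factorial *
              PowerSeries.coeff (a + 1 - i) (diagSeries m ^ r)) else 0) else 0 := ⟨_, rfl⟩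
      have hterm : ∀ B ∈ S.powerset.filter (Sum.inl s ∈ ·), M B *
          ∑ π : Finpartition (S \ B), g (π.parts.card + 1) * ∏ C ∈ π.parts, M C =
          h B.toLeft.card B.toRight.card := by
        intro B hB
        obtain ⟨hBS, hsB⟩ := Finset.mem_filter.1 hB
        rw [Finset.mem_powerset] at hBS
        have hBl : 0 < B.toLeft.card := Finset.card_pos.2 ⟨s, Finset.mem_toLeft.2 hsB⟩
        have h1 : B.toLeft.card ≤ S.toLeft.card :=
          Finset.card_le_card (Finset.toLeft_subset_toLeft hBS)
        have h2 : B.toRight.card ≤ S.toRight.card :=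
          Finset.card_le_card (Finset.toRight_subset_toRight hBS)
        have hl : (S \ B).toLeft.card = a + 1 - B.toLeft.card := by
          rw [Finset.toLeft_sdiff, Finset.card_sdiff_of_subset (Finset.toLeft_subset_toLeft hBS), hS]
        have hr : (S \ B).toRight.card = b - B.toRight.card := by
          rw [Finset.toRight_sdiff, Finset.card_sdiff_of_subset (Finset.toRight_subset_toRight hBS)]
        rw [ih (a + 1 - B.toLeft.card) (by omega) (S \ B) hl (fun r => g (r + 1)), hM, hr, hh]
        by_cases hd : B.toLeft.card = B.toRight.card
        · simp only [hd, if_true]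
          by_cases hab : a + 1 = b
          · rw [if_pos hab, if_pos (by omega)]
          · rw [if_neg hab, if_neg (by omega), mul_zero]
        · simp [hd]
      rw [Finset.sum_congr rfl hterm, sum_powerset_sum_apply_card S hs' hS, ← hb, hh]
      by_cases hab : a + 1 = b
      · rw [if_pos hab, ← hab]
        -- The block of `s` must contain equally many elements of both kinds, so only `j = i + 1`
        -- survives. The binomials and factorials combine to `(a+1)!² (i+1) / ((a+1) (i+1)!²)`, and
        -- the sum over `i` becomes the coefficient form of the derivative of `f^{r+1}`.
        have hinner : ∀ i ∈ Finset.range (a + 1), ∑ j ∈ Finset.range (a + 1 + 1),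
            (a.choose i : ℝ) * ((a + 1).choose j : ℝ) *
            (if i + 1 = j then (if a + 1 = a + 1 then m (i + 1) *
            (((a + 1 - (i + 1)).factorial : ℝ) ^ 2 *
              ∑ r ∈ Finset.range (a + 1 - (i + 1) + 1), g (r + 1) / r.factorial *
                PowerSeries.coeff (a + 1 - (i + 1)) (diagSeries m ^ r)) else 0) else 0) =
            ∑ r ∈ Finset.range (a + 1), ((a + 1).factorial : ℝ) ^ 2 *
              (g (r + 1) / (r + 1).factorial * (((r : ℝ) + 1) / ((a : ℝ) + 1) *
                (((i : ℝ) + 1) * PowerSeries.coeff (i + 1) (diagSeries m) *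
                  PowerSeries.coeff (a - i) (diagSeries m ^ r)))) := by
          intro i hi
          have hia : i ≤ a := by simpa [Nat.lt_succ_iff] using hi
          rw [Finset.sum_eq_single (i + 1)]
          · simp only [if_true, Nat.add_sub_add_right]
            -- The series has no constant term, so the added powers do not reach this coefficient; a
            -- range independent of `i` allows the two sums to be exchanged.
            have hext : ∑ r ∈ Finset.range (a - i + 1), g (r + 1) / r.factorial *
                PowerSeries.coeff (a - i) (diagSeries m ^ r) =
                ∑ r ∈ Finset.range (a + 1), g (r + 1) / r.factorial *
                PowerSeries.coeff (a - i) (diagSeries m ^ r) := by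
              refine Finset.sum_subset (by intro x; simp; omega) fun r _ hr => ?_
              rw [coeff_pow_eq_zero (constantCoeff_diagSeries m) (by simpa using hr), mul_zero]
            rw [hext, Finset.mul_sum, Finset.mul_sum, Finset.mul_sum]
            refine Finset.sum_congr rfl fun r _ => ?_
            rw [coeff_diagSeries_succ, Nat.cast_choose ℝ hia,
              Nat.cast_choose ℝ (Nat.succ_le_succ hia), Nat.succ_eq_add_one, Nat.succ_eq_add_one,
              Nat.add_sub_add_right]
            have e1 : ((a + 1).factorial : ℝ) = (a + 1) * a.factorial := by
              rw [Nat.factorial_succ]; push_cast; ring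
            have e2 : ((i + 1).factorial : ℝ) = (i + 1) * i.factorial := by
              rw [Nat.factorial_succ]; push_cast; ring
            have e3 : ((r + 1).factorial : ℝ) = (r + 1) * r.factorial := by
              rw [Nat.factorial_succ]; push_cast; ring
            rw [e1, e2, e3]
            have : (a.factorial : ℝ) ≠ 0 := by positivity
            have : (i.factorial : ℝ) ≠ 0 := by positivity
            have : (r.factorial : ℝ) ≠ 0 := by positivity
            have : ((a - i).factorial : ℝ) ≠ 0 := by positivity
            have : (a : ℝ) + 1 ≠ 0 := by positivity
            have : (i : ℝ) + 1 ≠ 0 := by positivity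
            have : (r : ℝ) + 1 ≠ 0 := by positivity
            field_simp
          · intro j _ hj
            rw [if_neg (Ne.symm hj), mul_zero]
          · intro h
            simp at h; omega
        rw [Finset.sum_congr rfl hinner, Finset.sum_comm, Finset.sum_range_succ' _ (a + 1)]
        have h0 : PowerSeries.coeff (a + 1) (diagSeries m ^ 0) = 0 := by
          rw [pow_zero, PowerSeries.coeff_one, if_neg (Nat.succ_ne_zero a)]
        rw [h0, mul_zero, add_zero, Finset.mul_sum]
        refine Finset.sum_congr rfl fun r _ => ?_
        rw [← Finset.mul_sum, ← Finset.mul_sum, ← Finset.mul_sum]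
        have h1 := succ_mul_coeff_pow_succ (diagSeries m) a r
        have ha : (a : ℝ) + 1 ≠ 0 := by positivity
        congr 2
        rw [div_mul_eq_mul_div, ← h1, mul_div_assoc, mul_comm, div_mul_cancel₀ _ ha]
      · simp [hab]

/-- The cumulant `κ_n` of `n` copies of `X` and `n` copies of `Y`, when the mixed moments of `X`
and `Y` are `𝔼[X^a Y^b] = δ_{ab} m_a`. -/
noncomputable def diagCumulant (m : ℕ → ℝ) (n : ℕ) : ℝ :=
  (n.factorial : ℝ) ^ 2 * ∑ r ∈ Finset.range (n + 1),
    (-1 : ℝ) ^ (r - 1) * ((r - 1).factorial : ℝ) / r.factorial *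
      PowerSeries.coeff n (diagSeries m ^ r)

/-- The coefficient form of `M' = K' M`, where `M` and `K` are the generating functions of the
moments and of the cumulants. -/
theorem diagCumulant_recursion (m : ℕ → ℝ) (h0 : m 0 = 1) (a : ℕ) :
    ((a : ℝ) + 1) * (m (a + 1) / ((a + 1).factorial : ℝ) ^ 2) =
      ∑ i ∈ Finset.range (a + 1), ((i : ℝ) + 1) *
        (diagCumulant m (i + 1) / ((i + 1).factorial : ℝ) ^ 2) *
          (m (a - i) / ((a - i).factorial : ℝ) ^ 2) := by
  set f := diagSeries m with hf
  have hf0 : PowerSeries.constantCoeff f = 0 := constantCoeff_diagSeries m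
  have hM : ∀ n, m n / (n.factorial : ℝ) ^ 2 = PowerSeries.coeff n (1 + f) := by
    intro n
    rcases n with _ | n
    · simp [h0, hf0]
    · rw [map_add, coeff_diagSeries_succ, PowerSeries.coeff_one, if_neg (Nat.succ_ne_zero n),
        zero_add]
  -- As `(r-1)!/r! = 1/r`, the cumulants generate `log(1 + f)`, whose derivative is `f'` times the
  -- geometric series of `-f`. Powers above `a` do not reach the coefficients in question. The
  -- summand `r = 0` of the cumulant, with its truncated `r - 1`, drops out because `f^0` has no
  -- coefficient of positive order.
  have hK : ∀ i ∈ Finset.range (a + 1), ((i : ℝ) + 1) *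
        (diagCumulant m (i + 1) / ((i + 1).factorial : ℝ) ^ 2) =
      PowerSeries.coeff i ((∑ r ∈ Finset.range (a + 1), (-f) ^ r) *
        PowerSeries.derivative ℝ f) := by
    intro i hi
    have hne : (((i + 1).factorial : ℝ)) ^ 2 ≠ 0 := by positivity
    rw [diagCumulant, mul_div_cancel_left₀ _ hne, Finset.sum_range_succ', pow_zero (diagSeries m),
      PowerSeries.coeff_one, if_neg (Nat.succ_ne_zero i), mul_zero, add_zero, Finset.mul_sum,
      Finset.sum_mul, map_sum]
    have hsub : Finset.range (i + 1) ⊆ Finset.range (a + 1) := by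
      intro x; simp at hi ⊢; omega
    rw [← Finset.sum_subset hsub]
    · refine Finset.sum_congr rfl fun r _ => ?_
      have h1 := succ_mul_coeff_pow_succ f i r
      have h2 : PowerSeries.coeff i ((-f) ^ r * PowerSeries.derivative ℝ f) =
          (-1) ^ r * ∑ j ∈ Finset.range (i + 1), ((j : ℝ) + 1) * PowerSeries.coeff (j + 1) f *
            PowerSeries.coeff (i - j) (f ^ r) := by
        have : (-f) ^ r * PowerSeries.derivative ℝ f =
            PowerSeries.C ((-1 : ℝ) ^ r) * (PowerSeries.derivative ℝ f * f ^ r) := by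
          rw [neg_pow, map_pow, map_neg, map_one]; ring
        rw [this, PowerSeries.coeff_C_mul, PowerSeries.coeff_mul,
          Finset.Nat.sum_antidiagonal_eq_sum_range_succ_mk]
        congr 1
        refine Finset.sum_congr rfl fun j _ => ?_
        rw [PowerSeries.coeff_derivative]
        ring
      rw [h2, Nat.add_sub_cancel, Nat.factorial_succ]
      have hr : (r : ℝ) + 1 ≠ 0 := by positivity
      have hr' : (r.factorial : ℝ) ≠ 0 := by positivity
      push_cast
      rw [mul_left_comm, h1]
      field_simp
    · intro r _ hr
      have hr' : i < r := by simpa using hr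
      have : PowerSeries.X ^ r ∣ (-f) ^ r * PowerSeries.derivative ℝ f :=
        Dvd.dvd.mul_right (pow_dvd_pow_of_dvd (PowerSeries.X_dvd_iff.2 (by simp [hf0])) r) _
      exact PowerSeries.X_pow_dvd_iff.1 this i hr'
  have hR : ∑ i ∈ Finset.range (a + 1), ((i : ℝ) + 1) *
        (diagCumulant m (i + 1) / ((i + 1).factorial : ℝ) ^ 2) *
          (m (a - i) / ((a - i).factorial : ℝ) ^ 2) =
      PowerSeries.coeff a (((∑ r ∈ Finset.range (a + 1), (-f) ^ r) *
        PowerSeries.derivative ℝ f) * (1 + f)) := by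
    rw [PowerSeries.coeff_mul, Finset.Nat.sum_antidiagonal_eq_sum_range_succ_mk]
    refine Finset.sum_congr rfl fun i hi => ?_
    rw [hK i hi, hM]
  -- The geometric sum telescopes against `1 + f`; the remainder starts beyond order `a`.
  have hgeom : ((∑ r ∈ Finset.range (a + 1), (-f) ^ r) * PowerSeries.derivative ℝ f) * (1 + f) =
      PowerSeries.derivative ℝ f - (-f) ^ (a + 1) * PowerSeries.derivative ℝ f := by
    have := geom_sum_mul_neg (-f) (a + 1)
    rw [sub_neg_eq_add] at this
    linear_combination PowerSeries.derivative ℝ f * this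
  have hz : PowerSeries.coeff a ((-f) ^ (a + 1) * PowerSeries.derivative ℝ f) = 0 := by
    have : PowerSeries.X ^ (a + 1) ∣ (-f) ^ (a + 1) * PowerSeries.derivative ℝ f :=
      Dvd.dvd.mul_right (pow_dvd_pow_of_dvd (PowerSeries.X_dvd_iff.2 (by simp [hf0])) _) _
    exact PowerSeries.X_pow_dvd_iff.1 this a (Nat.lt_succ_self a)
  rw [hR, hgeom, map_sub, hz, sub_zero, PowerSeries.coeff_derivative, hf, coeff_diagSeries_succ]
  ring

/-! ### The formal exponential -/

/-- The derivative of the polynomial coefficients of a power series. -/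
noncomputable def coeffDeriv (S : PowerSeries (Polynomial ℝ)) : PowerSeries (Polynomial ℝ) :=
  PowerSeries.mk fun j => Polynomial.derivative (PowerSeries.coeff j S)

theorem coeff_coeffDeriv (S : PowerSeries (Polynomial ℝ)) (j : ℕ) :
    PowerSeries.coeff j (coeffDeriv S) = Polynomial.derivative (PowerSeries.coeff j S) := by
  simp [coeffDeriv]

theorem coeffDeriv_mul (S T : PowerSeries (Polynomial ℝ)) :
    coeffDeriv (S * T) = coeffDeriv S * T + S * coeffDeriv T := by
  ext1 j
  simp only [coeff_coeffDeriv, PowerSeries.coeff_mul, map_add, Polynomial.derivative_sum,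
    Polynomial.derivative_mul, Finset.sum_add_distrib]

theorem coeffDeriv_pow_succ (S : PowerSeries (Polynomial ℝ)) (m : ℕ) :
    coeffDeriv (S ^ (m + 1)) = ((m + 1 : ℕ) : PowerSeries (Polynomial ℝ)) *
      (coeffDeriv S * S ^ m) := by
  induction m with
  | zero => simp
  | succ m ih =>
    rw [pow_succ, coeffDeriv_mul, ih]
    push_cast
    ring

/-- `S^m` starts at order `m`, so the cut-off at `j` in the definition may be replaced by any larger
one. This puts coefficients of different orders over one common range. -/
theorem coeff_formalExp {S : PowerSeries (Polynomial ℝ)} (hS : PowerSeries.constantCoeff S = 0)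
    {j n : ℕ} (h : j ≤ n) : PowerSeries.coeff j (formalExp S) =
      ∑ m ∈ Finset.range (n + 1), ((m.factorial : ℝ)⁻¹) • PowerSeries.coeff j (S ^ m) := by
  rw [formalExp, PowerSeries.coeff_mk]
  refine Finset.sum_subset (by intro x; simp; omega) fun m _ hm => ?_
  rw [coeff_pow_eq_zero hS (by simpa using hm), smul_zero]

/-- The formal exponential solves `E' = S' E`. -/
theorem derivative_coeff_formalExp {S : PowerSeries (Polynomial ℝ)}
    (hS : PowerSeries.constantCoeff S = 0) (j : ℕ) :
    Polynomial.derivative (PowerSeries.coeff j (formalExp S)) =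
      ∑ i ∈ Finset.range (j + 1), Polynomial.derivative (PowerSeries.coeff i S) *
        PowerSeries.coeff (j - i) (formalExp S) := by
  have hD0 : PowerSeries.constantCoeff (coeffDeriv S) = 0 := by
    rw [← PowerSeries.coeff_zero_eq_constantCoeff_apply, coeff_coeffDeriv,
      PowerSeries.coeff_zero_eq_constantCoeff_apply, hS, Polynomial.derivative_zero]
  have hR : ∑ i ∈ Finset.range (j + 1), Polynomial.derivative (PowerSeries.coeff i S) *
        PowerSeries.coeff (j - i) (formalExp S) =
      ∑ m ∈ Finset.range (j + 1), ((m.factorial : ℝ)⁻¹) •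
        PowerSeries.coeff j (coeffDeriv S * S ^ m) := by
    have : ∀ i ∈ Finset.range (j + 1), Polynomial.derivative (PowerSeries.coeff i S) *
        PowerSeries.coeff (j - i) (formalExp S) = ∑ m ∈ Finset.range (j + 1),
          ((m.factorial : ℝ)⁻¹) • (PowerSeries.coeff i (coeffDeriv S) *
            PowerSeries.coeff (j - i) (S ^ m)) := by
      intro i _
      rw [coeff_formalExp hS (Nat.sub_le j i), Finset.mul_sum]
      refine Finset.sum_congr rfl fun m _ => ?_
      rw [coeff_coeffDeriv, mul_smul_comm]
    rw [Finset.sum_congr rfl this, Finset.sum_comm]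
    refine Finset.sum_congr rfl fun m _ => ?_
    rw [← Finset.smul_sum, PowerSeries.coeff_mul,
      Finset.Nat.sum_antidiagonal_eq_sum_range_succ_mk]
  rw [hR, formalExp, PowerSeries.coeff_mk, Polynomial.derivative_sum, Finset.sum_range_succ',
    Finset.sum_range_succ]
  have h0 : Polynomial.derivative (((Nat.factorial 0 : ℝ)⁻¹) • PowerSeries.coeff j (S ^ 0)) = 0 := by
    rw [pow_zero, PowerSeries.coeff_one]
    split_ifs <;> simp
  -- Differentiation lowers the number of factors by one, so the right side has one summand too
  -- many; it vanishes since `S'` also lacks a constant term.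
  have h1 : PowerSeries.coeff j (coeffDeriv S * S ^ j) = 0 := by
    have : PowerSeries.X ^ (j + 1) ∣ coeffDeriv S * S ^ j := by
      rw [pow_succ']
      exact mul_dvd_mul (PowerSeries.X_dvd_iff.2 hD0)
        (pow_dvd_pow_of_dvd (PowerSeries.X_dvd_iff.2 hS) j)
    exact PowerSeries.X_pow_dvd_iff.1 this j (Nat.lt_succ_self j)
  rw [h0, h1, smul_zero]
  congr 1
  refine Finset.sum_congr rfl fun m _ => ?_
  rw [Polynomial.derivative_smul, ← coeff_coeffDeriv, coeffDeriv_pow_succ,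
    ← map_natCast (PowerSeries.C (R := Polynomial ℝ)), PowerSeries.coeff_C_mul,
    ← nsmul_eq_mul, ← Nat.cast_smul_eq_nsmul ℝ, smul_smul, Nat.factorial_succ]
  congr 1
  have hm : (m : ℝ) + 1 ≠ 0 := by positivity
  push_cast
  field_simp

theorem constantCoeff_exponent (q : ℕ → ℝ) : PowerSeries.constantCoeff (exponent q) = 0 := by
  rw [← PowerSeries.coeff_zero_eq_constantCoeff_apply]
  simp [exponent]

theorem coeff_exponent (q : ℕ → ℝ) (j : ℕ) : PowerSeries.coeff j (exponent q) =
    if j = 0 then 0 else Polynomial.monomial (j + 1) (cumulantCoeff q (j + 1)) := by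
  simp [exponent]

/-- Every term `ε^{n-1} X^n` of the exponent has at least as many factors `X` as factors `ε`, and
products keep this property. -/
theorem X_pow_dvd_coeff_exponent_pow (q : ℕ → ℝ) (m j : ℕ) :
    Polynomial.X ^ j ∣ PowerSeries.coeff j (exponent q ^ m) := by
  induction m generalizing j with
  | zero =>
    rw [pow_zero, PowerSeries.coeff_one]
    split_ifs with h
    · simp [h]
    · exact dvd_zero _
  | succ m ih =>
    rw [pow_succ, PowerSeries.coeff_mul]
    refine Finset.dvd_sum fun p hp => ?_
    rw [← Finset.HasAntidiagonal.mem_antidiagonal.1 hp, pow_add]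
    refine mul_dvd_mul (ih p.1) ?_
    rw [coeff_exponent]
    split_ifs
    · exact dvd_zero _
    · rw [← Polynomial.C_mul_X_pow_eq_monomial, pow_succ]
      exact Dvd.dvd.mul_left (dvd_mul_right _ _) _

theorem X_pow_dvd_coeff_formalExp (q : ℕ → ℝ) (j : ℕ) :
    Polynomial.X ^ j ∣ PowerSeries.coeff j (formalExp (exponent q)) := by
  rw [formalExp, PowerSeries.coeff_mk]
  refine Finset.dvd_sum fun m _ => ?_
  rw [Polynomial.smul_eq_C_mul]
  exact Dvd.dvd.mul_left (X_pow_dvd_coeff_exponent_pow q m j) _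

/-! ### Taylor coefficients of `e^x P(4x)` and the recursion of the moments -/

/-- The coefficient of `x^a` in `e^x P(4x)`. -/
noncomputable def expCoeff (a : ℕ) (P : Polynomial ℝ) : ℝ :=
  ∑ m ∈ Finset.range (a + 1), P.coeff m * 4 ^ m / ((a - m).factorial : ℝ)

theorem expCoeff_add (a : ℕ) (P Q : Polynomial ℝ) :
    expCoeff a (P + Q) = expCoeff a P + expCoeff a Q := by
  simp only [expCoeff, Polynomial.coeff_add, add_mul, add_div, Finset.sum_add_distrib]

theorem expCoeff_sum {ι : Type*} (a : ℕ) (s : Finset ι) (P : ι → Polynomial ℝ) :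
    expCoeff a (∑ i ∈ s, P i) = ∑ i ∈ s, expCoeff a (P i) := by
  simp only [expCoeff, Polynomial.finsetSum_coeff, Finset.sum_mul, Finset.sum_div]
  rw [Finset.sum_comm]

/-- The coefficient form of `(e^x P(4x))' = e^x P(4x) + 4 e^x P'(4x)`. -/
theorem succ_mul_expCoeff_succ (a : ℕ) (P : Polynomial ℝ) :
    ((a : ℝ) + 1) * expCoeff (a + 1) P =
      expCoeff a P + 4 * expCoeff a (Polynomial.derivative P) := by
  have h1 : ((a : ℝ) + 1) * expCoeff (a + 1) P =
      ∑ m ∈ Finset.range (a + 1 + 1), (((a + 1 - m : ℕ) : ℝ) *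
        (P.coeff m * 4 ^ m / ((a + 1 - m).factorial : ℝ)) +
        (m : ℝ) * (P.coeff m * 4 ^ m / ((a + 1 - m).factorial : ℝ))) := by
    rw [expCoeff, Finset.mul_sum]
    refine Finset.sum_congr rfl fun m hm => ?_
    have hm' : m ≤ a + 1 := by simpa [Nat.lt_succ_iff] using hm
    rw [← add_mul, Nat.cast_sub hm']
    push_cast
    ring
  rw [h1, Finset.sum_add_distrib]
  congr 1
  · rw [Finset.sum_range_succ, Nat.sub_self, Nat.cast_zero, zero_mul, add_zero, expCoeff]
    refine Finset.sum_congr rfl fun m hm => ?_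
    have hm' : m ≤ a := by simpa [Nat.lt_succ_iff] using hm
    rw [Nat.succ_sub hm', Nat.factorial_succ]
    have : ((a - m : ℕ) : ℝ) + 1 ≠ 0 := by positivity
    have : ((a - m).factorial : ℝ) ≠ 0 := by positivity
    push_cast
    field_simp
  · rw [Finset.sum_range_succ', Nat.cast_zero, zero_mul, add_zero, expCoeff, Finset.mul_sum]
    refine Finset.sum_congr rfl fun m _ => ?_
    rw [Polynomial.coeff_derivative, Nat.add_sub_add_right]
    push_cast
    ring

theorem expCoeff_monomial_mul (a i : ℕ) (c : ℝ) (P : Polynomial ℝ) :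
    expCoeff a (Polynomial.monomial i c * P) =
      if i ≤ a then c * 4 ^ i * expCoeff (a - i) P else 0 := by
  have hc : ∀ m, (Polynomial.monomial i c * P).coeff m =
      if i ≤ m then c * P.coeff (m - i) else 0 := by
    intro m
    rw [← Polynomial.C_mul_X_pow_eq_monomial, mul_assoc, Polynomial.coeff_C_mul,
      Polynomial.coeff_X_pow_mul']
    split_ifs <;> simp
  split_ifs with h
  · obtain ⟨b, rfl⟩ := Nat.exists_eq_add_of_le h
    rw [expCoeff, add_assoc, Finset.sum_range_add, Finset.sum_eq_zero, zero_add,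
      Nat.add_sub_cancel_left, expCoeff, Finset.mul_sum]
    · refine Finset.sum_congr rfl fun m _ => ?_
      rw [hc, if_pos (Nat.le_add_right i m), Nat.add_sub_cancel_left, Nat.add_sub_add_left, pow_add]
      ring
    · intro m hm
      rw [hc, if_neg (by simpa using hm), zero_mul, zero_div]
  · refine Finset.sum_eq_zero fun m hm => ?_
    have : m ≤ a := by simpa [Nat.lt_succ_iff] using hm
    rw [hc, if_neg (by omega), zero_mul, zero_div]

/-- Order `j` carries at least `j` powers of the operator, which leave no coefficient below `x^j`.
This is why truncations are exact on polynomials of low degree. -/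
theorem expCoeff_coeff_formalExp_eq_zero (q : ℕ → ℝ) {a j : ℕ} (h : a < j) :
    expCoeff a (PowerSeries.coeff j (formalExp (exponent q))) = 0 := by
  refine Finset.sum_eq_zero fun m hm => ?_
  have hm' : m ≤ a := by simpa [Nat.lt_succ_iff] using hm
  rw [Polynomial.X_pow_dvd_iff.1 (X_pow_dvd_coeff_formalExp q j) m (by omega), zero_mul, zero_div]

/-- The coefficient of `x^i` in the derivative of
`x + ∑_{n ≥ 2} q_n ε^{n-1} x^n / (n!)²`. -/
noncomputable def cumulantDerivCoeff (q : ℕ → ℝ) (ε : ℝ) (i : ℕ) : ℝ :=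
  if i = 0 then 1 else ((i : ℝ) + 1) * (q (i + 1) / ((i + 1).factorial : ℝ) ^ 2) * ε ^ i

/-- The factor 4 of the chain rule and the `4^i` from shifting by `X^i` cancel the `4^{i+1}` in
`cumulantCoeff`. -/
theorem four_mul_expCoeff_derivative_exponent_mul (q : ℕ → ℝ) (a i : ℕ) (P : Polynomial ℝ) :
    4 * expCoeff a (Polynomial.derivative (PowerSeries.coeff i (exponent q)) * P) =
      if i = 0 ∨ a < i then 0 else
        ((i : ℝ) + 1) * (q (i + 1) / ((i + 1).factorial : ℝ) ^ 2) * expCoeff (a - i) P := by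
  rw [coeff_exponent]
  by_cases hi : i = 0
  · simp [hi, expCoeff]
  · rw [if_neg hi, Polynomial.derivative_monomial, Nat.add_sub_cancel, expCoeff_monomial_mul]
    by_cases ha : a < i
    · rw [if_neg (by omega), if_pos (Or.inr ha), mul_zero]
    · rw [if_pos (by omega), if_neg (by tauto), cumulantCoeff]
      push_cast
      field_simp
      ring

/-- The generating function of the terms of the formal exponential solves the differential
equation of the generating function of the moments. -/
theorem sum_expCoeff_recursion (q : ℕ → ℝ) (ε : ℝ) (a : ℕ) :
    ((a : ℝ) + 1) * ∑ j ∈ Finset.range (a + 1 + 1), ε ^ j *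
        expCoeff (a + 1) (PowerSeries.coeff j (formalExp (exponent q))) =
      ∑ i ∈ Finset.range (a + 1), cumulantDerivCoeff q ε i *
        ∑ j ∈ Finset.range (a - i + 1), ε ^ j *
          expCoeff (a - i) (PowerSeries.coeff j (formalExp (exponent q))) := by
  set c := fun j => PowerSeries.coeff j (formalExp (exponent q)) with hc
  have hext : ∀ b n, b + 1 ≤ n → ∑ j ∈ Finset.range n, ε ^ j * expCoeff b (c j) =
      ∑ j ∈ Finset.range (b + 1), ε ^ j * expCoeff b (c j) := by
    intro b n hn
    symm
    refine Finset.sum_subset (by intro x; simp; omega) fun j _ hj => ?_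
    rw [expCoeff_coeff_formalExp_eq_zero q (by simpa using hj), mul_zero]
  -- This combines `(e^x P(4x))' = e^x P(4x) + 4 e^x P'(4x)` with `E' = S' E` for the formal
  -- exponential.
  have h1 : ∀ j, ((a : ℝ) + 1) * (ε ^ j * expCoeff (a + 1) (c j)) =
      ε ^ j * expCoeff a (c j) + ∑ i ∈ Finset.range (j + 1), ε ^ i * (ε ^ (j - i) *
        (if i = 0 ∨ a < i then 0 else ((i : ℝ) + 1) *
          (q (i + 1) / ((i + 1).factorial : ℝ) ^ 2) * expCoeff (a - i) (c (j - i)))) := by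
    intro j
    rw [mul_left_comm, succ_mul_expCoeff_succ, mul_add, hc,
      derivative_coeff_formalExp (constantCoeff_exponent q), expCoeff_sum, Finset.mul_sum,
      Finset.mul_sum]
    congr 1
    refine Finset.sum_congr rfl fun i hi => ?_
    have hi' : i ≤ j := by simpa [Nat.lt_succ_iff] using hi
    rw [four_mul_expCoeff_derivative_exponent_mul, ← mul_assoc, ← pow_add, Nat.add_sub_cancel' hi']
  change ((a : ℝ) + 1) * ∑ j ∈ Finset.range (a + 1 + 1), ε ^ j * expCoeff (a + 1) (c j) =
      ∑ i ∈ Finset.range (a + 1), cumulantDerivCoeff q ε i *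
        ∑ j ∈ Finset.range (a - i + 1), ε ^ j * expCoeff (a - i) (c j)
  rw [Finset.mul_sum, Finset.sum_congr rfl fun j _ => h1 j, Finset.sum_add_distrib,
    hext a (a + 1 + 1) (by omega),
    Finset.sum_range_diag_flip (a + 1 + 1) (fun i l => ε ^ i * (ε ^ l *
        (if i = 0 ∨ a < i then 0 else ((i : ℝ) + 1) *
          (q (i + 1) / ((i + 1).factorial : ℝ) ^ 2) * expCoeff (a - i) (c l)))),
    Finset.sum_range_succ _ (a + 1)]
  have hlast : ∑ k ∈ Finset.range (a + 1 + 1 - (a + 1)), ε ^ (a + 1) * (ε ^ k *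
        (if a + 1 = 0 ∨ a < a + 1 then 0 else (((a + 1 : ℕ) : ℝ) + 1) *
          (q (a + 1 + 1) / ((a + 1 + 1).factorial : ℝ) ^ 2) * expCoeff (a - (a + 1)) (c k))) =
      0 := by
    refine Finset.sum_eq_zero fun k _ => ?_
    rw [if_pos (Or.inr (Nat.lt_succ_self a)), mul_zero, mul_zero]
  -- `N` comes from differentiating `e^x`. The exponent contributes nothing at `i = 0`, and `N`
  -- fills that place, where `cumulantDerivCoeff` is 1.
  generalize hN : ∑ j ∈ Finset.range (a + 1), ε ^ j * expCoeff a (c j) = N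
  rw [hlast, add_zero, Finset.sum_range_succ' _ a, Finset.sum_range_succ' _ a]
  simp only [true_or, if_true, mul_zero, Finset.sum_const_zero, add_zero]
  rw [add_comm]
  congr 1
  · refine Finset.sum_congr rfl fun i hi => ?_
    have hi' : i < a := by simpa using hi
    rw [cumulantDerivCoeff, if_neg (Nat.succ_ne_zero i), ← hext (a - (i + 1)) (a + 1 + 1 - (i + 1))
      (by omega), Finset.mul_sum]
    refine Finset.sum_congr rfl fun k _ => ?_
    rw [if_neg (by omega)]
    ring
  · simp [cumulantDerivCoeff, ← hN]

/-- The terms of the formal exponential give the solution of the recursion of the moments. -/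
theorem sum_expCoeff_eq (q : ℕ → ℝ) (ε : ℝ) (w : ℕ → ℝ) (h0 : w 0 = 1)
    (hw : ∀ a : ℕ, ((a : ℝ) + 1) * w (a + 1) =
      ∑ i ∈ Finset.range (a + 1), cumulantDerivCoeff q ε i * w (a - i))
    {a n : ℕ} (han : a < n) :
    ∑ j ∈ Finset.range n, ε ^ j *
      expCoeff a (PowerSeries.coeff j (formalExp (exponent q))) = w a := by
  have hsub : ∑ j ∈ Finset.range n, ε ^ j *
      expCoeff a (PowerSeries.coeff j (formalExp (exponent q))) =
      ∑ j ∈ Finset.range (a + 1), ε ^ j *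
      expCoeff a (PowerSeries.coeff j (formalExp (exponent q))) := by
    symm
    refine Finset.sum_subset (by intro x; simp; omega) fun j _ hj => ?_
    rw [expCoeff_coeff_formalExp_eq_zero q (by simpa using hj), mul_zero]
  rw [hsub]
  clear hsub han n
  induction a using Nat.strong_induction_on with
  | _ a ih =>
    rcases a with _ | a
    · simp [h0, expCoeff, formalExp]
    · have h1 := sum_expCoeff_recursion q ε a
      have ha : (a : ℝ) + 1 ≠ 0 := by positivity
      refine mul_left_cancel₀ ha (h1.trans ?_)
      rw [hw]
      refine Finset.sum_congr rfl fun i _ => ?_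
      rw [ih (a - i) (by omega)]

/-! ### Bounds on the coefficients -/

/-- The coefficients are polynomials in the numbers `q n`, `n ≥ 2`, with nonnegative coefficients,
so the bounds `Q` give a majorant. -/
theorem abs_coeff_exponent_pow_le {q Q : ℕ → ℝ} (h : ∀ n, 2 ≤ n → |q n| ≤ Q n) (m j l : ℕ) :
    |(PowerSeries.coeff j (exponent q ^ m)).coeff l| ≤
      (PowerSeries.coeff j (exponent Q ^ m)).coeff l := by
  induction m generalizing j l with
  | zero =>
    rw [pow_zero, pow_zero, PowerSeries.coeff_one]
    split_ifs
    · rw [Polynomial.coeff_one]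
      split_ifs <;> simp
    · simp
  | succ m ih =>
    rw [pow_succ, pow_succ, PowerSeries.coeff_mul, PowerSeries.coeff_mul,
      Polynomial.finsetSum_coeff, Polynomial.finsetSum_coeff]
    refine (Finset.abs_sum_le_sum_abs _ _).trans (Finset.sum_le_sum fun p _ => ?_)
    rw [Polynomial.coeff_mul, Polynomial.coeff_mul]
    refine (Finset.abs_sum_le_sum_abs _ _).trans (Finset.sum_le_sum fun r _ => ?_)
    rw [abs_mul]
    have h1 : |(PowerSeries.coeff p.2 (exponent q)).coeff r.2| ≤
        (PowerSeries.coeff p.2 (exponent Q)).coeff r.2 := by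
      rw [coeff_exponent, coeff_exponent]
      split_ifs with hp
      · simp
      · rw [Polynomial.coeff_monomial, Polynomial.coeff_monomial]
        split_ifs
        · rw [cumulantCoeff, cumulantCoeff, abs_div,
            abs_of_nonneg (a := 4 ^ (p.2 + 1) * ((p.2 + 1).factorial : ℝ) ^ 2) (by positivity)]
          have := h (p.2 + 1) (by omega)
          gcongr
        · simp
    exact mul_le_mul (ih p.1 r.1) h1 (abs_nonneg _) ((abs_nonneg _).trans (ih p.1 r.1))

theorem abs_expCoeff_coeff_formalExp_le {q Q : ℕ → ℝ} (h : ∀ n, 2 ≤ n → |q n| ≤ Q n) (a j : ℕ) :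
    |expCoeff a (PowerSeries.coeff j (formalExp (exponent q)))| ≤
      expCoeff a (PowerSeries.coeff j (formalExp (exponent Q))) := by
  refine (Finset.abs_sum_le_sum_abs _ _).trans (Finset.sum_le_sum fun l _ => ?_)
  rw [abs_div, abs_mul, abs_of_nonneg (a := (4 : ℝ) ^ l) (by positivity),
    abs_of_nonneg (a := ((a - l).factorial : ℝ)) (by positivity)]
  gcongr
  rw [formalExp, formalExp, PowerSeries.coeff_mk, PowerSeries.coeff_mk, Polynomial.finsetSum_coeff,
    Polynomial.finsetSum_coeff]
  refine (Finset.abs_sum_le_sum_abs _ _).trans (Finset.sum_le_sum fun m _ => ?_)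
  rw [Polynomial.coeff_smul, Polynomial.coeff_smul, smul_eq_mul, smul_eq_mul, abs_mul,
    abs_of_nonneg (a := (m.factorial : ℝ)⁻¹) (by positivity)]
  exact mul_le_mul_of_nonneg_left (abs_coeff_exponent_pow_le h m j l) (by positivity)

/-! ### The radial operator on Gaussians -/

/-- The polynomial `4 (X (p'' - 2 p' + p) + p' - p)`: the radial operator maps `p(A²) e^{-A²}` to
its value at `A²` times `e^{-A²}`. -/
noncomputable def radialStep (p : Polynomial ℝ) : Polynomial ℝ :=
  4 * (Polynomial.X * (Polynomial.derivative (Polynomial.derivative p) -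
    2 * Polynomial.derivative p + p) + Polynomial.derivative p - p)

/-- The polynomial `p` with `(∂²_A + A⁻¹ ∂_A)^m e^{-A²} = p(A²) e^{-A²}`. -/
noncomputable def radialPoly (m : ℕ) : Polynomial ℝ := radialStep^[m] 1

theorem radialPoly_succ (m : ℕ) : radialPoly (m + 1) = radialStep (radialPoly m) :=
  Function.iterate_succ_apply' _ _ _

theorem hasDerivAt_eval_sq_mul_gauss (p : Polynomial ℝ) (A : ℝ) :
    HasDerivAt (fun x => p.eval (x ^ 2) * gauss x)
      (2 * A * ((Polynomial.derivative p - p).eval (A ^ 2) * gauss A)) A := by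
  have h1 : HasDerivAt (fun x : ℝ => x ^ 2) (2 * A) A := by simpa using hasDerivAt_pow 2 A
  have h2 := (p.hasDerivAt (A ^ 2)).comp A h1
  have h3 : HasDerivAt gauss (gauss A * (-(2 * A))) A := h1.neg.exp
  have h4 := h2.mul h3
  refine h4.congr_deriv ?_
  simp only [Polynomial.eval_sub, Function.comp_apply]
  ring

theorem radialOp_eval_sq_mul_gauss (p : Polynomial ℝ) {A : ℝ} (hA : A ≠ 0) :
    radialOp (fun x => p.eval (x ^ 2) * gauss x) A =
      (radialStep p).eval (A ^ 2) * gauss A := by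
  have h1 : deriv (fun x => p.eval (x ^ 2) * gauss x) =
      fun x => 2 * x * ((Polynomial.derivative p - p).eval (x ^ 2) * gauss x) :=
    funext fun x => (hasDerivAt_eval_sq_mul_gauss p x).deriv
  have h2 : HasDerivAt (fun x : ℝ => 2 * x) 2 A := by simpa using (hasDerivAt_id A).const_mul 2
  have h3 := h2.mul (hasDerivAt_eval_sq_mul_gauss (Polynomial.derivative p - p) A)
  rw [radialOp, h1]
  have h4 := h3.deriv
  simp only [Pi.mul_def] at h4
  rw [h4]
  simp only [radialStep, Polynomial.eval_sub, Polynomial.eval_mul, Polynomial.eval_add,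
    Polynomial.eval_X, Polynomial.eval_ofNat, Polynomial.derivative_sub]
  field_simp
  ring

theorem iterate_radialOp_gauss (m : ℕ) {A : ℝ} (hA : A ≠ 0) :
    (radialOp^[m] gauss) A = (radialPoly m).eval (A ^ 2) * gauss A := by
  induction m generalizing A with
  | zero => simp [radialPoly]
  | succ m ih =>
    -- Derivatives at `A` need the formula near `A`; the induction hypothesis holds on the open set
    -- `x ≠ 0`.
    have hev : radialOp^[m] gauss =ᶠ[nhds A] fun x => (radialPoly m).eval (x ^ 2) * gauss x := by
      filter_upwards [isOpen_ne.mem_nhds hA] with x hx using ih hx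
    rw [Function.iterate_succ_apply', radialPoly_succ, ← radialOp_eval_sq_mul_gauss _ hA, radialOp,
      radialOp, hev.deriv_eq, hev.deriv.deriv_eq]

theorem radialStep_add (p r : Polynomial ℝ) :
    radialStep (p + r) = radialStep p + radialStep r := by
  simp only [radialStep, Polynomial.derivative_add]; ring

/-- The linear form `∑ p_i X^i ↦ ∑ p_i (a + i)! = ∫₀^∞ s^a p(s) e^{-s} ds`. -/
noncomputable def factorialForm (a : ℕ) : Polynomial ℝ →ₗ[ℝ] ℝ :=
  Polynomial.lsum fun i => ((a + i).factorial : ℝ) • LinearMap.id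

theorem factorialForm_monomial (a i : ℕ) (c : ℝ) :
    factorialForm a (Polynomial.monomial i c) = (a + i).factorial * c := by
  simp [factorialForm, Polynomial.lsum_apply, Polynomial.sum_monomial_index]

/-- For `b = 0` the truncated exponent `b - 1` is harmless, its coefficient being zero. -/
theorem radialStep_monomial (b : ℕ) (c : ℝ) : radialStep (Polynomial.monomial b c) =
    Polynomial.monomial (b - 1) (4 * c * b ^ 2) - Polynomial.monomial b (4 * c * (2 * b + 1)) +
      Polynomial.monomial (b + 1) (4 * c) := by
  have h2 : Polynomial.C (2 : ℝ) = 2 := map_ofNat _ 2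
  have h4 : Polynomial.C (4 : ℝ) = 4 := map_ofNat _ 4
  rcases b with _ | _ | b
  · simp only [radialStep, ← Polynomial.C_mul_X_pow_eq_monomial]
    simp [h4]
    ring
  · simp only [radialStep, ← Polynomial.C_mul_X_pow_eq_monomial]
    simp [h2, h4]
    ring
  · simp only [radialStep, Nat.add_sub_cancel, ← Polynomial.C_mul_X_pow_eq_monomial]
    simp [h2, h4]
    ring

/-- The operator is `A⁻¹ ∂_A (A ∂_A)`, so against `A dA` it integrates a total derivative whose
boundary terms vanish. On monomials this is a relation between factorials. -/
theorem factorialForm_zero_radialStep (p : Polynomial ℝ) :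
    factorialForm 0 (radialStep p) = 0 := by
  induction p using Polynomial.induction_on' with
  | add p r hp hr => rw [radialStep_add, map_add, hp, hr, add_zero]
  | monomial b c =>
    rw [radialStep_monomial, map_add, map_sub]
    simp only [factorialForm_monomial]
    rcases b with _ | b
    · simp
    · simp only [zero_add, Nat.add_sub_cancel, Nat.factorial_succ]
      push_cast
      ring

/-- Algebraic form of two integrations by parts: the operator is symmetric with respect to `A dA`
and maps `A^{2a+2}` to `4(a+1)² A^{2a}`. -/
theorem factorialForm_succ_radialStep (a : ℕ) (p : Polynomial ℝ) :
    factorialForm (a + 1) (radialStep p) = 4 * ((a : ℝ) + 1) ^ 2 * factorialForm a p := by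
  induction p using Polynomial.induction_on' with
  | add p r hp hr => rw [radialStep_add, map_add, hp, hr, map_add]; ring
  | monomial b c =>
    rw [radialStep_monomial, map_add, map_sub]
    simp only [factorialForm_monomial]
    rcases b with _ | b
    · simp only [Nat.add_zero, zero_add, Nat.factorial_succ, Nat.zero_sub]
      push_cast
      ring
    · have e1 : a + 1 + (b + 1 - 1) = a + (b + 1) := by omega
      have e2 : a + 1 + (b + 1) = a + (b + 1) + 1 := by omega
      have e3 : a + 1 + (b + 1 + 1) = a + (b + 1) + 1 + 1 := by omega
      rw [e1, e2, e3]
      simp only [Nat.factorial_succ (a + (b + 1) + 1), Nat.factorial_succ (a + (b + 1))]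
      push_cast
      ring

theorem factorialForm_radialPoly (a m : ℕ) : factorialForm a (radialPoly m) =
    if m ≤ a then (a.factorial : ℝ) ^ 2 * 4 ^ m / ((a - m).factorial : ℝ) else 0 := by
  induction m generalizing a with
  | zero =>
    have : (radialPoly 0) = Polynomial.monomial 0 1 := rfl
    rw [this, factorialForm_monomial]
    have : (a.factorial : ℝ) ≠ 0 := by positivity
    simp
    field_simp
  | succ m ih =>
    rw [radialPoly_succ]
    rcases a with _ | a
    · simp [factorialForm_zero_radialStep]
    · rw [factorialForm_succ_radialStep, ih]
      simp only [Nat.add_le_add_iff_right, Nat.add_sub_add_right]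
      split_ifs
      · rw [Nat.factorial_succ]
        push_cast
        ring
      · simp

/-! ### Gaussian moments -/

theorem integrableOn_pow_mul_exp_neg_mul_sq {b : ℝ} (hb : 0 < b) (n : ℕ) :
    IntegrableOn (fun x : ℝ => x ^ n * Real.exp (-b * x ^ 2)) (Set.Ioi 0) := by
  have := integrableOn_rpow_mul_exp_neg_mul_sq hb (s := n)
    (by have : (0 : ℝ) ≤ n := Nat.cast_nonneg n; linarith)
  simpa only [Real.rpow_natCast] using this

theorem integral_pow_mul_exp_neg_mul_sq {b : ℝ} (hb : 0 < b) (n : ℕ) :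
    ∫ x in Set.Ioi (0 : ℝ), x ^ (2 * n + 1) * Real.exp (-b * x ^ 2) =
      n.factorial / (2 * b ^ (n + 1)) := by
  have h := integral_rpow_mul_exp_neg_mul_rpow (p := 2) (q := ((2 * n + 1 : ℕ) : ℝ)) (b := b)
    (by norm_num) (by have : (0 : ℝ) ≤ ((2 * n + 1 : ℕ) : ℝ) := Nat.cast_nonneg _; linarith) hb
  have e : ((((2 * n + 1 : ℕ) : ℝ)) + 1) / 2 = n + 1 := by push_cast; ring
  have e' : -((((2 * n + 1 : ℕ) : ℝ)) + 1) / 2 = -((n + 1 : ℕ) : ℝ) := by push_cast; ring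
  rw [e, e', Real.Gamma_nat_eq_factorial, Real.rpow_neg hb.le, Real.rpow_natCast] at h
  simp only [Real.rpow_natCast, Real.rpow_ofNat] at h
  rw [h]
  field_simp

theorem integrableOn_pow_mul_eval_sq_mul_gauss (n : ℕ) (p : Polynomial ℝ) :
    IntegrableOn (fun x : ℝ => x ^ n * (p.eval (x ^ 2) * gauss x)) (Set.Ioi 0) := by
  have : (fun x : ℝ => x ^ n * (p.eval (x ^ 2) * gauss x)) = fun x =>
      ∑ i ∈ p.support, p.coeff i * (x ^ (n + 2 * i) * Real.exp (-1 * x ^ 2)) := by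
    ext x
    rw [Polynomial.eval_eq_sum, Polynomial.sum, Finset.sum_mul, Finset.mul_sum]
    refine Finset.sum_congr rfl fun i _ => ?_
    rw [gauss, neg_one_mul]
    ring
  rw [this]
  exact integrable_finsetSum _ fun i _ =>
    (integrableOn_pow_mul_exp_neg_mul_sq one_pos (n + 2 * i)).const_mul _

theorem integral_pow_mul_eval_sq_mul_gauss (a : ℕ) (p : Polynomial ℝ) :
    ∫ x in Set.Ioi (0 : ℝ), x ^ (2 * a + 1) * (p.eval (x ^ 2) * gauss x) =
      factorialForm a p / 2 := by
  have : (fun x : ℝ => x ^ (2 * a + 1) * (p.eval (x ^ 2) * gauss x)) = fun x =>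
      ∑ i ∈ p.support, p.coeff i * (x ^ (2 * (a + i) + 1) * Real.exp (-1 * x ^ 2)) := by
    ext x
    rw [Polynomial.eval_eq_sum, Polynomial.sum, Finset.sum_mul, Finset.mul_sum]
    refine Finset.sum_congr rfl fun i _ => ?_
    rw [gauss, neg_one_mul]
    ring
  rw [this, integral_finsetSum _ fun i _ =>
    (integrableOn_pow_mul_exp_neg_mul_sq one_pos _).const_mul _]
  simp only [integral_const_mul, integral_pow_mul_exp_neg_mul_sq one_pos]
  rw [factorialForm, Polynomial.lsum_apply, Polynomial.sum, Finset.sum_div]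
  refine Finset.sum_congr rfl fun i _ => ?_
  simp
  ring

/-! ### Integrals against the truncated density -/

/-- The polynomial `p` with `(∑_{j < J} V^{-j} c_j(∂²_A + A⁻¹ ∂_A)) e^{-A²} = p(A²) e^{-A²}`. -/
noncomputable def truncPoly (V : ℝ) (q : ℕ → ℝ) (J : ℕ) : Polynomial ℝ :=
  ∑ j ∈ Finset.range J, (V⁻¹) ^ j •
    (PowerSeries.coeff j (formalExp (exponent q))).sum fun m c => c • radialPoly m

theorem applyRadial_gauss (P : Polynomial ℝ) {A : ℝ} (hA : A ≠ 0) :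
    applyRadial P gauss A = (P.sum fun m c => c • radialPoly m).eval (A ^ 2) * gauss A := by
  rw [applyRadial, Polynomial.sum, Polynomial.sum, Polynomial.eval_finsetSum, Finset.sum_mul]
  refine Finset.sum_congr rfl fun m _ => ?_
  rw [iterate_radialOp_gauss m hA, Polynomial.eval_smul, smul_eq_mul, mul_assoc]

theorem truncDensity_eq (V : ℝ) (q : ℕ → ℝ) (J : ℕ) {A : ℝ} (hA : A ≠ 0) (θ : ℝ) :
    truncDensity V q J (A, θ) = A / Real.pi * ((truncPoly V q J).eval (A ^ 2) * gauss A) := by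
  rw [truncDensity, truncPoly, Polynomial.eval_finsetSum, Finset.sum_mul]
  congr 1
  refine Finset.sum_congr rfl fun j _ => ?_
  simp only [applyRadial_gauss _ hA]
  rw [Polynomial.eval_smul, smul_eq_mul, mul_assoc]

/-- The passage from operators to power series: moments of `P(B) e^{-A²}` become Taylor coefficients
of `e^x P(4x)`, and by linearity `P = X^m` suffices. -/
theorem factorialForm_sum_radialPoly (a : ℕ) (P : Polynomial ℝ) :
    factorialForm a (P.sum fun m c => c • radialPoly m) =
      (a.factorial : ℝ) ^ 2 * expCoeff a P := by
  have h0 : ∀ m : ℕ, (0 : ℝ) • radialPoly m = 0 := fun _ => zero_smul _ _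
  induction P using Polynomial.induction_on' with
  | add P R hP hR =>
    rw [Polynomial.sum_add_index _ _ _ h0 (fun _ _ _ => add_smul _ _ _),
      map_add, hP, hR, expCoeff_add]
    ring
  | monomial m c =>
    rw [Polynomial.sum_monomial_index _ (fun m (c : ℝ) => c • radialPoly m) (h0 m), map_smul, factorialForm_radialPoly,
      ← mul_one (Polynomial.monomial m c), expCoeff_monomial_mul]
    split_ifs
    · have : expCoeff (a - m) 1 = 1 / ((a - m).factorial : ℝ) := by
        rw [expCoeff, Finset.sum_eq_single 0]
        · simp
        · intro l _ hl
          simp [Polynomial.coeff_one, hl]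
        · simp
      rw [this, smul_eq_mul]
      ring
    · simp

theorem factorialForm_truncPoly (V : ℝ) (q : ℕ → ℝ) (J a : ℕ) :
    factorialForm a (truncPoly V q J) = (a.factorial : ℝ) ^ 2 * ∑ j ∈ Finset.range J,
      (V⁻¹) ^ j * expCoeff a (PowerSeries.coeff j (formalExp (exponent q))) := by
  rw [truncPoly, map_sum, Finset.mul_sum]
  refine Finset.sum_congr rfl fun j _ => ?_
  rw [map_smul, factorialForm_sum_radialPoly, smul_eq_mul]
  ring

theorem integral_exp_int_mul_I (n : ℤ) :
    ∫ θ in Set.Ico (0 : ℝ) (2 * Real.pi), Complex.exp ((n * Complex.I) * θ) =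
      if n = 0 then ((2 * Real.pi : ℝ) : ℂ) else 0 := by
  rw [integral_Ico_eq_integral_Ioc, ← intervalIntegral.integral_of_le Real.two_pi_pos.le]
  split_ifs with h
  · simp [h]
  · rw [integral_exp_mul_complex (mul_ne_zero (Int.cast_ne_zero.2 h) Complex.I_ne_zero)]
    have : Complex.exp (n * Complex.I * ((2 * Real.pi : ℝ) : ℂ)) = 1 := by
      rw [Complex.exp_eq_one_iff]
      exact ⟨n, by push_cast; ring⟩
    rw [this]
    simp

/-- The monomial `z^a z̄^b` at `z = A e^{iθ}`. -/
noncomputable def monomialValue (a b : ℕ) (p : ℝ × ℝ) : ℂ :=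
  ((p.1 : ℂ) * Complex.exp (Complex.I * p.2)) ^ a *
    ((p.1 : ℂ) * Complex.exp (-Complex.I * p.2)) ^ b

theorem monomialValue_eq (a b : ℕ) (p : ℝ × ℝ) : monomialValue a b p =
    ((p.1 ^ (a + b) : ℝ) : ℂ) * Complex.exp ((((a : ℤ) - b : ℤ) * Complex.I) * p.2) := by
  rw [monomialValue, mul_pow, mul_pow, ← Complex.exp_nat_mul, ← Complex.exp_nat_mul, mul_mul_mul_comm,
    ← pow_add, ← Complex.exp_add]
  push_cast
  congr 2
  ring

theorem measurableSet_polarDomain : MeasurableSet polarDomain :=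
  measurableSet_Ioi.prod measurableSet_Ico

theorem monomialValue_mul_truncDensity (V : ℝ) (q : ℕ → ℝ) (J a b : ℕ) {p : ℝ × ℝ}
    (hp : p ∈ polarDomain) : monomialValue a b p * (truncDensity V q J p : ℂ) =
      ((Real.pi⁻¹ * (p.1 ^ (a + b + 1) * ((truncPoly V q J).eval (p.1 ^ 2) * gauss p.1)) : ℝ) : ℂ) *
        Complex.exp ((((a : ℤ) - b : ℤ) * Complex.I) * p.2) := by
  obtain ⟨A, θ⟩ := p
  have hA : A ≠ 0 := (show (0 : ℝ) < A from hp.1).ne'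
  rw [monomialValue_eq, truncDensity_eq V q J hA]
  push_cast
  ring

theorem volume_restrict_polarDomain : (volume : Measure (ℝ × ℝ)).restrict polarDomain =
    (volume.restrict (Set.Ioi 0)).prod (volume.restrict (Set.Ico 0 (2 * Real.pi))) := by
  rw [Measure.prod_restrict]; rfl

theorem integrableOn_monomialValue_mul_truncDensity (V : ℝ) (q : ℕ → ℝ) (J a b : ℕ) :
    IntegrableOn (fun p => monomialValue a b p * (truncDensity V q J p : ℂ)) polarDomain := by
  rw [integrableOn_congr_fun (fun p hp => monomialValue_mul_truncDensity V q J a b hp)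
    measurableSet_polarDomain, IntegrableOn, volume_restrict_polarDomain]
  refine Integrable.mul_prod (f := fun A : ℝ => ((Real.pi⁻¹ * (A ^ (a + b + 1) *
    ((truncPoly V q J).eval (A ^ 2) * gauss A)) : ℝ) : ℂ))
    (g := fun θ : ℝ => Complex.exp ((((a : ℤ) - b : ℤ) * Complex.I) * θ)) ?_ ?_
  · exact ((integrableOn_pow_mul_eval_sq_mul_gauss _ _).const_mul _).ofReal
  · have : Continuous fun θ : ℝ => Complex.exp ((((a : ℤ) - b : ℤ) * Complex.I) * θ) := by fun_prop
    exact (this.continuousOn.integrableOn_Icc (a := 0) (b := 2 * Real.pi)).mono_set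
      Set.Ico_subset_Icc_self

/-- The integral over the angle removes `a ≠ b`. For `a = b` its value `2π` meets the prefactor
`1/π` and the `1/2` of the radial moments. -/
theorem integral_monomialValue_mul_truncDensity (V : ℝ) (q : ℕ → ℝ) (J a b : ℕ) :
    ∫ p in polarDomain, monomialValue a b p * (truncDensity V q J p : ℂ) =
      if a = b then (((a.factorial : ℝ) ^ 2 * ∑ j ∈ Finset.range J,
        (V⁻¹) ^ j * expCoeff a (PowerSeries.coeff j (formalExp (exponent q))) : ℝ) : ℂ) else 0 := by
  rw [setIntegral_congr_fun measurableSet_polarDomain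
    (fun p hp => monomialValue_mul_truncDensity V q J a b hp), volume_restrict_polarDomain,
    integral_prod_mul (fun A : ℝ => ((Real.pi⁻¹ * (A ^ (a + b + 1) *
      ((truncPoly V q J).eval (A ^ 2) * gauss A)) : ℝ) : ℂ))
      (fun θ : ℝ => Complex.exp ((((a : ℤ) - b : ℤ) * Complex.I) * θ)), integral_exp_int_mul_I]
  split_ifs with h1 h2 h2
  · subst h2
    rw [integral_complex_ofReal, integral_const_mul, ← two_mul a, integral_pow_mul_eval_sq_mul_gauss,
      factorialForm_truncPoly, ← Complex.ofReal_mul]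
    congr 1
    have := Real.pi_ne_zero
    field_simp
  · omega
  · omega
  · rw [mul_zero]

/-! ### The second-order expansion -/

theorem coeff_zero_formalExp (q : ℕ → ℝ) : PowerSeries.coeff 0 (formalExp (exponent q)) =
    Polynomial.monomial 0 1 := by
  simp [formalExp]

theorem coeff_one_formalExp (q : ℕ → ℝ) : PowerSeries.coeff 1 (formalExp (exponent q)) =
    Polynomial.monomial 2 (q 2 / 64) := by
  simp [formalExp, Finset.sum_range_succ, coeff_exponent, cumulantCoeff, PowerSeries.coeff_one]
  norm_num

/-- `2304 = 4³ (3!)²` belongs to the cubic term of the exponent, and `8192 = 2 · 64²` to half the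
square of the first-order term. -/
theorem coeff_two_formalExp (q : ℕ → ℝ) : PowerSeries.coeff 2 (formalExp (exponent q)) =
    Polynomial.monomial 3 (q 3 / 2304) + Polynomial.monomial 4 (q 2 ^ 2 / 8192) := by
  have h : PowerSeries.coeff 2 (exponent q ^ 2) = Polynomial.monomial 4 (q 2 ^ 2 / 4096) := by
    rw [pow_two, PowerSeries.coeff_mul]
    simp [Finset.Nat.antidiagonal_succ, coeff_exponent, cumulantCoeff,
      Polynomial.monomial_mul_monomial]
    ring_nf
  rw [formalExp, PowerSeries.coeff_mk]
  simp [Finset.sum_range_succ, h, coeff_exponent, cumulantCoeff, PowerSeries.coeff_one,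
    Polynomial.smul_monomial, Nat.factorial]
  ring_nf

/-- This and the next three are the cases `m = 1, …, 4` of `(-4)^m m! L_m`, with `L_m` the Laguerre
polynomials. -/
theorem radialPoly_one : radialPoly 1 = 4 * Polynomial.X - 4 := by
  rw [radialPoly_succ]
  simp [radialPoly, radialStep]
  ring

theorem radialPoly_two : radialPoly 2 = 16 * (Polynomial.X ^ 2 - 4 * Polynomial.X + 2) := by
  rw [radialPoly_succ, radialPoly_one]
  simp [radialStep]
  ring

theorem radialPoly_three : radialPoly 3 =
    64 * (Polynomial.X ^ 3 - 9 * Polynomial.X ^ 2 + 18 * Polynomial.X - 6) := by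
  rw [radialPoly_succ, radialPoly_two]
  simp [radialStep]
  ring

theorem radialPoly_four : radialPoly 4 = 256 * (Polynomial.X ^ 4 - 16 * Polynomial.X ^ 3 +
    72 * Polynomial.X ^ 2 - 96 * Polynomial.X + 24) := by
  have h2 : Polynomial.C (2 : ℝ) = 2 := map_ofNat _ 2
  rw [radialPoly_succ, radialPoly_three]
  simp [radialStep, h2]
  ring

theorem truncDensity_three (V : ℝ) (q : ℕ → ℝ) (A θ : ℝ) (hA : 0 < A) :
    truncDensity V q 3 (A, θ) = gaussDensity (A, θ) *
        (1 + 1 / V * ((1 / 4 * A ^ 4 - A ^ 2 + 1 / 2) * q 2) +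
          1 / V ^ 2 *
            ((1 / 36 * A ^ 6 - 1 / 4 * A ^ 4 + 1 / 2 * A ^ 2 - 1 / 6) * q 3 +
              (1 / 32 * A ^ 8 - 1 / 2 * A ^ 6 + 9 / 4 * A ^ 4 - 3 * A ^ 2 + 3 / 4) *
                q 2 ^ 2)) := by
  have h0 : ∀ m : ℕ, (0 : ℝ) • radialPoly m = 0 := fun _ => zero_smul _ _
  rw [truncDensity_eq V q 3 hA.ne', truncPoly, Finset.sum_range_succ, Finset.sum_range_succ,
    Finset.sum_range_one, coeff_zero_formalExp, coeff_one_formalExp, coeff_two_formalExp,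
    Polynomial.sum_add_index _ _ _ h0 (fun _ _ _ => add_smul _ _ _)]
  simp only [Polynomial.sum_monomial_index _ (fun m (c : ℝ) => c • radialPoly m) (h0 _)]
  rw [radialPoly_two, radialPoly_three, radialPoly_four, gaussDensity, gauss]
  simp only [radialPoly, Function.iterate_zero, id, Polynomial.eval_add, Polynomial.eval_smul,
    Polynomial.eval_sub, Polynomial.eval_mul, Polynomial.eval_pow, Polynomial.eval_X,
    Polynomial.eval_ofNat, Polynomial.eval_one, smul_eq_mul]
  rw [one_div V, one_div (V ^ 2), ← inv_pow]
  have := Real.pi_ne_zero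
  field_simp
  ring

/-! ### The Bessel function and the Hankel transform of Gaussians -/

theorem hasSum_of_eq {E : Type*} [AddCommMonoid E] [TopologicalSpace E] {f g : ℕ → E} {a b : E}
    (h : HasSum f a) (hfg : ∀ m, g m = f m) (hab : b = a) : HasSum g b := by
  rw [hab, funext hfg]; exact h

theorem integral_cos_pow_two_mul (m : ℕ) :
    ∫ ψ in (0 : ℝ)..(2 * Real.pi), Real.cos ψ ^ (2 * m) =
      2 * Real.pi * ((2 * m).factorial / (4 ^ m * (m.factorial : ℝ) ^ 2)) := by
  induction m with
  | zero => simp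
  | succ m ih =>
    have e : 2 * (m + 1) = 2 * m + 2 := by ring
    rw [e, integral_cos_pow, ih]
    simp only [Real.sin_zero, Real.sin_two_pi, mul_zero, sub_zero, zero_div, zero_add,
      Nat.factorial_succ]
    push_cast
    have : (m.factorial : ℝ) ≠ 0 := by positivity
    field_simp
    ring

/-- The cosine series is integrated term by term, dominated by the series of `cosh |z|`. -/
theorem hasSum_besselJ0 (z : ℝ) :
    HasSum (fun m : ℕ => (-1) ^ m * (z / 2) ^ (2 * m) / (m.factorial : ℝ) ^ 2) (besselJ0 z) := by
  have h1 : HasSum (fun m : ℕ => ∫ ψ in (0 : ℝ)..(2 * Real.pi),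
      (-1) ^ m * (z * Real.cos ψ) ^ (2 * m) / ((2 * m).factorial : ℝ))
      (∫ ψ in (0 : ℝ)..(2 * Real.pi), Real.cos (z * Real.cos ψ)) := by
    refine intervalIntegral.hasSum_integral_of_dominated_convergence
      (fun m _ => |z| ^ (2 * m) / ((2 * m).factorial : ℝ)) (fun m => ?_) (fun m => ?_) ?_ ?_ ?_
    · exact Continuous.aestronglyMeasurable (by fun_prop)
    · refine Filter.Eventually.of_forall fun ψ _ => ?_
      rw [norm_div, norm_mul, norm_pow, norm_pow, norm_neg, norm_one, one_pow, one_mul, norm_mul,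
        Real.norm_eq_abs, Real.norm_eq_abs, Real.norm_eq_abs,
        abs_of_nonneg (a := ((2 * m).factorial : ℝ)) (by positivity)]
      have : |z| * |Real.cos ψ| ≤ |z| :=
        mul_le_of_le_one_right (abs_nonneg z) (Real.abs_cos_le_one ψ)
      gcongr
    · refine Filter.Eventually.of_forall fun ψ _ => ?_
      exact (Real.hasSum_cosh |z|).summable
    · exact intervalIntegrable_const
    · exact Filter.Eventually.of_forall fun ψ _ => Real.hasSum_cos _
  have h2 := h1.mul_left (2 * Real.pi)⁻¹
  refine hasSum_of_eq h2 (fun m => ?_) rfl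
  have : ∀ ψ : ℝ, (-1) ^ m * (z * Real.cos ψ) ^ (2 * m) / ((2 * m).factorial : ℝ) =
      (-1) ^ m * z ^ (2 * m) / ((2 * m).factorial : ℝ) * Real.cos ψ ^ (2 * m) := by
    intro ψ
    rw [mul_pow]
    ring
  simp only [this]
  rw [intervalIntegral.integral_const_mul, integral_cos_pow_two_mul, div_pow, pow_mul (2 : ℝ)]
  have := Real.pi_ne_zero
  norm_num
  field_simp

theorem factorial_add_le (n m : ℕ) :
    ((n + m).factorial : ℝ) ≤ 2 ^ (n + m) * n.factorial * m.factorial := by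
  have h1 := Nat.add_choose_mul_factorial_mul_factorial n m
  have h2 := Nat.choose_le_two_pow (n + m) m
  rw [← h1]
  push_cast
  gcongr
  exact_mod_cast h2

/-- The integral of `x^{2n+1} e^{-b x²} J₀(x A)`. -/
theorem hasSum_integral_besselJ0 {b : ℝ} (hb : 0 < b) (n : ℕ) (A : ℝ) :
    HasSum (fun m : ℕ => (-1) ^ m * (A / 2) ^ (2 * m) / (m.factorial : ℝ) ^ 2 *
        ((n + m).factorial / (2 * b ^ (n + m + 1))))
      (∫ x in Set.Ioi (0 : ℝ), x ^ (2 * n + 1) * Real.exp (-b * x ^ 2) * besselJ0 (x * A)) := by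
  set F : ℕ → ℝ → ℝ := fun m x => (-1) ^ m * (A / 2) ^ (2 * m) / (m.factorial : ℝ) ^ 2 *
    (x ^ (2 * (n + m) + 1) * Real.exp (-b * x ^ 2)) with hF
  have hInt : ∀ m, Integrable (F m) (volume.restrict (Set.Ioi 0)) := fun m =>
    (integrableOn_pow_mul_exp_neg_mul_sq hb _).const_mul _
  have hnorm : ∀ m, ∫ x in Set.Ioi (0 : ℝ), ‖F m x‖ = (A / 2) ^ (2 * m) / (m.factorial : ℝ) ^ 2 *
      ((n + m).factorial / (2 * b ^ (n + m + 1))) := by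
    intro m
    rw [← integral_pow_mul_exp_neg_mul_sq hb, ← integral_const_mul]
    refine setIntegral_congr_fun measurableSet_Ioi fun x hx => ?_
    have hx' : (0 : ℝ) < x := hx
    simp only [hF]
    rw [norm_mul, norm_div, norm_mul, norm_pow, norm_neg, norm_one, one_pow, one_mul,
      Real.norm_of_nonneg (r := (A / 2) ^ (2 * m)) (by rw [pow_mul]; positivity),
      Real.norm_of_nonneg (r := (m.factorial : ℝ) ^ 2) (by positivity),
      Real.norm_of_nonneg (by positivity)]
  -- Since `(n+m)! ≤ 2^{n+m} n! m!`, one factor `m!` stays in the denominator and an exponential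
  -- series at `A²/(2b)` dominates.
  have hsum : Summable fun m => ∫ x in Set.Ioi (0 : ℝ), ‖F m x‖ := by
    simp only [hnorm]
    refine Summable.of_nonneg_of_le (fun m => by rw [pow_mul]; positivity) (fun m => ?_)
      ((Real.summable_pow_div_factorial ((A / 2) ^ 2 * 2 / b)).mul_left
        (2 ^ n * n.factorial / (2 * b ^ (n + 1))))
    rw [pow_mul]
    calc ((A / 2) ^ 2) ^ m / (m.factorial : ℝ) ^ 2 * ((n + m).factorial / (2 * b ^ (n + m + 1)))
        ≤ ((A / 2) ^ 2) ^ m / (m.factorial : ℝ) ^ 2 *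
          ((2 ^ (n + m) * n.factorial * m.factorial) / (2 * b ^ (n + m + 1))) := by
          gcongr
          exact factorial_add_le n m
      _ = _ := by
          have : (m.factorial : ℝ) ≠ 0 := by positivity
          rw [div_pow _ b, mul_pow, show n + m + 1 = n + 1 + m by ring, pow_add b, pow_add (2 : ℝ)]
          field_simp
  have h := hasSum_integral_of_summable_integral_norm hInt hsum
  have hval : ∀ x : ℝ, ∑' m, F m x = x ^ (2 * n + 1) * Real.exp (-b * x ^ 2) * besselJ0 (x * A) := by
    intro x
    have h1 := (hasSum_besselJ0 (x * A)).mul_left (x ^ (2 * n + 1) * Real.exp (-b * x ^ 2))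
    refine (HasSum.tsum_eq ?_)
    refine hasSum_of_eq h1 (fun m => ?_) rfl
    simp only [hF]
    rw [show x * A / 2 = x * (A / 2) by ring, mul_pow x]
    ring
  simp only [hval] at h
  refine hasSum_of_eq h (fun m => ?_) rfl
  simp only [hF]
  rw [integral_const_mul, integral_pow_mul_exp_neg_mul_sq hb]

/-- For `n = 0` the integral of the Bessel series keeps a single `m!` in the denominator, so it sums
to an exponential. -/
theorem hankel_gauss (κ : ℝ) : hankel gauss κ = Real.exp (-κ ^ 2 / 4) / 2 := by
  have h := hasSum_integral_besselJ0 one_pos 0 κ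
  have h1 : HasSum (fun m : ℕ => (-1) ^ m * (κ / 2) ^ (2 * m) / (m.factorial : ℝ) ^ 2 *
        ((0 + m).factorial / (2 * (1 : ℝ) ^ (0 + m + 1)))) (Real.exp (-κ ^ 2 / 4) / 2) := by
    have h2 := (NormedSpace.expSeries_div_hasSum_exp (-κ ^ 2 / 4 : ℝ)).div_const 2
    rw [← Real.exp_eq_exp_ℝ] at h2
    refine hasSum_of_eq h2 (fun m => ?_) rfl
    have : (m.factorial : ℝ) ≠ 0 := by positivity
    rw [pow_mul, ← mul_pow, zero_add]
    field_simp
    norm_num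
  rw [← h.unique h1, hankel]
  refine setIntegral_congr_fun measurableSet_Ioi fun x _ => ?_
  simp only [gauss]
  rw [mul_comm κ x]
  ring_nf

/-! ### Powers of the radial operator -/

/-- The formal power series `∑ (-1)^m s^m / m!`. -/
noncomputable def expNegSeries : PowerSeries ℝ :=
  PowerSeries.mk fun m => (-1) ^ m / (m.factorial : ℝ)

theorem derivative_expNegSeries : PowerSeries.derivative ℝ expNegSeries = -expNegSeries := by
  ext m
  rw [PowerSeries.coeff_derivative, map_neg, expNegSeries, PowerSeries.coeff_mk,
    PowerSeries.coeff_mk, Nat.factorial_succ]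
  have : (m.factorial : ℝ) ≠ 0 := by positivity
  push_cast
  field_simp
  ring

/-- The power series in `s = A²` of `(∂²_A + A⁻¹ ∂_A)^n e^{-A²}`. -/
noncomputable def radialSeries (n : ℕ) : PowerSeries ℝ :=
  PowerSeries.mk fun m => (-1) ^ (n + m) * 4 ^ n * (n + m).factorial / (m.factorial : ℝ) ^ 2

/-- In the variable `s = A²` the operator is `4(s ∂_s² + ∂_s)`. The explicit coefficients obey this
recursion, and conjugation by `e^{-s}` turns it into `radialStep`. -/
theorem radialSeries_eq (n : ℕ) :
    radialSeries n = (radialPoly n : PowerSeries ℝ) * expNegSeries := by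
  induction n with
  | zero =>
    ext m
    have : (m.factorial : ℝ) ≠ 0 := by positivity
    simp only [radialSeries, radialPoly, Function.iterate_zero, id, Polynomial.coe_one, one_mul,
      expNegSeries, PowerSeries.coeff_mk, zero_add, pow_zero, mul_one]
    field_simp
  | succ n ih =>
    have h1 : radialSeries (n + 1) = 4 * (PowerSeries.X *
        PowerSeries.derivative ℝ (PowerSeries.derivative ℝ (radialSeries n)) +
          PowerSeries.derivative ℝ (radialSeries n)) := by
      ext m
      have h4 : (4 : PowerSeries ℝ) = PowerSeries.C 4 := (map_ofNat _ 4).symm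
      rw [h4, PowerSeries.coeff_C_mul, map_add]
      rcases m with _ | m
      · rw [PowerSeries.coeff_zero_X_mul, PowerSeries.coeff_derivative]
        simp only [radialSeries, PowerSeries.coeff_mk]
        simp
        ring
      · rw [PowerSeries.coeff_succ_X_mul, PowerSeries.coeff_derivative, PowerSeries.coeff_derivative]
        simp only [radialSeries, PowerSeries.coeff_mk]
        rw [show n + 1 + (m + 1) = n + (m + 1 + 1) by ring, Nat.factorial_succ (m + 1)]
        have : ((m + 1).factorial : ℝ) ≠ 0 := by positivity
        push_cast
        field_simp
        ring
    rw [h1, ih, radialPoly_succ, radialStep]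
    simp only [Derivation.leibniz, smul_eq_mul, derivative_expNegSeries, map_add, map_neg,
      PowerSeries.derivative_coe]
    push_cast
    have h4 : ((4 : Polynomial ℝ) : PowerSeries ℝ) = 4 := by
      exact map_ofNat (Polynomial.coeToPowerSeries.ringHom (R := ℝ)) 4
    have h2 : ((2 : Polynomial ℝ) : PowerSeries ℝ) = 2 := by
      exact map_ofNat (Polynomial.coeToPowerSeries.ringHom (R := ℝ)) 2
    rw [h4, h2]
    ring

theorem hasSum_coeff_polynomial_mul {f : PowerSeries ℝ} {s v : ℝ}
    (hf : HasSum (fun m => PowerSeries.coeff m f * s ^ m) v) (p : Polynomial ℝ) :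
    HasSum (fun m => PowerSeries.coeff m ((p : PowerSeries ℝ) * f) * s ^ m) (p.eval s * v) := by
  induction p using Polynomial.induction_on with
  | C a =>
    simp only [Polynomial.coe_C, PowerSeries.coeff_C_mul, Polynomial.eval_C, mul_assoc]
    exact hf.mul_left a
  | add p r hp hr =>
    simp only [Polynomial.coe_add, add_mul, map_add, Polynomial.eval_add]
    exact hp.add hr
  | monomial n a h =>
    have e : ((Polynomial.C a * Polynomial.X ^ (n + 1) : Polynomial ℝ) : PowerSeries ℝ) * f =
        PowerSeries.X * (((Polynomial.C a * Polynomial.X ^ n : Polynomial ℝ) : PowerSeries ℝ) * f) := by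
      push_cast
      ring
    rw [e]
    rw [← hasSum_nat_add_iff' 1]
    refine hasSum_of_eq (h.mul_left s) (fun m => ?_) ?_
    · rw [PowerSeries.coeff_succ_X_mul]; ring
    · simp
      ring

theorem integrableOn_pow_mul_hankel_gauss (n : ℕ) :
    IntegrableOn (fun κ => (-κ ^ 2) ^ n * hankel gauss κ * κ) (Set.Ioi 0) := by
  have h := (integrableOn_pow_mul_exp_neg_mul_sq (b := 1 / 4) (by norm_num) (2 * n + 1)).const_mul
    ((-1) ^ n / 2)
  refine h.congr (Filter.Eventually.of_forall fun κ => ?_)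
  simp only [hankel_gauss]
  rw [neg_pow, show -(1 / 4) * κ ^ 2 = -κ ^ 2 / 4 by ring]
  ring

/-- Both sides have the same convergent power series in `A²`, the left by expanding `J₀` under the
integral, the right through `radialSeries`; no derivative has to pass under the integral. -/
theorem radialCalculus_pow_gauss (n : ℕ) {A : ℝ} (hA : 0 < A) :
    radialCalculus (fun x => x ^ n) gauss A = (radialOp^[n] gauss) A := by
  have h1 := (hasSum_integral_besselJ0 (b := 1 / 4) (by norm_num) n A).mul_left ((-1) ^ n / 2)
  have h2 : HasSum (fun m => PowerSeries.coeff m expNegSeries * (A ^ 2) ^ m) (gauss A) := by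
    have := NormedSpace.expSeries_div_hasSum_exp (-A ^ 2 : ℝ)
    rw [← Real.exp_eq_exp_ℝ] at this
    refine hasSum_of_eq this (fun m => ?_) rfl
    rw [expNegSeries, PowerSeries.coeff_mk, neg_pow (A ^ 2)]
    ring
  have h3 := hasSum_coeff_polynomial_mul h2 (radialPoly n)
  rw [← radialSeries_eq] at h3
  rw [iterate_radialOp_gauss n hA.ne', radialCalculus]
  have h4 : ∫ κ in Set.Ioi (0 : ℝ), (-κ ^ 2) ^ n * hankel gauss κ * besselJ0 (κ * A) * κ =
      (-1) ^ n / 2 * ∫ x in Set.Ioi (0 : ℝ),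
        x ^ (2 * n + 1) * Real.exp (-(1 / 4) * x ^ 2) * besselJ0 (x * A) := by
    rw [← integral_const_mul]
    congr 1
    ext κ
    rw [hankel_gauss, neg_pow, show -(1 / 4) * κ ^ 2 = -κ ^ 2 / 4 by ring]
    ring
  rw [h4]
  refine h1.unique ?_
  refine hasSum_of_eq h3 (fun m => ?_) rfl
  have : (m.factorial : ℝ) ≠ 0 := by positivity
  rw [radialSeries, PowerSeries.coeff_mk, one_div, inv_pow, show n + m + 1 = (n + m) + 1 by rfl,
    pow_succ, pow_add, pow_mul, div_pow A, div_pow _ (2 ^ 2 : ℝ)]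
  norm_num
  field_simp
  ring

/-! ### Moments of the Fourier coefficients -/

/-- The largest factor controls the product, so one-point moments dominate correlations. The summand
1 is needed only for `n = 0`. -/
theorem prod_le_one_add_sum_pow {n : ℕ} (a : Fin n → ℝ) (ha : ∀ j, 0 ≤ a j) :
    ∏ j, a j ≤ 1 + ∑ j, a j ^ n := by
  rcases Nat.eq_zero_or_pos n with rfl | hn
  · simp
  · obtain ⟨j₀, -, hj₀⟩ := Finset.exists_max_image Finset.univ a ⟨⟨0, hn⟩, Finset.mem_univ _⟩
    have h1 : ∏ j, a j ≤ a j₀ ^ n := by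
      refine (Finset.prod_le_prod (fun j _ => ha j) fun j hj => hj₀ j hj).trans_eq ?_
      simp
    have h2 : a j₀ ^ n ≤ ∑ j, a j ^ n :=
      Finset.single_le_sum (f := fun j => a j ^ n) (fun j _ => pow_nonneg (ha j) n)
        (Finset.mem_univ j₀)
    linarith

/-- The integral over a period box of a function which is periodic in one direction does not
change under translations in this direction. -/
theorem setIntegral_box_translate {d : ℕ} {L : Fin d → ℝ} (hL : ∀ i, 0 < L i) (i : Fin d) {t : ℝ}
    (ht : 0 ≤ t) (htL : t ≤ L i) (h : (Fin d → ℝ) → ℂ)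
    (hper : ∀ᵐ x, h (x + Pi.single i (L i)) = h x)
    (hInt : IntegrableOn h (Set.Icc 0 (2 • L))) :
    ∫ x in Set.Icc 0 L, h (x + Pi.single i t) = ∫ x in Set.Icc 0 L, h x := by
  -- Half-open slabs can be cut and glued without overlap; the closed box differs from one by a null
  -- set.
  set S : ℝ → ℝ → Set (Fin d → ℝ) := fun a b =>
    {x | x i ∈ Set.Ico a b ∧ ∀ j, j ≠ i → x j ∈ Set.Ico 0 (L j)} with hS
  have hmeas : ∀ a b, MeasurableSet (S a b) := by
    intro a b
    have : S a b = (fun x : Fin d → ℝ => x i) ⁻¹' Set.Ico a b ∩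
        ⋂ j, ⋂ (_ : j ≠ i), (fun x : Fin d → ℝ => x j) ⁻¹' Set.Ico 0 (L j) := by
      ext x; simp [hS]
    rw [this]
    exact (measurable_pi_apply i measurableSet_Ico).inter (MeasurableSet.iInter fun j =>
      MeasurableSet.iInter fun _ => measurable_pi_apply j measurableSet_Ico)
  have hbox : (Set.Icc 0 L : Set (Fin d → ℝ)) =ᵐ[volume] S 0 (L i) := by
    have : S 0 (L i) = Set.univ.pi fun j => Set.Ico ((0 : Fin d → ℝ) j) (L j) := by
      ext x
      simp only [hS, Set.mem_ofPred_eq, Set.mem_univ_pi, Pi.zero_apply]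
      constructor
      · rintro ⟨h1, h2⟩ j
        by_cases hj : j = i
        · subst hj; exact h1
        · exact h2 j hj
      · exact fun h1 => ⟨h1 i, fun j _ => h1 j⟩
    rw [this]
    exact (Measure.univ_pi_Ico_ae_eq_Icc (f := (0 : Fin d → ℝ)) (g := L)).symm
  have hshift : ∀ a b s, (fun x : Fin d → ℝ => x + Pi.single i s) ⁻¹' S (a + s) (b + s) = S a b := by
    intro a b s
    ext x
    simp only [hS, Set.mem_preimage, Set.mem_ofPred_eq, Pi.add_apply, Pi.single_eq_same, Set.mem_Ico,
      add_le_add_iff_right, add_lt_add_iff_right]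
    refine and_congr_right fun _ => forall_congr' fun j => forall_congr' fun hj => ?_
    rw [Pi.single_eq_of_ne hj, add_zero]
  have htrans : ∀ a b s, ∫ x in S a b, h (x + Pi.single i s) = ∫ x in S (a + s) (b + s), h x := by
    intro a b s
    rw [← hshift a b s]
    exact (measurePreserving_add_right volume (Pi.single i s)).setIntegral_preimage_emb
      (measurableEmbedding_addRight _) h _
  have hsub : ∀ a b, 0 ≤ a → b ≤ 2 * L i → IntegrableOn h (S a b) := by
    intro a b ha hb
    refine hInt.mono_set fun x hx => ?_
    simp only [hS, Set.mem_ofPred_eq] at hx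
    rw [Set.mem_Icc, Pi.le_def, Pi.le_def]
    have key : ∀ j, 0 ≤ x j ∧ x j ≤ 2 * L j := by
      intro j
      by_cases hj : j = i
      · subst hj
        exact ⟨ha.trans hx.1.1, hx.1.2.le.trans hb⟩
      · have h1 := hx.2 j hj
        have := hL j
        exact ⟨h1.1, by linarith [h1.2]⟩
    refine ⟨fun j => (key j).1, fun j => ?_⟩
    have := (key j).2
    simpa [two_mul, two_nsmul] using this
  have hLi := hL i
  have hunion : ∀ a b c, a ≤ b → b ≤ c → 0 ≤ a → c ≤ 2 * L i →
      ∫ x in S a c, h x = (∫ x in S a b, h x) + ∫ x in S b c, h x := by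
    intro a b c hab hbc ha hc
    have hU : S a c = S a b ∪ S b c := by
      ext x
      simp only [hS, Set.mem_ofPred_eq, Set.mem_union, ← or_and_right]
      rw [← Set.mem_union, Set.Ico_union_Ico_eq_Ico hab hbc]
    rw [hU, setIntegral_union _ (hmeas b c) (hsub a b ha (hbc.trans hc))
      (hsub b c (ha.trans hab) hc)]
    rw [Set.disjoint_left]
    intro x hx hx'
    exact absurd hx.1.2 (not_lt.2 hx'.1.1)
  -- The slab lost at the bottom and the one gained at the top differ by a full period. The latter
  -- leaves the box, hence integrability on the doubled box.
  have hslab : ∫ x in S 0 t, h x = ∫ x in S (L i) (L i + t), h x := by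
    have h1 := htrans 0 t (L i)
    rw [zero_add, add_comm t] at h1
    rw [← h1]
    exact setIntegral_congr_ae (hmeas 0 t) (hper.mono fun x hx _ => hx.symm)
  rw [setIntegral_congr_set hbox, setIntegral_congr_set hbox, htrans 0 (L i) t, zero_add,
    hunion t (L i) (L i + t) htL (by linarith) ht (by linarith),
    hunion 0 t (L i) ht htL le_rfl (by linarith), hslab, add_comm]

namespace PeriodicField

variable {d : ℕ} (F : PeriodicField.{u} d)

theorem measurable_field (x : Fin d → ℝ) : Measurable (F.f x) :=
  F.measurable_f.comp measurable_prodMk_left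

theorem integral_abs_pow (x : Fin d → ℝ) (n : ℕ) :
    ∫ ω, |F.f x ω| ^ n ∂F.μ = ∫ ω, |F.f 0 ω| ^ n ∂F.μ := by
  have h := F.homogeneous 1 (fun _ => 0) x
  have hm : ∀ y : Fin d → ℝ, Measurable fun ω (_ : Fin 1) => F.f y ω := fun y =>
    measurable_pi_lambda _ fun _ => F.measurable_field y
  have hg : Measurable fun v : Fin 1 → ℝ => |v 0| ^ n :=
    ((measurable_pi_apply 0).abs).pow_const n
  have e : ∀ y : Fin d → ℝ, ∫ ω, |F.f y ω| ^ n ∂F.μ =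
      ∫ v, |v 0| ^ n ∂(F.μ.map fun ω (_ : Fin 1) => F.f y ω) := fun y => by
    rw [integral_map (hm y).aemeasurable hg.aestronglyMeasurable]
  rw [e, e]
  simp only [zero_add] at h
  rw [h]

/-- The correlation functions are translation invariant. -/
theorem integral_prod_translate (n : ℕ) (x : Fin n → Fin d → ℝ) (y : Fin d → ℝ) :
    ∫ ω, ∏ j, (F.f (x j + y) ω : ℂ) ∂F.μ = ∫ ω, ∏ j, (F.f (x j) ω : ℂ) ∂F.μ := by
  have h := F.homogeneous n x y
  have hm : ∀ z : Fin n → Fin d → ℝ, Measurable fun ω (j : Fin n) => F.f (z j) ω := fun z =>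
    measurable_pi_lambda _ fun j => F.measurable_field (z j)
  have hg : Measurable fun v : Fin n → ℝ => ∏ j, (v j : ℂ) :=
    Finset.measurable_fun_prod _ fun j _ => Complex.measurable_ofReal.comp (measurable_pi_apply j)
  have e : ∀ z : Fin n → Fin d → ℝ, ∫ ω, ∏ j, (F.f (z j) ω : ℂ) ∂F.μ =
      ∫ v, ∏ j, (v j : ℂ) ∂(F.μ.map fun ω (j : Fin n) => F.f (z j) ω) := fun z => by
    rw [integral_map (hm z).aemeasurable hg.aestronglyMeasurable]
  rw [e, e x, h]

/-- The hypothesis for exchanging expectation and spatial integrals. By homogeneity the dominating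
one-point moments do not depend on position, and `ν` is finite. -/
theorem integrable_prod_field (ν : Measure (Fin d → ℝ)) [IsFiniteMeasure ν] (n : ℕ)
    (e : Fin n → (Fin d → ℝ) → ℂ) (he : ∀ j, Measurable (e j)) (he1 : ∀ j x, ‖e j x‖ ≤ 1)
    (y : Fin d → ℝ) :
    Integrable (fun p : (Fin n → Fin d → ℝ) × F.Ω => ∏ j, ((F.f (p.1 j + y) p.2 : ℂ) * e j (p.1 j)))
      ((Measure.pi fun _ => ν).prod F.μ) := by
  have hmeas : Measurable fun p : (Fin n → Fin d → ℝ) × F.Ω =>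
      ∏ j, ((F.f (p.1 j + y) p.2 : ℂ) * e j (p.1 j)) := by
    refine Finset.measurable_fun_prod _ fun j _ => ?_
    have h1 : Measurable fun p : (Fin n → Fin d → ℝ) × F.Ω => p.1 j :=
      (measurable_pi_apply j).comp measurable_fst
    have h2 : Measurable fun p : (Fin n → Fin d → ℝ) × F.Ω => F.f (p.1 j + y) p.2 :=
      F.measurable_f.comp ((h1.add_const y).prodMk measurable_snd)
    exact (Complex.measurable_ofReal.comp h2).mul ((he j).comp h1)
  have hbound : ∀ (x : Fin n → Fin d → ℝ) (ω : F.Ω),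
      ‖∏ j, ((F.f (x j + y) ω : ℂ) * e j (x j))‖ ≤ 1 + ∑ j, |F.f (x j + y) ω| ^ n := by
    intro x ω
    rw [norm_prod]
    refine le_trans (Finset.prod_le_prod (fun j _ => norm_nonneg _) fun j _ => ?_)
      (prod_le_one_add_sum_pow (fun j => |F.f (x j + y) ω|) fun j => abs_nonneg _)
    rw [norm_mul, Complex.norm_real, Real.norm_eq_abs]
    exact mul_le_of_le_one_right (abs_nonneg _) (he1 j _)
  have hdom : ∀ x : Fin n → Fin d → ℝ,
      Integrable (fun ω => 1 + ∑ j, |F.f (x j + y) ω| ^ n) F.μ := fun x =>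
    (integrable_const _).add (integrable_finsetSum _ fun j _ => F.moments _ n)
  have hInt : ∀ x : Fin n → Fin d → ℝ,
      Integrable (fun ω => ∏ j, ((F.f (x j + y) ω : ℂ) * e j (x j))) F.μ := fun x =>
    (hdom x).mono' (hmeas.comp measurable_prodMk_left).aestronglyMeasurable
      (Filter.Eventually.of_forall (hbound x))
  rw [integrable_prod_iff hmeas.aestronglyMeasurable]
  refine ⟨Filter.Eventually.of_forall hInt, ?_⟩
  refine Integrable.of_bound (C := 1 + n * ∫ ω, |F.f 0 ω| ^ n ∂F.μ)
    hmeas.aestronglyMeasurable.norm.integral_prod_right' (Filter.Eventually.of_forall fun x => ?_)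
  rw [Real.norm_of_nonneg (integral_nonneg fun ω => norm_nonneg _)]
  refine (integral_mono (hInt x).norm (hdom x) (hbound x)).trans_eq ?_
  rw [integral_add (integrable_const _) (integrable_finsetSum _ fun j _ => F.moments _ n),
    integral_finsetSum _ fun j _ => F.moments _ n]
  simp [F.integral_abs_pow (_ + y) n]

theorem ae_integrable_field (ν : Measure (Fin d → ℝ)) [IsFiniteMeasure ν] :
    ∀ᵐ ω ∂F.μ, Integrable (fun x => (F.f x ω : ℂ)) ν := by
  have hm : Measurable fun p : (Fin d → ℝ) × F.Ω => (F.f p.1 p.2 : ℂ) :=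
    Complex.measurable_ofReal.comp F.measurable_f
  have hInt : Integrable (fun p : (Fin d → ℝ) × F.Ω => (F.f p.1 p.2 : ℂ)) (ν.prod F.μ) := by
    have h1 : ∀ x, Integrable (fun ω => (F.f x ω : ℂ)) F.μ := fun x => by
      refine ((F.moments x 1).mono' (Complex.measurable_ofReal.comp
        (F.measurable_field x)).aestronglyMeasurable (Filter.Eventually.of_forall fun ω => ?_))
      simp
    rw [integrable_prod_iff hm.aestronglyMeasurable]
    refine ⟨Filter.Eventually.of_forall h1, ?_⟩
    refine Integrable.of_bound (C := ∫ ω, |F.f 0 ω| ^ 1 ∂F.μ)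
      hm.aestronglyMeasurable.norm.integral_prod_right' (Filter.Eventually.of_forall fun x => ?_)
    rw [Real.norm_of_nonneg (integral_nonneg fun ω => norm_nonneg _), ← F.integral_abs_pow x 1]
    simp
  exact hInt.prod_left_ae

/-! ### Plane waves and Fourier integrals of the translated field -/

theorem V_pos : 0 < F.V := Finset.prod_pos fun i _ => F.L_pos i

/-- The plane wave `e^{-i k·x}`. -/
noncomputable def wave (k : Fin d → ℤ) (x : Fin d → ℝ) : ℂ :=
  Complex.exp (-Complex.I * (F.wavePhase k x : ℂ))

theorem wavePhase_add (k : Fin d → ℤ) (x y : Fin d → ℝ) :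
    F.wavePhase k (x + y) = F.wavePhase k x + F.wavePhase k y := by
  simp only [wavePhase, Pi.add_apply, mul_add, Finset.sum_add_distrib]

theorem wavePhase_single (k : Fin d → ℤ) (i : Fin d) (t : ℝ) :
    F.wavePhase k (Pi.single i t) = 2 * Real.pi * k i / F.L i * t := by
  rw [wavePhase, Finset.sum_eq_single i]
  · rw [Pi.single_eq_same]
  · intro j _ hj
    rw [Pi.single_eq_of_ne hj, mul_zero]
  · simp

theorem wavePhase_neg (k : Fin d → ℤ) (x : Fin d → ℝ) :
    F.wavePhase (-k) x = -F.wavePhase k x := by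
  simp only [wavePhase, Pi.neg_apply, Int.cast_neg]
  rw [← Finset.sum_neg_distrib]
  refine Finset.sum_congr rfl fun i _ => ?_
  ring

theorem continuous_wave (k : Fin d → ℤ) : Continuous (F.wave k) := by
  unfold wave wavePhase
  fun_prop

theorem norm_wave (k : Fin d → ℤ) (x : Fin d → ℝ) : ‖F.wave k x‖ = 1 := by
  rw [wave, show -Complex.I * (F.wavePhase k x : ℂ) = ((-F.wavePhase k x : ℝ) : ℂ) * Complex.I by
    push_cast; ring, Complex.norm_exp_ofReal_mul_I]

theorem wave_add (k : Fin d → ℤ) (x y : Fin d → ℝ) :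
    F.wave k (x + y) = F.wave k x * F.wave k y := by
  rw [wave, wave, wave, wavePhase_add, ← Complex.exp_add]
  push_cast
  ring_nf

theorem wave_ne_zero (k : Fin d → ℤ) (x : Fin d → ℝ) : F.wave k x ≠ 0 := Complex.exp_ne_zero _

theorem wave_period (k : Fin d → ℤ) (i : Fin d) : F.wave k (Pi.single i (F.L i)) = 1 := by
  rw [wave, wavePhase_single, Complex.exp_eq_one_iff]
  refine ⟨-k i, ?_⟩
  have : (F.L i : ℂ) ≠ 0 := Complex.ofReal_ne_zero.2 (F.L_pos i).ne'
  push_cast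
  field_simp

theorem wave_neg (k : Fin d → ℤ) (x : Fin d → ℝ) :
    F.wave (-k) x = (starRingEnd ℂ) (F.wave k x) := by
  rw [wave, wave, wavePhase_neg, ← Complex.exp_conj]
  simp

theorem wave_inv (k : Fin d → ℤ) (x : Fin d → ℝ) : (F.wave k x)⁻¹ = F.wave (-k) x := by
  rw [wave, wave, wavePhase_neg, ← Complex.exp_neg]
  push_cast
  ring_nf

/-- The Fourier integral of the field translated by `y`. -/
noncomputable def shiftedMode (k : Fin d → ℤ) (y : Fin d → ℝ) (ω : F.Ω) : ℂ :=
  ∫ x in Set.Icc (0 : Fin d → ℝ) F.L, (F.f (x + y) ω : ℂ) * F.wave k x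

theorem fourierCoeff_eq (k : Fin d → ℤ) (ω : F.Ω) :
    F.fourierCoeff k ω = ((√F.V : ℝ) : ℂ)⁻¹ * F.shiftedMode k 0 ω := by
  simp only [fourierCoeff, shiftedMode, add_zero, wave]

theorem fourierCoeff_neg (k : Fin d → ℤ) (ω : F.Ω) :
    F.fourierCoeff (-k) ω = (starRingEnd ℂ) (F.fourierCoeff k ω) := by
  rw [fourierCoeff_eq, fourierCoeff_eq, map_mul, map_inv₀, Complex.conj_ofReal, shiftedMode,
    shiftedMode, ← integral_conj]
  congr 2
  ext x
  rw [map_mul, Complex.conj_ofReal, wave_neg]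

theorem shiftedMode_pow_mul_pow (k : Fin d → ℤ) (a b : ℕ) (y : Fin d → ℝ) (ω : F.Ω) :
    F.shiftedMode k y ω ^ a * F.shiftedMode (-k) y ω ^ b =
      ∫ x : Fin (a + b) → Fin d → ℝ, ∏ j, ((F.f (x j + y) ω : ℂ) *
        (Fin.append (fun _ : Fin a => F.wave k) (fun _ : Fin b => F.wave (-k)) j) (x j))
        ∂(Measure.pi fun _ => volume.restrict (Set.Icc (0 : Fin d → ℝ) F.L)) := by
  rw [integral_fintype_prod_eq_prod (fun (j : Fin (a + b)) (x : Fin d → ℝ) => (F.f (x + y) ω : ℂ) *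
    (Fin.append (fun _ : Fin a => F.wave k) (fun _ : Fin b => F.wave (-k)) j) x),
    Fin.prod_univ_add]
  simp [shiftedMode]

/-- A product of modes is an integral over several points. Taking the expectation inside leaves a
correlation function, the only place where `y` enters, and that is translation invariant. -/
theorem integrable_shiftedMode (k : Fin d → ℤ) (a b : ℕ) (y : Fin d → ℝ) :
    Integrable (fun ω => F.shiftedMode k y ω ^ a * F.shiftedMode (-k) y ω ^ b) F.μ ∧
    ∫ ω, F.shiftedMode k y ω ^ a * F.shiftedMode (-k) y ω ^ b ∂F.μ =
      ∫ ω, F.shiftedMode k 0 ω ^ a * F.shiftedMode (-k) 0 ω ^ b ∂F.μ := by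
  set e : Fin (a + b) → (Fin d → ℝ) → ℂ :=
    Fin.append (fun _ : Fin a => F.wave k) (fun _ : Fin b => F.wave (-k)) with he
  set ν := (volume : Measure (Fin d → ℝ)).restrict (Set.Icc (0 : Fin d → ℝ) F.L) with hν
  have : IsFiniteMeasure ν := ⟨by
    rw [hν, Measure.restrict_apply_univ]
    exact isCompact_Icc.measure_lt_top⟩
  have hem : ∀ j, Measurable (e j) := by
    intro j
    refine Fin.addCases (fun i => ?_) (fun i => ?_) j
    · rw [he, Fin.append_left]; exact (F.continuous_wave k).measurable
    · rw [he, Fin.append_right]; exact (F.continuous_wave (-k)).measurable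
  have he1 : ∀ j x, ‖e j x‖ ≤ 1 := by
    intro j x
    refine Fin.addCases (fun i => ?_) (fun i => ?_) j
    · rw [he, Fin.append_left, norm_wave]
    · rw [he, Fin.append_right, norm_wave]
  have hI := F.integrable_prod_field ν (a + b) e hem he1
  have hval : ∀ y : Fin d → ℝ,
      ∫ ω, F.shiftedMode k y ω ^ a * F.shiftedMode (-k) y ω ^ b ∂F.μ =
      ∫ x : Fin (a + b) → Fin d → ℝ, (∫ ω, ∏ j, (F.f (x j) ω : ℂ) ∂F.μ) * ∏ j, e j (x j)
        ∂(Measure.pi fun _ => ν) := by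
    intro y
    simp only [F.shiftedMode_pow_mul_pow k a b y]
    rw [← integral_integral_swap (f := fun (x : Fin (a + b) → Fin d → ℝ) (ω : F.Ω) =>
      ∏ j, ((F.f (x j + y) ω : ℂ) * e j (x j))) (hI y)]
    congr 1
    ext x
    simp only [Finset.prod_mul_distrib]
    rw [integral_mul_const, F.integral_prod_translate]
  refine ⟨?_, by rw [hval, hval]⟩
  simp only [F.shiftedMode_pow_mul_pow k a b y]
  exact (hI y).integral_prod_right

theorem ae_shiftedMode_eq (k : Fin d → ℤ) (i : Fin d) {t : ℝ} (ht : 0 ≤ t) (htL : t ≤ F.L i) :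
    ∀ᵐ ω ∂F.μ, F.shiftedMode k (Pi.single i t) ω =
      F.wave (-k) (Pi.single i t) * F.shiftedMode k 0 ω := by
  -- Periodicity is almost sure at each point separately; Fubini turns it into a statement at almost
  -- every point for almost every realization.
  have hper : ∀ᵐ ω ∂F.μ, ∀ᵐ x : Fin d → ℝ, F.f (x + Pi.single i (F.L i)) ω = F.f x ω := by
    have hset : MeasurableSet {p : (Fin d → ℝ) × F.Ω |
        F.f (p.1 + Pi.single i (F.L i)) p.2 = F.f p.1 p.2} :=
      measurableSet_eq_fun (F.measurable_f.comp
        ((measurable_fst.add_const _).prodMk measurable_snd)) F.measurable_f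
    exact (Measure.ae_ae_comm hset).1 (Filter.Eventually.of_forall fun x => F.periodic i x)
  have : IsFiniteMeasure ((volume : Measure (Fin d → ℝ)).restrict (Set.Icc 0 (2 • F.L))) := ⟨by
    rw [Measure.restrict_apply_univ]
    exact isCompact_Icc.measure_lt_top⟩
  filter_upwards [hper, F.ae_integrable_field
    ((volume : Measure (Fin d → ℝ)).restrict (Set.Icc 0 (2 • F.L)))] with ω hω hInt
  have hper' : ∀ᵐ x : Fin d → ℝ, (F.f (x + Pi.single i (F.L i)) ω : ℂ) *
      F.wave k (x + Pi.single i (F.L i)) = (F.f x ω : ℂ) * F.wave k x := by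
    filter_upwards [hω] with x hx
    rw [hx, wave_add, wave_period, mul_one]
  have hInt' : IntegrableOn (fun x => (F.f x ω : ℂ) * F.wave k x) (Set.Icc 0 (2 • F.L)) := by
    refine hInt.mul_bdd (c := 1) (F.continuous_wave k).aestronglyMeasurable
      (Filter.Eventually.of_forall fun x => (F.norm_wave k x).le)
  have h := setIntegral_box_translate F.L_pos i ht htL (fun x => (F.f x ω : ℂ) * F.wave k x)
    hper' hInt'
  simp only [shiftedMode, add_zero]
  rw [← h, ← integral_const_mul]
  congr 1
  ext x
  rw [wave_add, ← wave_inv]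
  have := F.wave_ne_zero k (Pi.single i t)
  field_simp

/-- A translation leaves the moment unchanged but multiplies it by `e^{i(a-b)k·y}`; a translation
with phase `-1` forces it to vanish. -/
theorem integral_shiftedMode_eq_zero {k : Fin d → ℤ} (hk : k ≠ 0) {a b : ℕ} (hab : a ≠ b) :
    ∫ ω, F.shiftedMode k 0 ω ^ a * F.shiftedMode (-k) 0 ω ^ b ∂F.μ = 0 := by
  obtain ⟨i, hi⟩ := Function.ne_iff.1 hk
  have hi' : k i ≠ 0 := hi
  set n : ℤ := k i * ((a : ℤ) - b) with hn
  have hn0 : n ≠ 0 := mul_ne_zero hi' (by omega)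
  have hn1 : (1 : ℝ) ≤ |(n : ℝ)| := by
    have : (1 : ℤ) ≤ |n| := Int.one_le_abs hn0
    exact_mod_cast this
  -- With this `t` the total phase `2π n t / L_i` is `±π`, and `|n| ≥ 1` keeps `t` within one
  -- period.
  set t : ℝ := F.L i / (2 * |(n : ℝ)|) with ht
  have hL := F.L_pos i
  have ht0 : 0 ≤ t := by positivity
  have htL : t ≤ F.L i := by
    rw [ht, div_le_iff₀ (by positivity)]
    nlinarith
  have h1 := (F.integrable_shiftedMode k a b (Pi.single i t)).2
  have hphase : F.wave (-k) (Pi.single i t) ^ a * F.wave k (Pi.single i t) ^ b = -1 := by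
    rw [wave, wave, ← Complex.exp_nat_mul, ← Complex.exp_nat_mul, ← Complex.exp_add,
      wavePhase_neg, wavePhase_single]
    have hLc : (F.L i : ℂ) ≠ 0 := Complex.ofReal_ne_zero.2 hL.ne'
    have e : (a : ℂ) * (-Complex.I * ((-(2 * Real.pi * (k i : ℝ) / F.L i * t) : ℝ) : ℂ)) +
        (b : ℂ) * (-Complex.I * ((2 * Real.pi * (k i : ℝ) / F.L i * t : ℝ) : ℂ)) =
        ((Real.pi * (n / |(n : ℝ)|) : ℝ) : ℂ) * Complex.I := by
      have e' : Real.pi * ((n : ℝ) / |(n : ℝ)|) =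
          2 * Real.pi * (k i : ℝ) / F.L i * t * ((a : ℝ) - b) := by
        have : |(n : ℝ)| ≠ 0 := by positivity
        rw [ht, hn]
        push_cast
        field_simp
      rw [e']
      push_cast
      ring
    rw [e]
    rcases lt_or_gt_of_ne hn0 with h | h
    · have h' : (n : ℝ) < 0 := by exact_mod_cast h
      rw [abs_of_neg h', div_neg, div_self h'.ne, mul_neg, mul_one, Complex.ofReal_neg, neg_mul,
        Complex.exp_neg, Complex.exp_pi_mul_I]
      norm_num
    · have h' : (0 : ℝ) < n := by exact_mod_cast h
      rw [abs_of_pos h', div_self h'.ne', mul_one, Complex.exp_pi_mul_I]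
  have h2 : ∫ ω, F.shiftedMode k (Pi.single i t) ω ^ a *
      F.shiftedMode (-k) (Pi.single i t) ω ^ b ∂F.μ =
      -∫ ω, F.shiftedMode k 0 ω ^ a * F.shiftedMode (-k) 0 ω ^ b ∂F.μ := by
    rw [← integral_neg]
    refine integral_congr_ae ?_
    filter_upwards [F.ae_shiftedMode_eq k i ht0 htL, F.ae_shiftedMode_eq (-k) i ht0 htL]
      with ω h3 h4
    rw [h3, h4, neg_neg, mul_pow, mul_pow, mul_mul_mul_comm, hphase, neg_one_mul]
  rw [h2] at h1
  exact self_eq_neg.1 h1.symm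

theorem integrable_fourierCoeff (k : Fin d → ℤ) (a b : ℕ) :
    Integrable (fun ω => F.fourierCoeff k ω ^ a * F.fourierCoeff (-k) ω ^ b) F.μ := by
  simp only [fourierCoeff_eq, mul_pow, mul_mul_mul_comm]
  exact (F.integrable_shiftedMode k a b 0).1.const_mul _

theorem integral_fourierCoeff_eq_zero {k : Fin d → ℤ} (hk : k ≠ 0) {a b : ℕ} (hab : a ≠ b) :
    ∫ ω, F.fourierCoeff k ω ^ a * F.fourierCoeff (-k) ω ^ b ∂F.μ = 0 := by
  simp only [fourierCoeff_eq, mul_pow, mul_mul_mul_comm]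
  rw [integral_const_mul, F.integral_shiftedMode_eq_zero hk hab, mul_zero]

/-! ### Diagonal moments and cumulants of a mode -/

/-- The moment `⟨|f_k|^{2n}⟩`. -/
noncomputable def modeMoment (k : Fin d → ℤ) (n : ℕ) : ℝ :=
  ∫ ω, ‖F.fourierCoeff k ω‖ ^ (2 * n) ∂F.μ

theorem integral_fourierCoeff {k : Fin d → ℤ} (hk : k ≠ 0) (a b : ℕ) :
    ∫ ω, F.fourierCoeff k ω ^ a * F.fourierCoeff (-k) ω ^ b ∂F.μ =
      ((if a = b then F.modeMoment k a else 0 : ℝ) : ℂ) := by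
  split_ifs with h
  · subst h
    rw [modeMoment, ← integral_complex_ofReal]
    congr 1
    ext ω
    rw [fourierCoeff_neg, ← mul_pow, Complex.mul_conj', pow_mul]
    push_cast
    rfl
  · rw [F.integral_fourierCoeff_eq_zero hk h, Complex.ofReal_zero]

theorem modeMoment_zero (k : Fin d → ℤ) : F.modeMoment k 0 = 1 := by
  simp [modeMoment]

theorem modeMoment_one (k : Fin d → ℤ) : F.modeMoment k 1 = F.powerSpectrum k := by
  simp [modeMoment, powerSpectrum]

theorem powerSpectrum_neg (k : Fin d → ℤ) : F.powerSpectrum (-k) = F.powerSpectrum k := by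
  simp only [powerSpectrum, fourierCoeff_neg, RCLike.norm_conj]

/-- The moment of a block depends only on its numbers of `k` and `-k` and vanishes unless they
agree, which is the situation of `sum_finpartition_diag`. -/
theorem jointCumulant_mode {k : Fin d → ℤ} (hk : k ≠ 0) (n : ℕ) :
    jointCumulant F.μ (fun i => F.fourierCoeff
      (Sum.elim (fun _ : Fin n => k) (fun _ : Fin n => -k) i)) =
      (diagCumulant (F.modeMoment k) n : ℂ) := by
  set M : Finset (Fin n ⊕ Fin n) → ℝ := fun B =>
    if B.toLeft.card = B.toRight.card then F.modeMoment k B.toLeft.card else 0 with hM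
  have hB : ∀ B : Finset (Fin n ⊕ Fin n), ∫ ω, ∏ i ∈ B, F.fourierCoeff
      (Sum.elim (fun _ : Fin n => k) (fun _ : Fin n => -k) i) ω ∂F.μ = (M B : ℂ) := by
    intro B
    rw [hM, ← F.integral_fourierCoeff hk]
    congr 1
    ext ω
    conv_lhs => rw [← Finset.toLeft_disjSum_toRight (u := B)]
    rw [Finset.prod_disjSum]
    simp
  have h := sum_finpartition_diag (F.modeMoment k) M (fun B => rfl) n Finset.univ (by simp)
    (fun r => (-1 : ℝ) ^ (r - 1) * ((r - 1).factorial : ℝ))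
  rw [if_pos (by simp)] at h
  rw [jointCumulant, diagCumulant, ← h]
  push_cast
  refine Finset.sum_congr rfl fun π _ => ?_
  congr 1
  exact Finset.prod_congr rfl fun B _ => hB B

theorem collapsed_eq {k : Fin d → ℤ} (hk : k ≠ 0) (n : ℕ) :
    F.collapsed k n = ((F.V ^ ((n : ℝ) - 1) * diagCumulant (F.modeMoment k) n /
      F.powerSpectrum k ^ n : ℝ) : ℂ) := by
  have hP : 0 ≤ F.powerSpectrum k := integral_nonneg fun ω => by positivity
  have hs : ∑ i, Sum.elim (fun _ : Fin n => k) (fun _ : Fin n => -k) i = 0 := by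
    rw [Fintype.sum_sum_type]
    simp
  have hprod : √(∏ i, F.powerSpectrum (Sum.elim (fun _ : Fin n => k) (fun _ : Fin n => -k) i)) =
      F.powerSpectrum k ^ n := by
    rw [Fintype.prod_sum_type]
    simp only [Sum.elim_inl, Sum.elim_inr, powerSpectrum_neg, Finset.prod_const, Finset.card_univ,
      Fintype.card_fin]
    exact Real.sqrt_mul_self (pow_nonneg hP n)
  rw [collapsed, normalizedPolyspectrum, if_pos hs, hprod, polyspectrum, F.jointCumulant_mode hk]
  have hc : (Fintype.card (Fin n ⊕ Fin n) : ℝ) / 2 - 1 = (n : ℝ) - 1 := by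
    simp only [Fintype.card_sum, Fintype.card_fin]
    push_cast
    ring
  rw [hc]
  push_cast
  rfl

theorem q_eq {k : Fin d → ℤ} (hk : k ≠ 0) (n : ℕ) :
    F.q k n = F.V ^ ((n : ℝ) - 1) * diagCumulant (F.modeMoment k) n / F.powerSpectrum k ^ n := by
  rw [q, F.collapsed_eq hk, Complex.ofReal_re]

/-- The normalized moments `⟨|α_k|^{2n}⟩ / (n!)²`. -/
noncomputable def normMoment (k : Fin d → ℤ) (n : ℕ) : ℝ :=
  F.modeMoment k n / F.powerSpectrum k ^ n / (n.factorial : ℝ) ^ 2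

theorem normMoment_zero (k : Fin d → ℤ) : F.normMoment k 0 = 1 := by
  simp [normMoment, modeMoment_zero]

/-- The recursion of the moments in terms of the collapsed polyspectra. -/
theorem normMoment_recursion {k : Fin d → ℤ} (hk : k ≠ 0) (hP : 0 < F.powerSpectrum k) (a : ℕ) :
    ((a : ℝ) + 1) * F.normMoment k (a + 1) =
      ∑ i ∈ Finset.range (a + 1),
        cumulantDerivCoeff (F.q k) F.V⁻¹ i * F.normMoment k (a - i) := by
  have hrec := diagCumulant_recursion (F.modeMoment k) (F.modeMoment_zero k)
  have hV := F.V_pos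
  -- The lowest cumulant is the power itself, so normalization turns it into the linear coefficient
  -- 1, whatever `q 1` is in the recursion.
  have h1 : diagCumulant (F.modeMoment k) 1 = F.powerSpectrum k := by
    have := hrec 0
    simp [modeMoment_one, modeMoment_zero] at this
    exact this.symm
  have hk' : ∀ i, cumulantDerivCoeff (F.q k) F.V⁻¹ i = ((i : ℝ) + 1) *
      (diagCumulant (F.modeMoment k) (i + 1) / ((i + 1).factorial : ℝ) ^ 2) /
        F.powerSpectrum k ^ (i + 1) := by
    intro i
    rw [cumulantDerivCoeff]
    split_ifs with hi
    · subst hi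
      rw [zero_add, h1]
      have := hP.ne'
      simp
      field_simp
    · rw [F.q_eq hk, show (((i + 1 : ℕ) : ℝ) - 1) = (i : ℝ) by push_cast; ring,
        Real.rpow_natCast, inv_pow]
      have := hV.ne'
      field_simp
  have h := hrec a
  have hPa : F.powerSpectrum k ^ (a + 1) ≠ 0 := (pow_pos hP _).ne'
  rw [normMoment, div_right_comm, ← mul_div_assoc, h, Finset.sum_div]
  refine Finset.sum_congr rfl fun i hi => ?_
  have hia : i ≤ a := by simpa [Nat.lt_succ_iff] using hi
  rw [hk', normMoment, show a + 1 = (i + 1) + (a - i) by omega, pow_add]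
  have : F.powerSpectrum k ≠ 0 := hP.ne'
  field_simp

end PeriodicField

/-! ### Exponentials of entire series -/

/-- If the coefficients `w` solve `W' = K' W`, `W(0) = 1`, where `K` is an everywhere convergent
power series with `K(0) = 0`, then `W = exp K` everywhere. -/
theorem hasSum_exp_of_recursion {c w : ℕ → ℝ} (hc : ∀ x : ℝ, Summable fun n => c n * x ^ n)
    (hc0 : c 0 = 0) (hw0 : w 0 = 1)
    (hw : ∀ a : ℕ, ((a : ℝ) + 1) * w (a + 1) =
      ∑ i ∈ Finset.range (a + 1), ((i : ℝ) + 1) * c (i + 1) * w (a - i)) (x : ℝ) :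
    HasSum (fun n => w n * x ^ n) (Real.exp (∑' n, c n * x ^ n)) := by
  -- Over `ℂ` the exponential of an entire function is entire and equals its Taylor series
  -- everywhere, so only the Taylor coefficients remain to be identified.
  set p : FormalMultilinearSeries ℂ ℂ ℂ :=
    FormalMultilinearSeries.ofScalars ℂ (fun n => (c n : ℂ)) with hp
  have hrad : p.radius = ⊤ := by
    refine FormalMultilinearSeries.radius_eq_top_of_summable_norm p fun r => ?_
    refine (hc r).norm.congr fun n => ?_
    rw [hp, FormalMultilinearSeries.ofScalars_norm]
    simp
  have hball : HasFPowerSeriesOnBall p.sum p 0 ⊤ := by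
    have := p.hasFPowerSeriesOnBall (by rw [hrad]; exact ENNReal.zero_lt_top)
    rwa [hrad] at this
  have hsum : ∀ z : ℂ, p.sum z = ∑' n, (c n : ℂ) * z ^ n := by
    intro z
    have := FormalMultilinearSeries.ofScalars_sum_eq (E := ℂ) (fun n => (c n : ℂ)) z
    simpa [FormalMultilinearSeries.ofScalarsSum] using this
  have hdiff : Differentiable ℂ p.sum := by
    intro z
    exact (hball.analyticAt_of_mem (by simp)).differentiableAt
  have hcoef : ∀ n, iteratedDeriv n p.sum 0 = n.factorial * c n := by
    intro n
    have h1 : AnalyticAt ℂ p.sum 0 := hball.analyticAt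
    have h2 := h1.hasFPowerSeriesAt.eq_formalMultilinearSeries hball.hasFPowerSeriesAt
    have h3 := congrArg (fun r => FormalMultilinearSeries.coeff r n) h2
    simp only [hp, FormalMultilinearSeries.coeff_ofScalars] at h3
    have : (n.factorial : ℂ) ≠ 0 := Nat.cast_ne_zero.2 n.factorial_ne_zero
    rw [div_eq_iff this] at h3
    rw [h3, mul_comm]
  set g : ℂ → ℂ := fun z => Complex.exp (p.sum z) with hg
  have hgdiff : Differentiable ℂ g := hdiff.cexp
  have hgderiv : deriv g = deriv p.sum * g := by
    ext z
    rw [hg, Pi.mul_apply, deriv_cexp (hdiff z)]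
    ring
  -- Leibniz' rule applied to `g' = K' g` reproduces the recursion of `w`.
  have hgcoef : ∀ n, iteratedDeriv n g 0 = n.factorial * w n := by
    intro n
    induction n using Nat.strong_induction_on with
    | _ n ih =>
      rcases n with _ | a
      · have : p.sum 0 = 0 := by
          have := hcoef 0
          simpa [hc0] using this
        simp [hg, this, hw0]
      · rw [iteratedDeriv_succ', hgderiv, iteratedDeriv_mul]
        · have hterm : ∀ i ∈ Finset.range (a + 1), (a.choose i : ℂ) *
              iteratedDeriv i (deriv p.sum) 0 * iteratedDeriv (a - i) g 0 =
              a.factorial * ((((i : ℝ) + 1) * c (i + 1) * w (a - i) : ℝ) : ℂ) := by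
            intro i hi
            have hia : i ≤ a := by simpa [Nat.lt_succ_iff] using hi
            rw [← iteratedDeriv_succ', hcoef, ih (a - i) (by omega), Nat.cast_choose ℂ hia,
              Nat.factorial_succ]
            have h1 : (i.factorial : ℂ) ≠ 0 := Nat.cast_ne_zero.2 i.factorial_ne_zero
            have h2 : ((a - i).factorial : ℂ) ≠ 0 := Nat.cast_ne_zero.2 (a - i).factorial_ne_zero
            push_cast
            field_simp
          rw [Finset.sum_congr rfl hterm, ← Finset.mul_sum, ← Complex.ofReal_sum, ← hw,
            Nat.factorial_succ]
          push_cast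
          ring
        · exact (hdiff.contDiff.iterate_deriv' a 1).contDiffAt
        · exact hgdiff.contDiff.contDiffAt
  have hT := Complex.hasSum_taylorSeries_of_entire hgdiff 0 (x : ℂ)
  have hT' : HasSum (fun n => ((w n * x ^ n : ℝ) : ℂ)) ((Real.exp (∑' n, c n * x ^ n) : ℝ) : ℂ) := by
    refine hasSum_of_eq hT (fun n => ?_) ?_
    · rw [hgcoef, sub_zero, smul_eq_mul, smul_eq_mul]
      have h1 : (n.factorial : ℂ) ≠ 0 := Nat.cast_ne_zero.2 n.factorial_ne_zero
      push_cast
      field_simp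
    · change _ = Complex.exp (p.sum x)
      rw [hsum]
      push_cast
      rfl
  exact_mod_cast hT'

/-! ### Exponential moments and the characteristic function of a mode -/

namespace PeriodicField

variable {d : ℕ} (F : PeriodicField.{u} d)

theorem aemeasurable_fourierCoeff (k : Fin d → ℤ) : AEMeasurable (F.fourierCoeff k) F.μ := by
  have := (F.integrable_fourierCoeff k 1 0).aestronglyMeasurable.aemeasurable
  simpa using this

theorem aemeasurable_α (k : Fin d → ℤ) : AEMeasurable (F.α k) F.μ :=
  (F.aemeasurable_fourierCoeff k).div_const _

theorem integrable_α (k : Fin d → ℤ) (a b : ℕ) :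
    Integrable (fun ω => F.α k ω ^ a * (starRingEnd ℂ) (F.α k ω) ^ b) F.μ := by
  refine ((F.integrable_fourierCoeff k a b).const_mul
    ((((√(F.powerSpectrum k) : ℝ) : ℂ)⁻¹) ^ (a + b))).congr (Filter.Eventually.of_forall fun ω => ?_)
  simp only [α, fourierCoeff_neg, map_div₀, Complex.conj_ofReal]
  rw [div_eq_mul_inv, div_eq_mul_inv, mul_pow, mul_pow, pow_add]
  ring

theorem integral_α {k : Fin d → ℤ} (hk : k ≠ 0) (hP : 0 < F.powerSpectrum k) (a b : ℕ) :
    ∫ ω, F.α k ω ^ a * (starRingEnd ℂ) (F.α k ω) ^ b ∂F.μ =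
      ((if a = b then (a.factorial : ℝ) ^ 2 * F.normMoment k a else 0 : ℝ) : ℂ) := by
  have e : ∀ ω, F.α k ω ^ a * (starRingEnd ℂ) (F.α k ω) ^ b =
      (((√(F.powerSpectrum k) : ℝ) : ℂ)⁻¹) ^ (a + b) *
        (F.fourierCoeff k ω ^ a * F.fourierCoeff (-k) ω ^ b) := by
    intro ω
    simp only [α, fourierCoeff_neg, map_div₀, Complex.conj_ofReal]
    rw [div_eq_mul_inv, div_eq_mul_inv, mul_pow, mul_pow, pow_add]
    ring
  simp only [e]
  rw [integral_const_mul, F.integral_fourierCoeff hk]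
  split_ifs with h
  · subst h
    rw [← Complex.ofReal_inv, ← Complex.ofReal_pow, ← Complex.ofReal_mul]
    congr 1
    rw [inv_pow, ← two_mul, pow_mul, Real.sq_sqrt hP.le, normMoment]
    have := (pow_pos hP a).ne'
    field_simp
  · simp

theorem integrable_norm_α_pow (k : Fin d → ℤ) (n : ℕ) :
    Integrable (fun ω => ‖F.α k ω‖ ^ (2 * n)) F.μ := by
  refine (F.integrable_α k n n).norm.congr (Filter.Eventually.of_forall fun ω => ?_)
  simp only [norm_mul, norm_pow, RCLike.norm_conj]
  ring

theorem integral_norm_α_pow {k : Fin d → ℤ} (hk : k ≠ 0) (hP : 0 < F.powerSpectrum k) (n : ℕ) :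
    ∫ ω, ‖F.α k ω‖ ^ (2 * n) ∂F.μ = (n.factorial : ℝ) ^ 2 * F.normMoment k n := by
  have h := F.integral_α hk hP n n
  rw [if_pos rfl] at h
  have e : ∀ ω, F.α k ω ^ n * (starRingEnd ℂ) (F.α k ω) ^ n = ((‖F.α k ω‖ ^ (2 * n) : ℝ) : ℂ) := by
    intro ω
    rw [← mul_pow, Complex.mul_conj', pow_mul]
    push_cast
    rfl
  simp only [e] at h
  rw [integral_complex_ofReal] at h
  exact_mod_cast h

theorem normMoment_nonneg {k : Fin d → ℤ} (hk : k ≠ 0) (hP : 0 < F.powerSpectrum k) (n : ℕ) :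
    0 ≤ F.normMoment k n := by
  have h := F.integral_norm_α_pow hk hP n
  have h1 : 0 ≤ ∫ ω, ‖F.α k ω‖ ^ (2 * n) ∂F.μ := integral_nonneg fun ω => by positivity
  rw [h] at h1
  exact nonneg_of_mul_nonneg_right h1 (by positivity)

/-- The normalized moments are the power series coefficients of the exponential of the
generating function of the cumulants. -/
theorem hasSum_normMoment {k : Fin d → ℤ} (hk : k ≠ 0) (hP : 0 < F.powerSpectrum k)
    (hs : ∀ x : ℝ, Summable (symbolTerm F.V (F.q k) x)) (x : ℝ) :
    HasSum (fun n => F.normMoment k n * x ^ n) (Real.exp x * expSymbol F.V (F.q k) (4 * x)) := by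
  set c : ℕ → ℝ := fun n => if n = 0 then 0 else
    cumulantDerivCoeff (F.q k) F.V⁻¹ (n - 1) / n with hc
  have hV := F.V_pos.ne'
  -- The argument `4 * y` absorbs the `4^n` in `cumulantCoeff`.
  have hterm : ∀ (y : ℝ) (m : ℕ), c (m + 2) * y ^ (m + 2) = symbolTerm F.V (F.q k) (4 * y) m := by
    intro y m
    simp only [hc, symbolTerm, cumulantCoeff, cumulantDerivCoeff]
    rw [if_neg (by omega), if_neg (by omega), show m + 2 - 1 = m + 1 by omega,
      show m + 1 + 1 = m + 2 by omega, mul_pow, inv_pow]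
    have : ((m + 2).factorial : ℝ) ≠ 0 := by positivity
    push_cast
    have : (m : ℝ) + 2 ≠ 0 := by positivity
    field_simp
    ring
  have hsumm : ∀ y : ℝ, Summable fun n => c n * y ^ n := by
    intro y
    rw [← summable_nat_add_iff 2]
    exact (hs (4 * y)).congr fun m => (hterm y m).symm
  have hval : ∑' n, c n * x ^ n = x + ∑' m, symbolTerm F.V (F.q k) (4 * x) m := by
    rw [← (hsumm x).sum_add_tsum_nat_add 2]
    congr 1
    · simp [Finset.sum_range_succ, hc, cumulantDerivCoeff]
    · exact tsum_congr fun m => hterm x m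
  have h := hasSum_exp_of_recursion hsumm (by simp [hc]) (F.normMoment_zero k) (fun a => ?_) x
  · rwa [hval, Real.exp_add] at h
  · rw [F.normMoment_recursion hk hP]
    refine Finset.sum_congr rfl fun i _ => ?_
    simp only [hc]
    rw [if_neg (Nat.succ_ne_zero i), Nat.add_sub_cancel]
    have : (i : ℝ) + 1 ≠ 0 := by positivity
    push_cast
    field_simp

/-- From `(n!)² ≤ (2n)!` the moments of the `cosh` series are dominated by the convergent series of
the normalized moments at `t²`, and `exp ≤ 2 cosh`. -/
theorem integrable_exp_norm_α {k : Fin d → ℤ} (hk : k ≠ 0) (hP : 0 < F.powerSpectrum k)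
    (hs : ∀ x : ℝ, Summable (symbolTerm F.V (F.q k) x)) {t : ℝ} (ht : 0 ≤ t) :
    Integrable (fun ω => Real.exp (t * ‖F.α k ω‖)) F.μ := by
  have hα := F.aemeasurable_α k
  have hsum : Summable fun n => ∫ ω, (t * ‖F.α k ω‖) ^ (2 * n) / ((2 * n).factorial : ℝ) ∂F.μ := by
    refine Summable.of_nonneg_of_le (fun n => integral_nonneg fun ω => by positivity) (fun n => ?_)
      (F.hasSum_normMoment hk hP hs (t ^ 2)).summable
    have e : ∀ ω, (t * ‖F.α k ω‖) ^ (2 * n) / ((2 * n).factorial : ℝ) =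
        (t ^ 2) ^ n / ((2 * n).factorial : ℝ) * ‖F.α k ω‖ ^ (2 * n) := by
      intro ω
      rw [mul_pow, pow_mul t]
      ring
    simp only [e]
    rw [integral_const_mul, F.integral_norm_α_pow hk hP]
    have h1 : ((n.factorial : ℝ)) ^ 2 ≤ ((2 * n).factorial : ℝ) := by
      have := Nat.factorial_mul_factorial_dvd_factorial_add n n
      have h2 := Nat.le_of_dvd (Nat.factorial_pos _) this
      rw [← two_mul] at h2
      rw [pow_two]
      exact_mod_cast h2
    have h2 := F.normMoment_nonneg hk hP n
    have h3 : (0 : ℝ) < ((2 * n).factorial : ℝ) := by positivity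
    rw [div_mul_eq_mul_div, div_le_iff₀ h3]
    calc (t ^ 2) ^ n * ((n.factorial : ℝ) ^ 2 * F.normMoment k n)
        = F.normMoment k n * (t ^ 2) ^ n * (n.factorial : ℝ) ^ 2 := by ring
      _ ≤ _ := by gcongr
  have hcosh : Integrable (fun ω => Real.cosh (t * ‖F.α k ω‖)) F.μ := by
    refine ⟨(Real.continuous_cosh.measurable.comp_aemeasurable
      (hα.norm.const_mul t)).aestronglyMeasurable, ?_⟩
    rw [hasFiniteIntegral_iff_ofReal (Filter.Eventually.of_forall fun ω => (Real.cosh_pos _).le)]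
    have e : ∀ ω, ENNReal.ofReal (Real.cosh (t * ‖F.α k ω‖)) =
        ∑' n : ℕ, ENNReal.ofReal ((t * ‖F.α k ω‖) ^ (2 * n) / ((2 * n).factorial : ℝ)) := by
      intro ω
      have := Real.hasSum_cosh (t * ‖F.α k ω‖)
      rw [← this.tsum_eq, ENNReal.ofReal_tsum_of_nonneg (fun n => by positivity) this.summable]
    simp only [e]
    rw [lintegral_tsum fun n => (((hα.norm.const_mul t).pow_const _).div_const _).ennreal_ofReal]
    have e2 : ∀ n : ℕ, ∫⁻ ω, ENNReal.ofReal ((t * ‖F.α k ω‖) ^ (2 * n) / ((2 * n).factorial : ℝ)) ∂F.μ =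
        ENNReal.ofReal (∫ ω, (t * ‖F.α k ω‖) ^ (2 * n) / ((2 * n).factorial : ℝ) ∂F.μ) := by
      intro n
      rw [ofReal_integral_eq_lintegral_ofReal]
      · simp only [mul_pow]
        exact ((F.integrable_norm_α_pow k n).const_mul _).div_const _
      · exact Filter.Eventually.of_forall fun ω => by positivity
    simp only [e2]
    exact hsum.tsum_ofReal_lt_top
  refine (hcosh.const_mul 2).mono' (Real.continuous_exp.measurable.comp_aemeasurable
      (hα.norm.const_mul t)).aestronglyMeasurable (Filter.Eventually.of_forall fun ω => ?_)
  rw [Real.norm_of_nonneg (Real.exp_pos _).le, Real.cosh_eq]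
  have := (Real.exp_pos (-(t * ‖F.α k ω‖))).le
  linarith

/-- Binomial expansion of `⟨α, t⟩ = (t̄ α + t ᾱ)/2`; only the middle term can survive the
expectation. -/
theorem integral_inner_α_pow {k : Fin d → ℤ} (hk : k ≠ 0) (hP : 0 < F.powerSpectrum k) (t : ℂ)
    (N : ℕ) : ∫ ω, ((inner ℝ (F.α k ω) t : ℝ) : ℂ) ^ N ∂F.μ =
      ∑ j ∈ Finset.range (N + 1), (((starRingEnd ℂ) t / 2) ^ j * (t / 2) ^ (N - j) * (N.choose j : ℂ)) *
        ((if j = N - j then (j.factorial : ℝ) ^ 2 * F.normMoment k j else 0 : ℝ) : ℂ) := by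
  have e : ∀ ω, ((inner ℝ (F.α k ω) t : ℝ) : ℂ) ^ N = ∑ j ∈ Finset.range (N + 1),
      (((starRingEnd ℂ) t / 2) ^ j * (t / 2) ^ (N - j) * (N.choose j : ℂ)) *
        (F.α k ω ^ j * (starRingEnd ℂ) (F.α k ω) ^ (N - j)) := by
    intro ω
    have : ((inner ℝ (F.α k ω) t : ℝ) : ℂ) =
        ((starRingEnd ℂ) t / 2) * F.α k ω + (t / 2) * (starRingEnd ℂ) (F.α k ω) := by
      rw [Complex.inner, Complex.re_eq_add_conj]
      simp only [map_mul, Complex.conj_conj]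
      ring
    rw [this, add_pow]
    refine Finset.sum_congr rfl fun j _ => ?_
    rw [mul_pow, mul_pow]
    ring
  simp only [e]
  rw [integral_finsetSum _ fun j _ => (F.integrable_α k j (N - j)).const_mul _]
  refine Finset.sum_congr rfl fun j _ => ?_
  rw [integral_const_mul, F.integral_α hk hP]

/-- The characteristic function of the normalized mode. -/
theorem charFun_α {k : Fin d → ℤ} (hk : k ≠ 0) (hP : 0 < F.powerSpectrum k)
    (hs : ∀ x : ℝ, Summable (symbolTerm F.V (F.q k) x)) (t : ℂ) :
    charFun (F.μ.map (F.α k)) t =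
      ((Real.exp (-‖t‖ ^ 2 / 4) * expSymbol F.V (F.q k) (-‖t‖ ^ 2) : ℝ) : ℂ) := by
  have hα := F.aemeasurable_α k
  rw [charFun_apply, integral_map hα (by fun_prop)]
  have h1 : HasSum (fun N : ℕ => ∫ ω, (((inner ℝ (F.α k ω) t : ℝ) : ℂ) * Complex.I) ^ N /
      (N.factorial : ℂ) ∂F.μ) (∫ ω, Complex.exp (((inner ℝ (F.α k ω) t : ℝ) : ℂ) * Complex.I) ∂F.μ) := by
    refine hasSum_integral_of_dominated_convergence
      (fun N ω => (‖t‖ * ‖F.α k ω‖) ^ N / (N.factorial : ℝ)) (fun N => ?_) (fun N => ?_) ?_ ?_ ?_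
    · have : Continuous fun z : ℂ => (((inner ℝ z t : ℝ) : ℂ) * Complex.I) ^ N /
        (N.factorial : ℂ) := by fun_prop
      exact (this.measurable.comp_aemeasurable hα).aestronglyMeasurable
    · refine Filter.Eventually.of_forall fun ω => ?_
      rw [norm_div, norm_pow, norm_mul, Complex.norm_I, mul_one, Complex.norm_natCast,
        Complex.norm_real]
      have : ‖(inner ℝ (F.α k ω) t : ℝ)‖ ≤ ‖t‖ * ‖F.α k ω‖ := by
        rw [mul_comm]; exact norm_inner_le_norm _ _
      gcongr
    · exact Filter.Eventually.of_forall fun ω => Real.summable_pow_div_factorial _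
    · refine (F.integrable_exp_norm_α hk hP hs (norm_nonneg t)).congr
        (Filter.Eventually.of_forall fun ω => ?_)
      simp only
      rw [Real.exp_eq_exp_ℝ, NormedSpace.exp_eq_tsum_div]
    · refine Filter.Eventually.of_forall fun ω => ?_
      rw [Complex.exp_eq_exp_ℂ]
      exact NormedSpace.expSeries_div_hasSum_exp _
  have hodd : ∀ N ∉ Set.range (fun n : ℕ => 2 * n), ∫ ω, (((inner ℝ (F.α k ω) t : ℝ) : ℂ) *
      Complex.I) ^ N / (N.factorial : ℂ) ∂F.μ = 0 := by
    intro N hN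
    simp only [mul_pow]
    rw [integral_div, integral_mul_const, F.integral_inner_α_pow hk hP, Finset.sum_eq_zero]
    · simp
    · intro j hj
      rw [if_neg, Complex.ofReal_zero, mul_zero]
      intro h
      have : j ≤ N := by simpa [Nat.lt_succ_iff] using hj
      exact hN ⟨j, by simp only; omega⟩
  have hinj : Function.Injective fun n : ℕ => 2 * n := fun a b h => by simpa using h
  have h2 := (hinj.hasSum_iff hodd).2 h1
  -- For `N = 2n` the central binomial cancels `(n!)²/(2n)!`, leaving the normalized moment times
  -- `(-‖t‖²/4)^n`.
  have h3 := F.hasSum_normMoment hk hP hs (-‖t‖ ^ 2 / 4)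
  rw [show 4 * (-‖t‖ ^ 2 / 4) = -‖t‖ ^ 2 by ring] at h3
  have h3' := (Complex.hasSum_ofReal.2 h3)
  refine h2.unique (hasSum_of_eq h3' (fun n => ?_) rfl)
  simp only [Function.comp_apply, mul_pow]
  rw [integral_div, integral_mul_const, F.integral_inner_α_pow hk hP, Finset.sum_eq_single n]
  · rw [if_pos (by omega), show 2 * n - n = n by omega, ← mul_pow, pow_mul, Complex.I_sq,
      show (starRingEnd ℂ) t / 2 * (t / 2) = ((‖t‖ ^ 2 / 4 : ℝ) : ℂ) by
        rw [div_mul_div_comm, Complex.conj_mul']; push_cast; norm_num,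
      Nat.cast_choose ℂ (show n ≤ 2 * n by omega), show 2 * n - n = n by omega]
    have h4 : (n.factorial : ℂ) ≠ 0 := Nat.cast_ne_zero.2 n.factorial_ne_zero
    have h5 : ((2 * n).factorial : ℂ) ≠ 0 := Nat.cast_ne_zero.2 (2 * n).factorial_ne_zero
    rw [show (-‖t‖ ^ 2 / 4 : ℝ) = -1 * (‖t‖ ^ 2 / 4) by ring]
    generalize ‖t‖ ^ 2 / 4 = r
    rw [mul_pow]
    push_cast
    field_simp
  · intro j _ hj
    rw [if_neg (by omega), Complex.ofReal_zero, mul_zero]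
  · intro h
    simp at h
    omega

end PeriodicField

section Inversion

open FourierTransform SchwartzMap

variable {V : Type*} [NormedAddCommGroup V] [InnerProductSpace ℝ V] [FiniteDimensional ℝ V]
  [MeasurableSpace V] [BorelSpace V]

/-! ### Fourier inversion for measures -/

theorem continuous_fourier_of_integrable {c : V → ℂ} (hc : Integrable c) : Continuous (𝓕 c) :=
  VectorFourier.fourierIntegral_continuous Real.continuous_fourierChar continuous_inner hc

/-- Parseval's formula for a finite measure and a Schwartz function. -/
theorem integral_schwartz_eq (ν : Measure V) [IsFiniteMeasure ν]
    (hν : Integrable fun ξ : V => charFun ν ((2 * Real.pi) • ξ)) (ψ : 𝓢(V, ℂ)) :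
    ∫ x, ψ x ∂ν = ∫ x, ψ x * 𝓕 (fun ξ : V => charFun ν ((2 * Real.pi) • ξ)) x := by
  set χ : 𝓢(V, ℂ) := 𝓕⁻ ψ with hχ
  have hψ : 𝓕 (χ : V → ℂ) = ψ := by
    rw [← SchwartzMap.fourier_coe, hχ, FourierTransform.fourier_fourierInv_eq]
  have hL : Continuous fun p : V × V => innerₗ V p.1 p.2 := continuous_inner
  -- The Fourier transform is moved across the pairing twice: here between `ν` and Lebesgue measure,
  -- where the constant 1 produces the characteristic function, and in `h2` between two copies of
  -- Lebesgue measure.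
  have h1 := VectorFourier.integral_fourierIntegral_smul_eq_flip (L := innerₗ V) (μ := ν)
    (ν := volume) (f := fun _ => (1 : ℂ)) (g := χ) Real.continuous_fourierChar hL
    (integrable_const _) χ.integrable
  rw [flip_innerₗ] at h1
  have h1' : ∫ ξ, charFun ν (-((2 * Real.pi) • ξ)) * χ ξ = ∫ x, ψ x ∂ν := by
    have e1 : ∀ x, VectorFourier.fourierIntegral Real.fourierChar volume (innerₗ V) (χ : V → ℂ) x =
        ψ x := fun x => congrFun hψ x
    simp only [e1, one_mul, smul_eq_mul] at h1
    rw [← h1]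
    congr 1
    ext ξ
    congr 1
    rw [charFun_eq_fourierIntegral']
    congr 1
    rw [neg_smul, smul_neg, neg_neg, smul_smul, inv_mul_cancel₀ (by positivity), one_smul]
  have h2 := VectorFourier.integral_fourierIntegral_smul_eq_flip (L := innerₗ V) (μ := volume)
    (ν := volume) (f := ψ) (g := fun ξ : V => charFun ν ((2 * Real.pi) • ξ))
    Real.continuous_fourierChar hL ψ.integrable hν
  rw [flip_innerₗ] at h2
  simp only [smul_eq_mul] at h2
  rw [← h1']
  refine Eq.trans ?_ h2
  rw [← integral_neg_eq_self]
  congr 1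
  ext ξ
  have e2 : χ (-ξ) = 𝓕 (ψ : V → ℂ) ξ := by
    rw [hχ, SchwartzMap.fourierInv_coe, Real.fourierInv_eq_fourier_neg, neg_neg]
  rw [e2, smul_neg, neg_neg, mul_comm]
  rfl

/-- For smooth `0 ≤ f ≤ 1` with `f ≠ 0` exactly on `U`, the functions `1 - (1 - f)^n` are smooth
test functions converging to the indicator of `U`. Boundedness of `U` makes their supports compact.
-/
theorem setIntegral_density_eq (ν : Measure V) [IsFiniteMeasure ν]
    (hν : Integrable fun ξ : V => charFun ν ((2 * Real.pi) • ξ)) {U : Set V} (hU : IsOpen U)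
    (hb : Bornology.IsBounded U) :
    ∫ x in U, (𝓕 (fun ξ : V => charFun ν ((2 * Real.pi) • ξ)) x).re = ν.real U := by
  set h := 𝓕 (fun ξ : V => charFun ν ((2 * Real.pi) • ξ)) with hh
  have hcont : Continuous h := continuous_fourier_of_integrable hν
  obtain ⟨f, hsupp, hsm, hrange⟩ := hU.exists_contDiff_support_eq (n := ⊤)
  have h01 : ∀ x, 0 ≤ f x ∧ f x ≤ 1 := fun x => hrange ⟨x, rfl⟩
  have hK : IsCompact (closure U) := hb.isCompact_closure
  have hintU : IntegrableOn (fun x => (h x).re) U :=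
    ((Complex.continuous_re.comp hcont).continuousOn.integrableOn_compact hK).mono_set
      subset_closure
  set g : ℕ → V → ℝ := fun n x => 1 - (1 - f x) ^ n with hg
  have hgzero : ∀ n x, x ∉ U → g n x = 0 := by
    intro n x hx
    have : f x = 0 := by
      by_contra hne
      exact hx (hsupp ▸ hne)
    simp [hg, this]
  have hg01 : ∀ n x, 0 ≤ g n x ∧ g n x ≤ 1 := by
    intro n x
    have h1 : 0 ≤ 1 - f x := by linarith [(h01 x).2]
    have h2 : 1 - f x ≤ 1 := by linarith [(h01 x).1]
    have h3 := pow_le_one₀ (n := n) h1 h2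
    have h4 := pow_nonneg h1 n
    simp only [hg]
    constructor <;> linarith
  have hgsm : ∀ n, ContDiff ℝ (⊤ : ℕ∞) (g n) := fun n => contDiff_const.sub ((contDiff_const.sub hsm).pow n)
  have hglim : ∀ x, Filter.Tendsto (fun n => g n x) Filter.atTop
      (nhds (U.indicator (fun _ => 1) x)) := by
    intro x
    by_cases hx : x ∈ U
    · have hne : f x ≠ 0 := by
        have : x ∈ f.support := hsupp ▸ hx
        exact this
      have hpos : 0 < f x := lt_of_le_of_ne (h01 x).1 hne.symm
      rw [Set.indicator_of_mem hx]
      have := (tendsto_pow_atTop_nhds_zero_of_lt_one (r := 1 - f x) (by linarith [(h01 x).2])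
        (by linarith)).const_sub 1
      simpa using this
    · rw [Set.indicator_of_notMem hx]
      simp only [hgzero _ x hx]
      exact tendsto_const_nhds
  have hcs : ∀ n, HasCompactSupport fun x => ((g n x : ℝ) : ℂ) := fun n =>
    HasCompactSupport.intro hK fun x hx => by
      rw [hgzero n x fun hxU => hx (subset_closure hxU), Complex.ofReal_zero]
  have hcsm : ∀ n, ContDiff ℝ (⊤ : ℕ∞) fun x => ((g n x : ℝ) : ℂ) := fun n =>
    Complex.ofRealCLM.contDiff.comp (hgsm n)
  have heq : ∀ n, ∫ x, g n x ∂ν = ∫ x, g n x * (h x).re := by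
    intro n
    have h1 := integral_schwartz_eq ν hν ((hcs n).toSchwartzMap (hcsm n))
    change ∫ x, ((g n x : ℝ) : ℂ) ∂ν = ∫ x, ((g n x : ℝ) : ℂ) * h x at h1
    rw [integral_complex_ofReal] at h1
    have h2 : Integrable fun x => ((g n x : ℝ) : ℂ) * h x := by
      refine Continuous.integrable_of_hasCompactSupport ?_ ((hcs n).mul_right)
      exact (hcsm n).continuous.mul hcont
    have h3 := congrArg Complex.re h1
    rw [Complex.ofReal_re] at h3
    rw [h3, ← RCLike.re_eq_complex_re, ← integral_re h2]
    congr 1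
    ext x
    simp
  have hlim1 : Filter.Tendsto (fun n => ∫ x, g n x ∂ν) Filter.atTop (nhds (ν.real U)) := by
    have : ν.real U = ∫ x, U.indicator (fun _ => (1 : ℝ)) x ∂ν := by
      rw [integral_indicator hU.measurableSet]; simp
    rw [this]
    refine tendsto_integral_of_dominated_convergence (fun _ => 1)
      (fun n => (hgsm n).continuous.aestronglyMeasurable) (integrable_const _)
      (fun n => Filter.Eventually.of_forall fun x => ?_) (Filter.Eventually.of_forall hglim)
    rw [Real.norm_of_nonneg (hg01 n x).1]
    exact (hg01 n x).2
  have hlim2 : Filter.Tendsto (fun n => ∫ x, g n x * (h x).re) Filter.atTop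
      (nhds (∫ x in U, (h x).re)) := by
    rw [← integral_indicator hU.measurableSet]
    refine tendsto_integral_of_dominated_convergence (fun x => ‖U.indicator (fun x => (h x).re) x‖)
      (fun n => ((hgsm n).continuous.mul
        (Complex.continuous_re.comp hcont)).aestronglyMeasurable)
      (hintU.integrable_indicator hU.measurableSet).norm
      (fun n => Filter.Eventually.of_forall fun x => ?_) (Filter.Eventually.of_forall fun x => ?_)
    · by_cases hx : x ∈ U
      · rw [Set.indicator_of_mem hx, norm_mul, Real.norm_of_nonneg (hg01 n x).1]
        exact mul_le_of_le_one_left (norm_nonneg _) (hg01 n x).2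
      · rw [hgzero n x hx, zero_mul, norm_zero]
        exact norm_nonneg _
    · have := (hglim x).mul_const (h x).re
      by_cases hx : x ∈ U
      · simpa [hx] using this
      · simpa [hx] using this
  simp only [heq] at hlim1
  exact tendsto_nhds_unique hlim2 hlim1

/-- A negative value would persist on a small ball by continuity and give that ball negative mass.
-/
theorem re_fourier_charFun_nonneg (ν : Measure V) [IsFiniteMeasure ν]
    (hν : Integrable fun ξ : V => charFun ν ((2 * Real.pi) • ξ)) (x : V) :
    0 ≤ (𝓕 (fun ξ : V => charFun ν ((2 * Real.pi) • ξ)) x).re := by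
  set h := fun x => (𝓕 (fun ξ : V => charFun ν ((2 * Real.pi) • ξ)) x).re with hh
  have hcont : Continuous h := Complex.continuous_re.comp (continuous_fourier_of_integrable hν)
  change 0 ≤ h x
  by_contra! hneg
  obtain ⟨r, hr, hball⟩ := Metric.isOpen_iff.1 (isOpen_lt hcont continuous_const) x
    (show h x < h x / 2 by linarith)
  have h1 := setIntegral_density_eq ν hν (Metric.isOpen_ball (x := x) (ε := r))
    Metric.isBounded_ball
  have hInt : IntegrableOn h (Metric.ball x r) :=
    (hcont.continuousOn.integrableOn_compact (isCompact_closedBall x r)).mono_set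
      Metric.ball_subset_closedBall
  have h2 : ∫ y in Metric.ball x r, h y ≤ ∫ _ in Metric.ball x r, h x / 2 :=
    setIntegral_mono_on hInt (integrableOn_const (Metric.isBounded_ball.measure_lt_top).ne)
      measurableSet_ball fun y hy => (hball hy).le
  rw [setIntegral_const, smul_eq_mul] at h2
  have h3 : 0 < (volume : Measure V).real (Metric.ball x r) :=
    ENNReal.toReal_pos (Metric.measure_ball_pos volume x hr).ne'
      (Metric.isBounded_ball.measure_lt_top).ne
  have h4 : 0 ≤ ν.real (Metric.ball x r) := measureReal_nonneg
  rw [← h1] at h4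
  have h5 : ∫ y in Metric.ball x r, h y < 0 := lt_of_le_of_lt h2 (mul_neg_of_pos_of_neg h3 (by linarith))
  exact absurd h4 (not_le.2 h5)

/-- A finite measure with integrable characteristic function has a density, given by Fourier
inversion. -/
theorem eq_withDensity_fourier_charFun (ν : Measure V) [IsFiniteMeasure ν]
    (hν : Integrable fun ξ : V => charFun ν ((2 * Real.pi) • ξ)) :
    ν = volume.withDensity fun x =>
      ENNReal.ofReal (𝓕 (fun ξ : V => charFun ν ((2 * Real.pi) • ξ)) x).re := by
  set h := fun x => (𝓕 (fun ξ : V => charFun ν ((2 * Real.pi) • ξ)) x).re with hh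
  have hcont : Continuous h := Complex.continuous_re.comp (continuous_fourier_of_integrable hν)
  have : IsLocallyFiniteMeasure ((volume : Measure V).withDensity fun x => ENNReal.ofReal (h x)) :=
    IsLocallyFiniteMeasure.withDensity_ofReal hcont
  refine Measure.OuterRegular.ext_isOpen_isBounded fun U hU hb => ?_
  have hInt : IntegrableOn h U :=
    (hcont.continuousOn.integrableOn_compact hb.isCompact_closure).mono_set subset_closure
  rw [withDensity_apply _ hU.measurableSet, ← ofReal_integral_eq_lintegral_ofReal hInt
    (Filter.Eventually.of_forall fun x => re_fourier_charFun_nonneg ν hν x),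
    setIntegral_density_eq ν hν hU hb, ofReal_measureReal]

end Inversion

/-! ### Radial Fourier transforms and polar coordinates -/

theorem integral_cos_mul_cos_sub (z θ₀ : ℝ) :
    ∫ θ in Set.Ioo (-Real.pi) Real.pi, Real.cos (z * Real.cos (θ - θ₀)) =
      2 * Real.pi * besselJ0 z := by
  have hper : Function.Periodic (fun θ => Real.cos (z * Real.cos θ)) (2 * Real.pi) := by
    intro θ
    simp only [Real.cos_add_two_pi]
  rw [← integral_Ioc_eq_integral_Ioo, ← intervalIntegral.integral_of_le (by linarith [Real.pi_pos]),
    intervalIntegral.integral_comp_sub_right (fun θ => Real.cos (z * Real.cos θ)) θ₀, besselJ0,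
    show Real.pi - θ₀ = (-Real.pi - θ₀) + 2 * Real.pi by ring,
    hper.intervalIntegral_add_eq (-Real.pi - θ₀) 0, zero_add, ← mul_assoc,
    mul_inv_cancel₀ Real.two_pi_pos.ne', one_mul]

theorem volume_restrict_polarCoord_target : (volume : Measure (ℝ × ℝ)).restrict polarCoord.target =
    (volume.restrict (Set.Ioi 0)).prod (volume.restrict (Set.Ioo (-Real.pi) Real.pi)) := by
  rw [polarCoord_target, Measure.prod_restrict]; rfl

/-- The Fourier transform of a radial function on the plane is a Hankel transform. -/
theorem integral_cos_inner_mul_radial {Φ : ℝ → ℝ}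
    (hΦ : IntegrableOn (fun κ => Φ κ * κ) (Set.Ioi 0)) (z : ℂ) :
    ∫ t : ℂ, Real.cos (inner ℝ t z) * Φ ‖t‖ =
      2 * Real.pi * ∫ κ in Set.Ioi (0 : ℝ), Φ κ * κ * besselJ0 (κ * ‖z‖) := by
  rw [← Complex.integral_comp_polarCoord_symm]
  have hpt : ∀ p ∈ polarCoord.target, p.1 • (Real.cos (inner ℝ (Complex.polarCoord.symm p) z) *
      Φ ‖Complex.polarCoord.symm p‖) =
      Φ p.1 * p.1 * Real.cos (p.1 * ‖z‖ * Real.cos (p.2 - z.arg)) := by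
    rintro ⟨r, θ⟩ hp
    have hr : 0 < r := by
      rw [polarCoord_target] at hp
      exact hp.1
    have hinner : inner ℝ (Complex.polarCoord.symm (r, θ)) z = r * ‖z‖ * Real.cos (θ - z.arg) := by
      rw [Complex.polarCoord_symm_apply, Complex.inner, Real.cos_sub]
      simp only [map_mul, map_add, Complex.conj_ofReal, Complex.conj_I, Complex.mul_re,
        Complex.mul_im, Complex.add_re, Complex.add_im, Complex.ofReal_re, Complex.ofReal_im,
        Complex.neg_re, Complex.neg_im, Complex.I_re, Complex.I_im]
      linear_combination (-(r * Real.cos θ)) * Complex.norm_mul_cos_arg z -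
        r * Real.sin θ * Complex.norm_mul_sin_arg z
    rw [hinner, Complex.norm_polarCoord_symm, abs_of_pos hr, smul_eq_mul]
    ring
  rw [setIntegral_congr_fun polarCoord.open_target.measurableSet hpt,
    volume_restrict_polarCoord_target, integral_prod]
  · rw [← integral_const_mul]
    refine setIntegral_congr_fun measurableSet_Ioi fun r _ => ?_
    simp only
    rw [integral_const_mul, integral_cos_mul_cos_sub]
    ring
  · have h1 : Integrable (fun p : ℝ × ℝ => Φ p.1 * p.1 * 1)
        ((volume.restrict (Set.Ioi 0)).prod (volume.restrict (Set.Ioo (-Real.pi) Real.pi))) := by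
      have : IsFiniteMeasure ((volume : Measure ℝ).restrict (Set.Ioo (-Real.pi) Real.pi)) :=
        ⟨by simp⟩
      exact Integrable.mul_prod (f := fun κ => Φ κ * κ) (g := fun _ => (1 : ℝ)) hΦ
        (integrable_const _)
    simp only [mul_one] at h1
    have hc : Continuous fun p : ℝ × ℝ => Real.cos (p.1 * ‖z‖ * Real.cos (p.2 - z.arg)) := by
      fun_prop
    exact h1.mul_bdd (c := 1) hc.aestronglyMeasurable
      (Filter.Eventually.of_forall fun p => Real.abs_cos_le_one _)

/-- Passes from the range of `arg` to that of `polar`: negative angles move up by a full turn, and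
the endpoint is a null set. -/
theorem lintegral_wrap_angle (g : ℝ → ENNReal) :
    ∫⁻ θ in Set.Ioo (-Real.pi) Real.pi, g (if θ < 0 then θ + 2 * Real.pi else θ) =
      ∫⁻ θ in Set.Ico 0 (2 * Real.pi), g θ := by
  have hπ := Real.pi_pos
  have h1 : Set.Ioo (-Real.pi) Real.pi = Set.Ioo (-Real.pi) 0 ∪ Set.Ico 0 Real.pi :=
    (Set.Ioo_union_Ico_eq_Ioo (by linarith) hπ.le).symm
  have h2 : Set.Ico 0 (2 * Real.pi) = Set.Ico 0 Real.pi ∪ Set.Ico Real.pi (2 * Real.pi) :=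
    (Set.Ico_union_Ico_eq_Ico hπ.le (by linarith)).symm
  rw [h1, h2, lintegral_union measurableSet_Ico, lintegral_union measurableSet_Ico, add_comm]
  · congr 1
    · refine setLIntegral_congr_fun measurableSet_Ico fun θ hθ => ?_
      rw [if_neg (not_lt.2 hθ.1)]
    · have e : Set.Ioo (-Real.pi) 0 = (fun θ : ℝ => θ + 2 * Real.pi) ⁻¹'
          Set.Ioo Real.pi (2 * Real.pi) := by
        ext θ
        simp only [Set.mem_Ioo, Set.mem_preimage]
        constructor <;> rintro ⟨h3, h4⟩ <;> constructor <;> linarith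
      rw [setLIntegral_congr (Ioo_ae_eq_Ico (a := Real.pi) (b := 2 * Real.pi)).symm,
        ← (measurePreserving_add_right volume (2 * Real.pi)).setLIntegral_comp_preimage_emb
        (measurableEmbedding_addRight _) g, ← e]
      refine setLIntegral_congr_fun measurableSet_Ioo fun θ hθ => ?_
      rw [if_pos hθ.2]
  · exact Set.disjoint_left.2 fun x h3 h4 => absurd h3.2 (not_lt.2 h4.1)
  · exact Set.disjoint_left.2 fun x h3 h4 => absurd h3.2 (not_lt.2 h4.1)

theorem measurable_polar : Measurable polar := by
  refine measurable_norm.prodMk ?_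
  exact Measurable.ite (Complex.measurable_arg measurableSet_Iio)
    (Complex.measurable_arg.add_const _) Complex.measurable_arg

/-- The polar coordinates of a measure on the plane with a rotation invariant density. -/
theorem map_polar_withDensity {D : ℝ → ℝ} (hD : Measurable D) :
    ((volume : Measure ℂ).withDensity fun z => ENNReal.ofReal (D ‖z‖)).map polar =
      (volume.restrict polarDomain).withDensity fun p => ENNReal.ofReal (p.1 * D p.1) := by
  ext S hS
  rw [Measure.map_apply measurable_polar hS, withDensity_apply _ (measurable_polar hS),
    withDensity_apply _ hS, ← lintegral_indicator (measurable_polar hS), ← lintegral_indicator hS,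
    ← Complex.lintegral_comp_polarCoord_symm]
  set Ψ : ℝ × ℝ → ENNReal := fun p => ENNReal.ofReal p.1 *
    S.indicator (fun p => ENNReal.ofReal (D p.1)) p with hΨ
  have hΨm : Measurable Ψ := (measurable_fst.ennreal_ofReal).mul
    ((hD.comp measurable_fst).ennreal_ofReal.indicator hS)
  have hl : ∀ p ∈ polarCoord.target, ENNReal.ofReal p.1 • (polar ⁻¹' S).indicator
      (fun z => ENNReal.ofReal (D ‖z‖)) (Complex.polarCoord.symm p) =
      Ψ (p.1, if p.2 < 0 then p.2 + 2 * Real.pi else p.2) := by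
    rintro ⟨r, θ⟩ hp
    rw [polarCoord_target] at hp
    have hr : 0 < r := hp.1
    have hθ : θ ∈ Set.Ioc (-Real.pi) Real.pi := Set.Ioo_subset_Ioc_self hp.2
    have hpol : polar (Complex.polarCoord.symm (r, θ)) =
        (r, if θ < 0 then θ + 2 * Real.pi else θ) := by
      have harg : (Complex.polarCoord.symm (r, θ)).arg = θ := by
        rw [Complex.polarCoord_symm_apply]
        simpa using Complex.arg_mul_cos_add_sin_mul_I hr hθ
      rw [polar, harg, Complex.norm_polarCoord_symm, abs_of_pos hr]
    simp only [hΨ, smul_eq_mul]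
    congr 1
    by_cases hmem : (r, if θ < 0 then θ + 2 * Real.pi else θ) ∈ S
    · rw [Set.indicator_of_mem hmem, Set.indicator_of_mem (by rw [Set.mem_preimage, hpol]; exact hmem),
        Complex.norm_polarCoord_symm, abs_of_pos hr]
    · rw [Set.indicator_of_notMem hmem,
        Set.indicator_of_notMem (by rw [Set.mem_preimage, hpol]; exact hmem)]
  have hrr : ∀ p ∈ polarDomain, S.indicator (fun p : ℝ × ℝ => ENNReal.ofReal (p.1 * D p.1)) p =
      Ψ p := by
    intro p hp
    have hr : (0 : ℝ) < p.1 := hp.1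
    simp only [hΨ]
    by_cases hmem : p ∈ S
    · rw [Set.indicator_of_mem hmem, Set.indicator_of_mem hmem, ENNReal.ofReal_mul hr.le]
    · rw [Set.indicator_of_notMem hmem, Set.indicator_of_notMem hmem, mul_zero]
  have hw : Measurable fun θ : ℝ => if θ < 0 then θ + 2 * Real.pi else θ :=
    Measurable.ite measurableSet_Iio (measurable_id.add_const _) measurable_id
  rw [setLIntegral_congr_fun polarCoord.open_target.measurableSet hl,
    setLIntegral_congr_fun measurableSet_polarDomain hrr, volume_restrict_polarCoord_target,
    volume_restrict_polarDomain, lintegral_prod _ hΨm.aemeasurable, lintegral_prod]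
  · refine lintegral_congr fun r => ?_
    exact lintegral_wrap_angle fun θ => Ψ (r, θ)
  · exact (hΨm.comp (measurable_fst.prodMk (hw.comp measurable_snd))).aemeasurable

open FourierTransform in
/-- The density of a finite measure on the plane with a radial integrable characteristic
function. -/
theorem map_polar_of_charFun {ν : Measure ℂ} [IsFiniteMeasure ν] {Φ : ℝ → ℝ}
    (hν : ∀ t, charFun ν t = (Φ ‖t‖ : ℂ)) (hΦ : IntegrableOn (fun κ => Φ κ * κ) (Set.Ioi 0)) :
    ν.map polar = (volume.restrict polarDomain).withDensity fun p => ENNReal.ofReal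
      (p.1 * ((2 * Real.pi)⁻¹ * ∫ κ in Set.Ioi (0 : ℝ), Φ κ * κ * besselJ0 (κ * p.1))) := by
  have hInt : Integrable (charFun ν) := by
    have h1 : Integrable (fun t : ℂ => Φ ‖t‖) := by
      rw [integrable_fun_norm_addHaar (volume : Measure ℂ) (f := Φ), Complex.finrank_real_complex]
      refine hΦ.congr (Filter.Eventually.of_forall fun κ => ?_)
      simp [mul_comm]
    rw [funext hν]
    exact h1.ofReal
  have h2π : (2 * Real.pi) ≠ 0 := Real.two_pi_pos.ne'
  have hInt' : Integrable fun ξ : ℂ => charFun ν ((2 * Real.pi) • ξ) := hInt.comp_smul h2π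
  set h := 𝓕 (fun ξ : ℂ => charFun ν ((2 * Real.pi) • ξ)) with hh
  have hcont : Continuous h := continuous_fourier_of_integrable hInt'
  -- Rescaling the frequency by `2π` in the plane gives `(2π)⁻²`, and the angular integral returns
  -- one factor `2π`.
  have hval : ∀ z : ℂ, (h z).re =
      (2 * Real.pi)⁻¹ * ∫ κ in Set.Ioi (0 : ℝ), Φ κ * κ * besselJ0 (κ * ‖z‖) := by
    intro z
    have e1 : h z = ∫ ξ : ℂ, Complex.exp (((-(inner ℝ ((2 * Real.pi) • ξ) z) : ℝ) : ℂ) *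
        Complex.I) • charFun ν ((2 * Real.pi) • ξ) := by
      rw [hh, Real.fourier_eq']
      congr 1
      ext ξ
      rw [real_inner_smul_left]
      congr 4
      ring
    rw [Measure.integral_comp_smul volume (fun t : ℂ => Complex.exp (((-(inner ℝ t z) : ℝ) : ℂ) *
      Complex.I) • charFun ν t) (2 * Real.pi)] at e1
    have hI : Integrable fun t : ℂ => Complex.exp (((-(inner ℝ t z) : ℝ) : ℂ) * Complex.I) •
        charFun ν t := by
      refine hInt.bdd_mul (c := 1) ?_ (Filter.Eventually.of_forall fun t => ?_)
      · exact Continuous.aestronglyMeasurable (by fun_prop)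
      · rw [Complex.norm_exp_ofReal_mul_I]
    have e2 : (∫ t : ℂ, Complex.exp (((-(inner ℝ t z) : ℝ) : ℂ) * Complex.I) • charFun ν t).re =
        ∫ t : ℂ, Real.cos (inner ℝ t z) * Φ ‖t‖ := by
      rw [← RCLike.re_eq_complex_re, ← integral_re hI]
      congr 1
      ext t
      rw [hν, smul_eq_mul, RCLike.re_eq_complex_re, Complex.re_mul_ofReal,
        Complex.exp_ofReal_mul_I_re, Real.cos_neg]
    rw [e1, Complex.smul_re, e2, integral_cos_inner_mul_radial hΦ, Complex.finrank_real_complex,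
      abs_of_pos (by positivity), smul_eq_mul]
    generalize ∫ κ in Set.Ioi (0 : ℝ), Φ κ * κ * besselJ0 (κ * ‖z‖) = I
    field_simp
  have hD : ∀ z : ℂ, (h z).re = (h ((‖z‖ : ℝ) : ℂ)).re := by
    intro z
    rw [hval, hval]
    simp
  have hmeas : Measurable fun r : ℝ => (h (r : ℂ)).re :=
    (Complex.continuous_re.comp (hcont.comp Complex.continuous_ofReal)).measurable
  have hden := eq_withDensity_fourier_charFun ν hInt'
  rw [hden]
  change (volume.withDensity fun z : ℂ => ENNReal.ofReal (h z).re).map polar = _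
  rw [show (fun z : ℂ => ENNReal.ofReal (h z).re) = fun z : ℂ => ENNReal.ofReal
    ((fun r : ℝ => (h (r : ℂ)).re) ‖z‖) from funext fun z => by rw [hD z], map_polar_withDensity hmeas]
  refine withDensity_congr_ae ?_
  filter_upwards [ae_restrict_mem measurableSet_polarDomain] with p hp
  have hp0 : (0 : ℝ) < p.1 := hp.1
  rw [hval]
  simp [abs_of_pos hp0]

/-! ### Polynomial test functions -/

theorem polar_fst_mul_exp (z : ℂ) :
    ((polar z).1 : ℂ) * Complex.exp (Complex.I * (polar z).2) = z := by
  have h : Complex.exp (Complex.I * (polar z).2) = Complex.exp (z.arg * Complex.I) := by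
    simp only [polar]
    split_ifs
    · push_cast
      rw [mul_comm, add_mul, Complex.exp_add, Complex.exp_two_pi_mul_I, mul_one]
    · rw [mul_comm]
  rw [h]
  exact Complex.norm_mul_exp_arg_mul_I z

theorem polar_fst_mul_exp_neg (z : ℂ) :
    ((polar z).1 : ℂ) * Complex.exp (-Complex.I * (polar z).2) = (starRingEnd ℂ) z := by
  conv_rhs => rw [← polar_fst_mul_exp z]
  simp [← Complex.exp_conj]

theorem testValue_polar (φ : MvPolynomial (Fin 2) ℂ) (z : ℂ) :
    testValue φ (polar z) =
      ∑ s ∈ φ.support, φ.coeff s * (z ^ s 0 * (starRingEnd ℂ) z ^ s 1) := by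
  rw [testValue, MvPolynomial.eval_eq']
  simp only [Fin.prod_univ_two, Matrix.cons_val_zero, Matrix.cons_val_one, polar_fst_mul_exp,
    polar_fst_mul_exp_neg]

theorem testValue_eq_sum (φ : MvPolynomial (Fin 2) ℂ) (p : ℝ × ℝ) :
    testValue φ p = ∑ s ∈ φ.support, φ.coeff s * monomialValue (s 0) (s 1) p := by
  rw [testValue, MvPolynomial.eval_eq']
  simp only [Fin.prod_univ_two, Matrix.cons_val_zero, Matrix.cons_val_one, monomialValue]

theorem testValue_mul_truncDensity (φ : MvPolynomial (Fin 2) ℂ) (V : ℝ) (q : ℕ → ℝ) (J : ℕ)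
    (p : ℝ × ℝ) : testValue φ p * (truncDensity V q J p : ℂ) = ∑ s ∈ φ.support, φ.coeff s *
      (monomialValue (s 0) (s 1) p * (truncDensity V q J p : ℂ)) := by
  rw [testValue_eq_sum, Finset.sum_mul]
  exact Finset.sum_congr rfl fun s _ => mul_assoc _ _ _

theorem integrableOn_testValue_mul_truncDensity (φ : MvPolynomial (Fin 2) ℂ) (V : ℝ) (q : ℕ → ℝ)
    (J : ℕ) : IntegrableOn (fun p => testValue φ p * (truncDensity V q J p : ℂ)) polarDomain := by
  simp only [testValue_mul_truncDensity]
  exact integrable_finsetSum _ fun s _ =>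
    (integrableOn_monomialValue_mul_truncDensity V q J (s 0) (s 1)).const_mul _

theorem integral_testValue_mul_truncDensity (φ : MvPolynomial (Fin 2) ℂ) (V : ℝ) (q : ℕ → ℝ)
    (J : ℕ) : ∫ p in polarDomain, testValue φ p * (truncDensity V q J p : ℂ) =
      ∑ s ∈ φ.support, φ.coeff s * ((if s 0 = s 1 then ((s 0).factorial : ℝ) ^ 2 *
        ∑ j ∈ Finset.range J, V⁻¹ ^ j *
          expCoeff (s 0) (PowerSeries.coeff j (formalExp (exponent q))) else 0 : ℝ) : ℂ) := by
  simp only [testValue_mul_truncDensity]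
  rw [integral_finsetSum _ fun s _ =>
    (integrableOn_monomialValue_mul_truncDensity V q J (s 0) (s 1)).const_mul _]
  refine Finset.sum_congr rfl fun s _ => ?_
  rw [integral_const_mul, integral_monomialValue_mul_truncDensity]
  split_ifs <;> simp

/-! ### Comparison of the law of a mode with the truncated and closed densities -/

namespace PeriodicField

variable {d : ℕ} (F : PeriodicField.{u} d) {k : Fin d → ℤ}

theorem integrable_testValue (φ : MvPolynomial (Fin 2) ℂ) :
    Integrable (fun ω => testValue φ (polar (F.α k ω))) F.μ := by
  simp only [testValue_polar]
  exact integrable_finsetSum _ fun s _ => (F.integrable_α k (s 0) (s 1)).const_mul _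

theorem integral_testValue (hk : k ≠ 0) (hP : 0 < F.powerSpectrum k)
    (φ : MvPolynomial (Fin 2) ℂ) :
    ∫ ω, testValue φ (polar (F.α k ω)) ∂F.μ = ∑ s ∈ φ.support, φ.coeff s *
      ((if s 0 = s 1 then ((s 0).factorial : ℝ) ^ 2 * F.normMoment k (s 0) else 0 : ℝ) : ℂ) := by
  simp only [testValue_polar]
  rw [integral_finsetSum _ fun s _ => (F.integrable_α k (s 0) (s 1)).const_mul _]
  refine Finset.sum_congr rfl fun s _ => ?_
  rw [integral_const_mul, F.integral_α hk hP]

theorem sum_expCoeff_eq_normMoment (hk : k ≠ 0) (hP : 0 < F.powerSpectrum k) {a n : ℕ}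
    (h : a < n) : ∑ j ∈ Finset.range n, F.V⁻¹ ^ j *
      expCoeff a (PowerSeries.coeff j (formalExp (exponent (F.q k)))) = F.normMoment k a :=
  sum_expCoeff_eq (F.q k) F.V⁻¹ (F.normMoment k) (F.normMoment_zero k)
    (F.normMoment_recursion hk hP) h

/-- Polynomials of degree below the order of truncation are integrated exactly. -/
theorem integral_testValue_eq (hk : k ≠ 0) (hP : 0 < F.powerSpectrum k)
    (φ : MvPolynomial (Fin 2) ℂ) {J : ℕ} (hJ : φ.totalDegree < J) :
    ∫ ω, testValue φ (polar (F.α k ω)) ∂F.μ =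
      ∫ p in polarDomain, testValue φ p * (truncDensity F.V (F.q k) J p : ℂ) := by
  rw [F.integral_testValue hk hP, integral_testValue_mul_truncDensity]
  refine Finset.sum_congr rfl fun s hs => ?_
  -- Only the exponent of `α_k` has to stay below `J`; for a diagonal monomial this is half its
  -- degree.
  have hd : s 0 ≤ φ.totalDegree := by
    refine le_trans ?_ (MvPolynomial.le_totalDegree hs)
    rw [Finsupp.sum_fintype _ _ (fun _ => rfl), Fin.sum_univ_two]
    exact Nat.le_add_right _ _
  rw [F.sum_expCoeff_eq_normMoment hk hP (hd.trans_lt hJ)]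

/-- The moments of a mode differ from their truncated expansions by `O(V⁻ᴶ)`. -/
theorem abs_normMoment_sub_le (hk : k ≠ 0) (hP : 0 < F.powerSpectrum k) {V₀ : ℝ} (hV₀ : 0 < V₀)
    (hV : V₀ ≤ F.V) {Q : ℕ → ℝ} (hQ : ∀ n, 2 ≤ n → |F.q k n| ≤ Q n) (a J : ℕ) :
    |F.normMoment k a - ∑ j ∈ Finset.range J, F.V⁻¹ ^ j *
      expCoeff a (PowerSeries.coeff j (formalExp (exponent (F.q k))))| ≤
      F.V⁻¹ ^ J * ∑ i ∈ Finset.range (a + 1), V₀⁻¹ ^ i *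
        expCoeff a (PowerSeries.coeff (J + i) (formalExp (exponent Q))) := by
  -- The moment is itself a truncated sum of length `J + (a + 1) > a`, so the difference is a block
  -- of `a + 1` terms with the common factor `V^{-J}`.
  rw [← F.sum_expCoeff_eq_normMoment hk hP (show a < J + (a + 1) by omega),
    Finset.sum_range_add, add_sub_cancel_left, Finset.mul_sum]
  refine (Finset.abs_sum_le_sum_abs _ _).trans (Finset.sum_le_sum fun i _ => ?_)
  have hVp : 0 ≤ F.V⁻¹ := inv_nonneg.2 F.V_pos.le
  have hle : F.V⁻¹ ≤ V₀⁻¹ := inv_anti₀ hV₀ hV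
  rw [abs_mul, abs_of_nonneg (pow_nonneg hVp _), pow_add, mul_assoc]
  gcongr
  exact abs_expCoeff_coeff_formalExp_le hQ a (J + i)

/-- The truncated density leaves an error `O(V⁻ᴶ)` against a polynomial, uniformly over the
fields with bounded collapsed polyspectra. -/
theorem norm_integral_testValue_sub_le (hk : k ≠ 0) (hP : 0 < F.powerSpectrum k) {V₀ : ℝ}
    (hV₀ : 0 < V₀) (hV : V₀ ≤ F.V) {Q : ℕ → ℝ} (hQ : ∀ n, 2 ≤ n → |F.q k n| ≤ Q n) (J : ℕ)
    (φ : MvPolynomial (Fin 2) ℂ) :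
    ‖∫ ω, testValue φ (polar (F.α k ω)) ∂F.μ -
      ∫ p in polarDomain, testValue φ p * (truncDensity F.V (F.q k) J p : ℂ)‖ ≤
      (∑ s ∈ φ.support, ‖φ.coeff s‖ * if s 0 = s 1 then ((s 0).factorial : ℝ) ^ 2 *
        ∑ i ∈ Finset.range (s 0 + 1), V₀⁻¹ ^ i *
          expCoeff (s 0) (PowerSeries.coeff (J + i) (formalExp (exponent Q))) else 0) /
        F.V ^ J := by
  rw [F.integral_testValue hk hP, integral_testValue_mul_truncDensity, ← Finset.sum_sub_distrib,
    Finset.sum_div]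
  refine (norm_sum_le _ _).trans (Finset.sum_le_sum fun s _ => ?_)
  rw [← mul_sub, norm_mul, mul_div_assoc, ← Complex.ofReal_sub, Complex.norm_real]
  gcongr
  split_ifs
  · rw [← mul_sub, norm_mul, mul_div_assoc, Real.norm_of_nonneg (by positivity), Real.norm_eq_abs]
    gcongr
    rw [div_eq_mul_inv, ← inv_pow, mul_comm _ (F.V⁻¹ ^ J)]
    exact F.abs_normMoment_sub_le hk hP hV₀ hV hQ (s 0) J
  · simp

/-- Where the exponential of the operator exists, the polar coordinates of a mode have the closed
density. -/
theorem map_polar_α (hk : k ≠ 0) (hP : 0 < F.powerSpectrum k)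
    (hs : ∀ x : ℝ, Summable (symbolTerm F.V (F.q k) x))
    (hi : IntegrableOn (fun κ => expSymbol F.V (F.q k) (-κ ^ 2) * hankel gauss κ * κ)
      (Set.Ioi 0)) :
    F.μ.map (fun ω => polar (F.α k ω)) = (volume.restrict polarDomain).withDensity
      fun p => ENNReal.ofReal (closedDensity F.V (F.q k) p) := by
  -- The factor 2 undoes the `1/2` in the Hankel transform of the Gaussian and turns the prefactor
  -- `1/(2π)` of the inversion into `1/π`.
  have hΦ : ∀ κ, Real.exp (-κ ^ 2 / 4) * expSymbol F.V (F.q k) (-κ ^ 2) =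
      2 * (expSymbol F.V (F.q k) (-κ ^ 2) * hankel gauss κ) := fun κ => by
    rw [hankel_gauss]; ring
  have hmap : F.μ.map (fun ω => polar (F.α k ω)) = (F.μ.map (F.α k)).map polar :=
    (AEMeasurable.map_map_of_aemeasurable measurable_polar.aemeasurable
      (F.aemeasurable_α k)).symm
  have hprob : IsProbabilityMeasure (F.μ.map (F.α k)) :=
    Measure.isProbabilityMeasure_map (F.aemeasurable_α k)
  rw [hmap, map_polar_of_charFun
    (Φ := fun κ => 2 * (expSymbol F.V (F.q k) (-κ ^ 2) * hankel gauss κ))]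
  · congr 1
    funext p
    congr 1
    rw [closedDensity, radialCalculus, div_eq_mul_inv, mul_assoc, ← integral_const_mul,
      ← integral_const_mul (Real.pi⁻¹)]
    refine congrArg (p.1 * ·) (integral_congr_ae (Filter.Eventually.of_forall fun κ => ?_))
    simp only [mul_inv]
    ring
  · intro t
    rw [F.charFun_α hk hP hs t, hΦ]
  · simpa only [IntegrableOn, mul_assoc] using hi.const_mul 2

end PeriodicField

end FourierModes

open FourierModes in
theorem mainTheorem3 {d : ℕ} :
    -- one field in one box, one mode `k ≠ 0` with non-zero power
    (∀ (F : PeriodicField.{u} d) (k : Fin d → ℤ), k ≠ 0 → 0 < F.powerSpectrum k →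
      -- the collapsed polyspectra are real
      (∀ n, (F.collapsed k n : ℂ) = (F.q k n : ℂ)) ∧
      -- the closed form holds to all orders in `V⁻¹`, against every polynomial in `α_k`, `α_{-k}`
      (∀ φ : MvPolynomial (Fin 2) ℂ,
        Integrable (fun ω => testValue φ (polar (F.α k ω))) F.μ ∧
        (∀ J, IntegrableOn (fun p => testValue φ p * (truncDensity F.V (F.q k) J p : ℂ))
          polarDomain) ∧
        ∀ J, φ.totalDegree < J →
          ∫ ω, testValue φ (polar (F.α k ω)) ∂F.μ =
            ∫ p in polarDomain, testValue φ p * (truncDensity F.V (F.q k) J p : ℂ)) ∧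
      -- where the exponential of the operator exists, the closed form is the density of `(A, θ)`
      ((∀ x : ℝ, Summable (symbolTerm F.V (F.q k) x)) →
        IntegrableOn (fun κ => expSymbol F.V (F.q k) (-κ ^ 2) * hankel gauss κ * κ)
          (Set.Ioi 0) →
        F.μ.map (fun ω => polar (F.α k ω)) =
          (volume.restrict polarDomain).withDensity
            (fun p => ENNReal.ofReal (closedDensity F.V (F.q k) p)))) ∧
    -- on powers, the calculus used in the closed form is the iterated differential operator
    (∀ (n : ℕ) (A : ℝ), 0 < A →
      IntegrableOn (fun κ => (-κ ^ 2) ^ n * hankel gauss κ * κ) (Set.Ioi 0) ∧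
      radialCalculus (fun x => x ^ n) gauss A = (radialOp^[n] gauss) A) ∧
    -- the expansion to second order
    (∀ (V : ℝ) (q : ℕ → ℝ) (A θ : ℝ), 0 < A →
      truncDensity V q 3 (A, θ) = gaussDensity (A, θ) *
        (1 + 1 / V * ((1 / 4 * A ^ 4 - A ^ 2 + 1 / 2) * q 2) +
          1 / V ^ 2 *
            ((1 / 36 * A ^ 6 - 1 / 4 * A ^ 4 + 1 / 2 * A ^ 2 - 1 / 6) * q 3 +
              (1 / 32 * A ^ 8 - 1 / 2 * A ^ 6 + 9 / 4 * A ^ 4 - 3 * A ^ 2 + 3 / 4) *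
                q 2 ^ 2))) ∧
    -- the terms up to order `V^{-(J-1)}` leave an error `O(V^{-J})`, uniformly over all fields
    -- whose collapsed polyspectra obey fixed bounds
    (∀ (J : ℕ) (φ : MvPolynomial (Fin 2) ℂ) (Q : ℕ → ℝ) (V₀ : ℝ), 0 < V₀ →
      ∃ C : ℝ, ∀ (F : PeriodicField.{u} d) (k : Fin d → ℤ), k ≠ 0 → 0 < F.powerSpectrum k →
        V₀ ≤ F.V → (∀ n, 2 ≤ n → |F.q k n| ≤ Q n) →
        ‖∫ ω, testValue φ (polar (F.α k ω)) ∂F.μ -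
          ∫ p in polarDomain, testValue φ p * (truncDensity F.V (F.q k) J p : ℂ)‖
            ≤ C / F.V ^ J) := by
  refine ⟨fun F k hk hP => ⟨fun n => ?_, fun φ => ⟨F.integrable_testValue φ,
    fun J => integrableOn_testValue_mul_truncDensity φ _ _ J,
    fun J hJ => F.integral_testValue_eq hk hP φ hJ⟩, F.map_polar_α hk hP⟩,
    fun n A hA => ⟨integrableOn_pow_mul_hankel_gauss n, radialCalculus_pow_gauss n hA⟩,
    fun V q A θ hA => truncDensity_three V q A θ hA,
    fun J φ Q V₀ hV₀ => ⟨_, fun F k hk hP hV hQ =>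
      F.norm_integral_testValue_sub_le hk hP hV₀ hV hQ J φ⟩⟩
  rw [F.q_eq hk n, F.collapsed_eq hk n]
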